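/- Let $L^2[0,1]$ carry its usual inner product and the trigonometric basis $\psi_1=1$, $\psi_{2k}(t)=\sqrt2\cos(2\pi kt)$, $\psi_{2k+1}(t)=\sqrt2\sin(2\pi kt)$ $(k\ge 1)$. For $p>0$ let $b_1=1$, $b_{2j}=b_{2j+1}=j^{2p}$ $(j\ge1)$, and for $\rho>0$ let $\mathcal W_p^\rho=\{f\in L^2[0,1]:\sum_{j\ge1}b_j\langle f,\psi_j\rangle^2\le\rho\}$. Let $X$ be a centred random element of $L^2[0,1]$ with $E\|X\|^2<\infty$ and strictly positive covariance operator $\Gamma f=E[\langle X,f\rangle X]$, and let $\epsilon$ be a centred real random variable with variance one which is uncorrelated with $X$, i.e. $E[\epsilon X]=0$. For $\beta\in L^2[0,1]$ and $\sigma>0$ put $Y=\langle\beta,X\rangle+\sigma\epsilon$, and let $(Y_i,X_i)$, $1\le i\le n$, come from $n$ independent copies $(X_i,\epsilon_i)$ of $(X,\epsilon)$. For a function $f$ and an operator $K$ write $[f]_m=(\langle f,\psi_i\rangle)_{i\le m}$ and $[K]_m=(\langle K\psi_j,\psi_i\rangle)_{i,j\le m}$. Assume, for some $\eta\ge1$ and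 $k\in\mathbb N$, that $E|\epsilon|^{4k}\le\eta$, $E|\langle X,\psi_j\rangle/\langle\Gamma\psi_j,\psi_j\rangle^{1/2}|^{4k}\le\eta$ for all $j\ge 1$, and $E|([\Gamma]_m^{-1/2}[X]_m)_j|^{4k}\le\eta$ for all $1\le j\le m$, $m\ge 1$. Assume also, for some $d\ge1$ and a positive sequence $\upsilon=(\upsilon_j)_{j\ge1}$, the link condition $d^{-2}\sum_j\upsilon_j^2\langle f,\psi_j\rangle^2\le\|\Gamma f\|^2\le d^2\sum_j\upsilon_j^2\langle f,\psi_j\rangle^2$ for all $f\in L^2[0,1]$. Let $\widehat\Gamma=n^{-1}\sum_i\langle X_i,\cdot\rangle X_i$ and $\widehat g=n^{-1}\sum_iY_iX_i$. The estimator with dimension $m=m(n)$ and threshold $\gamma=n$ is $\widehat\beta=\sum_{l\le m}([\widehat\Gamma]_m^{-1}[\widehat g]_m)_l\,\psi_l$ if $[\widehat\Gamma]_m$ is nonsingular with $\|[\widehat\Gamma]_m^{-1}\|\le\gamma$ (spectral norm), and $\widehat\beta=0$ otherwise. Write $\|f\|_\Gamma^2=\langle\Gamma f,f\rangle$, and $u_n\sim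 v_n$ if each of $u_n$, $v_n$ is at most a constant times the other for all large $n$. In the following bounds "for all large $n$" and the constant $C$ may depend on $a,p,\rho,d,\sigma,\eta,k$ and the sequence $m(\cdot)$, but not otherwise on the distribution of $(X,\epsilon)$. (i) Polynomial case: let $\upsilon_1=1$ and $\upsilon_j=j^{-2a}$ $(j\ge2)$ with $a>1/2$. If $k\ge2+8/(2p+2a-1)$ and $m\sim n^{1/(2p+2a+1)}$, then there is $C>0$ such that for all large $n$ $$\sup_{\beta\in\mathcal W_p^\rho}E\|\widehat\beta-\beta\|_\Gamma^2\le C\,n^{-(2p+2a)/(2p+2a+1)}.$$ (ii) Exponential case: let $\upsilon_1=1$ and $\upsilon_j=\exp(-j^{2a})$ $(j\ge2)$ with $a>0$, and let $k\ge4$. If $m\sim(\log n)^{1/(2a)}$ and if, for some $D\ge1$ and all large $n$, $$\frac{m}{\upsilon_m}\le D\,n\qquad\text{and}\qquad n\le D\,(m+1)\,\frac{b_{m+1}}{\upsilon_{m+1}},\qquad(\ast)$$ then there is $C>0$ such that for all large $n$ $$\sup_{\beta\in\mathcal W_p^\rho}E\|\widehat\beta-\beta\|_\Gamma^2\le C\,n^{-1}(\log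 n)^{1/(2a)}.$$ Moreover, for every $a>0$ there is a sequence $m\sim(\log n)^{1/(2a)}$, depending on $a$ only, that satisfies $(\ast)$ for every $p>0$. -/

import Mathlib

open MeasureTheory ProbabilityTheory Filter Asymptotics
open scoped ENNReal RealInnerProductSpace

universe u

namespace FLR

noncomputable section

/-! ### The space `L²[0,1]` and the trigonometric basis -/

/-- The Hilbert space `L²[0,1]` of real square integrable functions. -/
abbrev L2I : Type := Lp ℝ 2 (volume.restrict (Set.Icc (0 : ℝ) 1))

instance : MeasurableSpace L2I := borel L2I

instance : BorelSpace L2I := ⟨rfl⟩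

/-- The trigonometric functions, numbered from `1`: `ψ₁ = 1`, `ψ_{2k}(t) = √2 cos(2πkt)`,
`ψ_{2k+1}(t) = √2 sin(2πkt)` for `k ≥ 1`. The index `0` is never used. -/
def trigFun (j : ℕ) (t : ℝ) : ℝ :=
  if j ≤ 1 then 1
  else if Even j then √2 * Real.cos (2 * Real.pi * ((j / 2 : ℕ) : ℝ) * t)
  else √2 * Real.sin (2 * Real.pi * ((j / 2 : ℕ) : ℝ) * t)

theorem continuous_trigFun (j : ℕ) : Continuous (trigFun j) := by
  unfold trigFun
  split_ifs <;> fun_prop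

theorem memLp_trigFun (j : ℕ) :
    MemLp (trigFun j) 2 (volume.restrict (Set.Icc (0 : ℝ) 1)) := by
  refine MemLp.of_bound (continuous_trigFun j).aestronglyMeasurable (√2) (ae_of_all _ fun t => ?_)
  have h1 : (1 : ℝ) ≤ √2 := by
    rw [Real.one_le_sqrt]
    norm_num
  rw [Real.norm_eq_abs]
  unfold trigFun
  split_ifs
  · rw [abs_one]
    exact h1
  · rw [abs_mul, abs_of_nonneg (Real.sqrt_nonneg 2)]
    exact mul_le_of_le_one_right (Real.sqrt_nonneg 2) (Real.abs_cos_le_one _)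
  · rw [abs_mul, abs_of_nonneg (Real.sqrt_nonneg 2)]
    exact mul_le_of_le_one_right (Real.sqrt_nonneg 2) (Real.abs_sin_le_one _)

/-- The trigonometric basis `(ψ_j)_{j ≥ 1}` as elements of `L²[0,1]`. -/
def psi (j : ℕ) : L2I := (memLp_trigFun j).toLp (trigFun j)

/-! ### Weights, weighted norms, ellipsoids -/

/-- `‖f‖_w² = ∑_{j ≥ 1} w_j |⟨f, ψ_j⟩|²`, with values in `[0, ∞]`. -/
def weightedSq (w : ℕ → ℝ) (f : L2I) : ℝ≥0∞ :=
  ∑' i : ℕ, ENNReal.ofReal (w (i + 1) * ⟪f, psi (i + 1)⟫ ^ 2)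

/-- The Sobolev weights `b₁ = 1`, `b_{2j} = b_{2j+1} = j^{2p}`. -/
def sobolevWeight (p : ℝ) (j : ℕ) : ℝ :=
  if j ≤ 1 then 1 else ((j / 2 : ℕ) : ℝ) ^ (2 * p)

/-- The periodic Sobolev ellipsoid of smoothness `p` and radius `ρ`. -/
def sobolevEllipsoid (p ρ : ℝ) : Set L2I :=
  {f | weightedSq (sobolevWeight p) f ≤ ENNReal.ofReal ρ}

/-- Polynomial decay: `υ₁ = 1`, `υ_j = j^{-2a}` for `j ≥ 2`. -/
def polyWeight (a : ℝ) (j : ℕ) : ℝ :=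
  if j ≤ 1 then 1 else (j : ℝ) ^ (-(2 * a))

/-- Exponential decay: `υ₁ = 1`, `υ_j = exp(-j^{2a})` for `j ≥ 2`. -/
def expWeight (a : ℝ) (j : ℕ) : ℝ :=
  if j ≤ 1 then 1 else Real.exp (-((j : ℝ) ^ (2 * a)))

/-! ### Covariance operator, link condition, moment classes -/

/-- The first `m` coordinates `(⟨f, ψ_1⟩, …, ⟨f, ψ_m⟩)` of `f`. -/
def coords (m : ℕ) (f : L2I) : Fin m → ℝ := fun i => ⟪f, psi (i + 1)⟫

/-- The `m × m` matrix with entries `⟨K ψ_j, ψ_i⟩`, `1 ≤ i, j ≤ m`. -/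
def opMatrix (m : ℕ) (K : L2I → L2I) : Matrix (Fin m) (Fin m) ℝ :=
  Matrix.of fun i j => ⟪K (psi (j + 1)), psi (i + 1)⟫

/-- `A^{-1/2}` for a symmetric positive definite matrix `A`. -/
def invSqrt {m : ℕ} (A : Matrix (Fin m) (Fin m) ℝ) : Matrix (Fin m) (Fin m) ℝ :=
  cfc (fun x : ℝ => (√x)⁻¹) A

/-- The covariance operator `Γ f = E[⟨X, f⟩ X]` of a centred square integrable random function. -/
def covOp {Ω : Type u} [MeasurableSpace Ω] (P : Measure Ω) (X : Ω → L2I) : L2I →L[ℝ] L2I :=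
  covarianceOperator (P.map X)

/-- `‖f‖_Γ² = ⟨Γ f, f⟩`. -/
def gammaSq (Γ : L2I →L[ℝ] L2I) (f : L2I) : ℝ := ⟪Γ f, f⟫

/-- The link condition `‖f‖_{υ²}² / d² ≤ ‖Γ f‖² ≤ d² ‖f‖_{υ²}²` for all `f`. It is imposed on
covariance operators of square integrable random functions only, which are always self-adjoint
and nuclear. -/
def LinkCondition (υ : ℕ → ℝ) (d : ℝ) (Γ : L2I →L[ℝ] L2I) : Prop :=
  ∀ f : L2I,
    weightedSq (fun j => υ j ^ 2) f ≤ ENNReal.ofReal (d ^ 2 * ‖Γ f‖ ^ 2) ∧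
    ENNReal.ofReal (‖Γ f‖ ^ 2) ≤ ENNReal.ofReal (d ^ 2) * weightedSq (fun j => υ j ^ 2) f

/-- The centred random functions with finite second moment, strictly positive covariance operator,
and `K`-th moments of `⟨X, ψ_j⟩ / Γ_{jj}^{1/2}` and of the entries of the standardised vectors
`[Γ]_m^{-1/2} [X]_m` all bounded by `η`. -/
structure RegressorClass (K : ℕ) (η : ℝ) {Ω : Type u} [MeasurableSpace Ω] (P : Measure Ω)
    (X : Ω → L2I) : Prop where
  measurable : Measurable X
  memLp : MemLp X 2 P
  centred : ∫ ω, X ω ∂P = 0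
  pos : ∀ f : L2I, f ≠ 0 → 0 < ⟪covOp P X f, f⟫
  moment_coord : ∀ i : ℕ,
    ∫⁻ ω, ENNReal.ofReal
      (|⟪X ω, psi (i + 1)⟫ / √⟪covOp P X (psi (i + 1)), psi (i + 1)⟫| ^ K) ∂P
      ≤ ENNReal.ofReal η
  moment_std : ∀ (m : ℕ) (i : Fin m),
    ∫⁻ ω, ENNReal.ofReal
      (|(invSqrt (opMatrix m (covOp P X))).mulVec (coords m (X ω)) i| ^ K) ∂P
      ≤ ENNReal.ofReal η

/-- The centred error terms with variance one and `K`-th absolute moment at most `η`. -/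
structure ErrorClass (K : ℕ) (η : ℝ) {Ω : Type u} [MeasurableSpace Ω] (P : Measure Ω)
    (ε : Ω → ℝ) : Prop where
  measurable : Measurable ε
  centred : ∫ ω, ε ω ∂P = 0
  variance_one : ∫ ω, ε ω ^ 2 ∂P = 1
  moment : ∫⁻ ω, ENNReal.ofReal (|ε ω| ^ K) ∂P ≤ ENNReal.ofReal η

/-- `(X_i, ε_i)_{i < n}` are independent copies of `(X, ε)`. -/
structure IsSample (n : ℕ) {Ω : Type u} [MeasurableSpace Ω] (P : Measure Ω)
    (X : Ω → L2I) (ε : Ω → ℝ) (Xs : Fin n → Ω → L2I) (εs : Fin n → Ω → ℝ) : Prop where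
  indep : iIndepFun (fun i ω => (Xs i ω, εs i ω)) P
  ident : ∀ i, IdentDistrib (fun ω => (Xs i ω, εs i ω)) (fun ω => (X ω, ε ω)) P P

/-! ### The estimator -/

/-- The empirical covariance operator `n⁻¹ ∑ ⟨x_i, ·⟩ x_i`. -/
def empCov {n : ℕ} (x : Fin n → L2I) (f : L2I) : L2I := (n : ℝ)⁻¹ • ∑ i, ⟪x i, f⟫ • x i

/-- The empirical cross moment `n⁻¹ ∑ y_i x_i`. -/
def empCross {n : ℕ} (x : Fin n → L2I) (y : Fin n → ℝ) : L2I := (n : ℝ)⁻¹ • ∑ i, y i • x i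

open Classical in
/-- The thresholded projection estimator with dimension `m` and threshold `γ`: it is
`∑_{l ≤ m} ([Γ̂]_m⁻¹ [ĝ]_m)_l ψ_l` if `[Γ̂]_m` is nonsingular and its inverse has spectral norm at
most `γ`, and zero otherwise. -/
def estimator {n : ℕ} (m : ℕ) (γ : ℝ) (x : Fin n → L2I) (y : Fin n → ℝ) : L2I :=
  if IsUnit (opMatrix m (empCov x)).det ∧
      ‖Matrix.toEuclideanCLM (𝕜 := ℝ) (opMatrix m (empCov x))⁻¹‖ ≤ γ then
    ∑ l : Fin m, ((opMatrix m (empCov x))⁻¹.mulVec (coords m (empCross x y)) l) • psi (l + 1)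
  else 0

/-! ### The risk -/

/-- The mean prediction error `E ‖β̂ - β‖_Γ²` at the slope `β`, for the responses
`Y_i = ⟨β, X_i⟩ + σ ε_i` and covariance operator `Γ`. -/
def mpe {Ω : Type u} [MeasurableSpace Ω] (P : Measure Ω) (Γ : L2I →L[ℝ] L2I) {n : ℕ} (m : ℕ)
    (γ σ : ℝ) (Xs : Fin n → Ω → L2I) (εs : Fin n → Ω → ℝ) (β : L2I) : ℝ≥0∞ :=
  ∫⁻ ω, ENNReal.ofReal (gammaSq Γ
    (estimator m γ (fun i => Xs i ω) (fun i => ⟪β, Xs i ω⟫ + σ * εs i ω) - β)) ∂P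

/-- The estimator with dimension `m n` and threshold `γ = n` has maximal mean prediction error over
the Sobolev ellipsoid of order `rate n`, with a constant that does not depend on the distribution
of `(X, ε)` within the class given by the moment bounds and the link condition. The regressor and
the error are only assumed to be uncorrelated. -/
def HasMPERate (υ : ℕ → ℝ) (p ρ d σ η : ℝ) (k : ℕ) (m : ℕ → ℕ) (rate : ℕ → ℝ) : Prop :=
  ∃ C : ℝ, 0 < C ∧ ∃ N : ℕ, ∀ n : ℕ, N ≤ n →
    ∀ (Ω : Type u) [MeasurableSpace Ω] (P : Measure Ω) [IsProbabilityMeasure P]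
      (X : Ω → L2I) (ε : Ω → ℝ) (Xs : Fin n → Ω → L2I) (εs : Fin n → Ω → ℝ),
      RegressorClass (4 * k) η P X →
      ErrorClass (4 * k) η P ε →
      ∫ ω, ε ω • X ω ∂P = 0 →
      LinkCondition υ d (covOp P X) →
      IsSample n P X ε Xs εs →
      ⨆ β ∈ sobolevEllipsoid p ρ, mpe P (covOp P X) (m n) (n : ℝ) σ Xs εs β
        ≤ ENNReal.ofReal (C * rate n)

/-- For some `D ≥ 1` and all large `n`,
`m / υ_m ≤ D n` and `n ≤ D (m + 1) b_{m+1} / υ_{m+1}` with `m = m(n)` and the Sobolev weights `b`: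
the dimension is, up to constants and integer rounding, not beyond the largest one at which the
threshold `n` is harmless and not below the one that balances bias and variance. -/
def BalancedDim (υ : ℕ → ℝ) (p : ℝ) (m : ℕ → ℕ) : Prop :=
  ∃ D : ℝ, 1 ≤ D ∧ ∀ᶠ n : ℕ in atTop,
    (m n : ℝ) / υ (m n) ≤ D * n ∧
    (n : ℝ) ≤ D * ((m n + 1 : ℕ) * sobolevWeight p (m n + 1) / υ (m n + 1))

end

end FLR

/-!
The prediction error of the thresholded Galerkin estimator is at most a multiple of
`υ_{m+1} / b_{m+1} + m / n`, uniformly over the model (`mpe_le`), and the dimensions of the two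
cases balance these terms.

*Half powers.* The link condition compares `Γ²` with a diagonal operator, while the prediction error
is measured by `Γ`. Since the square root is operator monotone (`inner_apply_le_of_norm_apply_le`),
the comparison passes to `Γ` itself: `⟨Γf, f⟩` is at least `υ_m ‖f‖² / d` on the span of
`ψ_1, …, ψ_m` and at most `d υ_{m+1} ‖f‖²` on its orthogonal complement. The link condition and the
strict positivity of `Γ` also give the completeness of the trigonometric system
(`IsLinked.eq_zero_of_inner_psi`), so that it need not be proved separately.

*Bias and variance.* The `Γ`-orthogonal projection of `β` onto the span, its Galerkin approximation,
has squared bias at most `d ρ υ_{m+1} / b_{m+1}` (`IsLinked.exists_galerkin`). Its residual is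
uncorrelated with `[X]_m`, so the standardised mean score `V` is a mean of `n` centred vectors, and
`E|V|² ≤ C m / n`. Where the empirical second moments dominate half of the population ones, the
threshold is met and the loss is at most the squared bias plus `4|V|²`
(`gammaSq_estimator_sub_le`).

*The bad event.* Only a lower bound of the empirical second moments is needed, so the standardised
vectors may be truncated at the level `|z|² ≤ L`; the moment condition keeps most of the second
moment, and Bernstein's inequality for the entries bounds the probability of the complement by
`2 m² exp(-c n / (m L))` (`exists_bad_set`). There the threshold `n` only loses a power of `n`, which
the exponential absorbs as soon as `m L` is `O(n^{1 - τ})`; the lower bounds on `k` ensure this.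
-/

namespace FLR

/-! ### Orthonormality of the trigonometric system -/

theorem integral_cos_two_pi_mul {k : ℤ} (hk : k ≠ 0) :
    ∫ t in (0 : ℝ)..1, Real.cos (2 * Real.pi * k * t) = 0 := by
  have h : (2 * Real.pi * k : ℝ) ≠ 0 := by
    have : (k : ℝ) ≠ 0 := by exact_mod_cast hk
    positivity
  rw [intervalIntegral.integral_comp_mul_left (fun x => Real.cos x) h, integral_cos]
  have : Real.sin (2 * Real.pi * k * 1) = 0 := by
    rw [show 2 * Real.pi * k * 1 = ((2 * k : ℤ) : ℝ) * Real.pi by push_cast; ring]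
    exact Real.sin_int_mul_pi _
  rw [this]
  simp

theorem integral_sin_two_pi_mul (k : ℤ) :
    ∫ t in (0 : ℝ)..1, Real.sin (2 * Real.pi * k * t) = 0 := by
  rcases eq_or_ne k 0 with rfl | hk
  · simp
  have h : (2 * Real.pi * k : ℝ) ≠ 0 := by
    have : (k : ℝ) ≠ 0 := by exact_mod_cast hk
    positivity
  rw [intervalIntegral.integral_comp_mul_left (fun x => Real.sin x) h, integral_sin]
  have : Real.cos (2 * Real.pi * k * 1) = 1 := by
    rw [show 2 * Real.pi * k * 1 = (k : ℝ) * (2 * Real.pi) by ring]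
    exact Real.cos_int_mul_two_pi _
  rw [this]
  simp

theorem inner_psi_eq_integral (i j : ℕ) :
    ⟪psi i, psi j⟫ = ∫ t in (0 : ℝ)..1, trigFun i t * trigFun j t := by
  rw [L2.inner_def, intervalIntegral.integral_of_le zero_le_one, ← integral_Icc_eq_integral_Ioc]
  refine integral_congr_ae ?_
  filter_upwards [(memLp_trigFun i).coeFn_toLp, (memLp_trigFun j).coeFn_toLp] with t h1 h2
  simp only [psi, h1, h2]
  simp [mul_comm]

theorem trigFun_one : trigFun 1 = fun _ => 1 := by
  ext t
  simp [trigFun]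

theorem trigFun_even {k : ℕ} (hk : 1 ≤ k) (t : ℝ) :
    trigFun (2 * k) t = √2 * Real.cos (2 * Real.pi * k * t) := by
  rw [trigFun, if_neg (by omega), if_pos (even_two_mul k), Nat.mul_div_cancel_left k two_pos]

theorem trigFun_odd {k : ℕ} (hk : 1 ≤ k) (t : ℝ) :
    trigFun (2 * k + 1) t = √2 * Real.sin (2 * Real.pi * k * t) := by
  rw [trigFun, if_neg (by omega), if_neg (by simp), show (2 * k + 1) / 2 = k by omega]

theorem inner_psi_even_even {k l : ℕ} (hk : 1 ≤ k) (hl : 1 ≤ l) :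
    ⟪psi (2 * k), psi (2 * l)⟫ = if k = l then 1 else 0 := by
  rw [inner_psi_eq_integral]
  have h (t : ℝ) : trigFun (2 * k) t * trigFun (2 * l) t =
      Real.cos (2 * Real.pi * ((k - l : ℤ) : ℝ) * t)
        + Real.cos (2 * Real.pi * ((k + l : ℤ) : ℝ) * t) := by
    rw [trigFun_even hk, trigFun_even hl, mul_mul_mul_comm, Real.mul_self_sqrt zero_le_two,
      show 2 * Real.pi * ((k - l : ℤ) : ℝ) * t = 2 * Real.pi * k * t - 2 * Real.pi * l * t by
        push_cast; ring,
      show 2 * Real.pi * ((k + l : ℤ) : ℝ) * t = 2 * Real.pi * k * t + 2 * Real.pi * l * t by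
        push_cast; ring, Real.cos_sub, Real.cos_add]
    ring
  simp only [h]
  rw [intervalIntegral.integral_add (by apply Continuous.intervalIntegrable; fun_prop)
    (by apply Continuous.intervalIntegrable; fun_prop),
    integral_cos_two_pi_mul (k := (k + l : ℤ)) (by omega)]
  split_ifs with hkl
  · simp [hkl]
  · rw [integral_cos_two_pi_mul (by omega), add_zero]

theorem inner_psi_odd_odd {k l : ℕ} (hk : 1 ≤ k) (hl : 1 ≤ l) :
    ⟪psi (2 * k + 1), psi (2 * l + 1)⟫ = if k = l then 1 else 0 := by
  rw [inner_psi_eq_integral]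
  have h (t : ℝ) : trigFun (2 * k + 1) t * trigFun (2 * l + 1) t =
      Real.cos (2 * Real.pi * ((k - l : ℤ) : ℝ) * t)
        - Real.cos (2 * Real.pi * ((k + l : ℤ) : ℝ) * t) := by
    rw [trigFun_odd hk, trigFun_odd hl, mul_mul_mul_comm, Real.mul_self_sqrt zero_le_two,
      show 2 * Real.pi * ((k - l : ℤ) : ℝ) * t = 2 * Real.pi * k * t - 2 * Real.pi * l * t by
        push_cast; ring,
      show 2 * Real.pi * ((k + l : ℤ) : ℝ) * t = 2 * Real.pi * k * t + 2 * Real.pi * l * t by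
        push_cast; ring, Real.cos_sub, Real.cos_add]
    ring
  simp only [h]
  rw [intervalIntegral.integral_sub (by apply Continuous.intervalIntegrable; fun_prop)
    (by apply Continuous.intervalIntegrable; fun_prop),
    integral_cos_two_pi_mul (k := (k + l : ℤ)) (by omega)]
  split_ifs with hkl
  · simp [hkl]
  · rw [integral_cos_two_pi_mul (by omega), sub_zero]

theorem inner_psi_even_odd {k l : ℕ} (hk : 1 ≤ k) (hl : 1 ≤ l) :
    ⟪psi (2 * k), psi (2 * l + 1)⟫ = 0 := by
  rw [inner_psi_eq_integral]
  have h (t : ℝ) : trigFun (2 * k) t * trigFun (2 * l + 1) t =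
      Real.sin (2 * Real.pi * ((k + l : ℤ) : ℝ) * t)
        - Real.sin (2 * Real.pi * ((k - l : ℤ) : ℝ) * t) := by
    rw [trigFun_even hk, trigFun_odd hl, mul_mul_mul_comm, Real.mul_self_sqrt zero_le_two,
      show 2 * Real.pi * ((k - l : ℤ) : ℝ) * t = 2 * Real.pi * k * t - 2 * Real.pi * l * t by
        push_cast; ring,
      show 2 * Real.pi * ((k + l : ℤ) : ℝ) * t = 2 * Real.pi * k * t + 2 * Real.pi * l * t by
        push_cast; ring, Real.sin_sub, Real.sin_add]
    ring
  simp only [h]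
  rw [intervalIntegral.integral_sub (by apply Continuous.intervalIntegrable; fun_prop)
    (by apply Continuous.intervalIntegrable; fun_prop),
    integral_sin_two_pi_mul, integral_sin_two_pi_mul, sub_zero]

theorem inner_psi_one_even {k : ℕ} (hk : 1 ≤ k) : ⟪psi 1, psi (2 * k)⟫ = 0 := by
  rw [inner_psi_eq_integral]
  simp only [trigFun_one, trigFun_even hk, one_mul]
  rw [intervalIntegral.integral_const_mul]
  have := integral_cos_two_pi_mul (k := (k : ℤ)) (by omega)
  push_cast at this
  rw [this, mul_zero]

theorem inner_psi_one_odd {k : ℕ} (hk : 1 ≤ k) : ⟪psi 1, psi (2 * k + 1)⟫ = 0 := by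
  rw [inner_psi_eq_integral]
  simp only [trigFun_one, trigFun_odd hk, one_mul]
  rw [intervalIntegral.integral_const_mul]
  have := integral_sin_two_pi_mul (k : ℤ)
  push_cast at this
  rw [this, mul_zero]

theorem eq_one_or_even_or_odd {j : ℕ} (hj : 1 ≤ j) :
    j = 1 ∨ ∃ k, 1 ≤ k ∧ (j = 2 * k ∨ j = 2 * k + 1) := by
  rcases Nat.lt_or_ge j 2 with h | h
  · left; omega
  · right; exact ⟨j / 2, by omega, by omega⟩

theorem orthonormal_psi : Orthonormal ℝ (fun i : ℕ => psi (i + 1)) := by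
  rw [orthonormal_iff_ite]
  have key : ∀ i j : ℕ, 1 ≤ i → 1 ≤ j → ⟪psi i, psi j⟫ = if i = j then (1 : ℝ) else 0 := by
    intro i j hi hj
    rcases eq_one_or_even_or_odd hi with rfl | ⟨k, hk, rfl | rfl⟩ <;>
    rcases eq_one_or_even_or_odd hj with rfl | ⟨l, hl, rfl | rfl⟩
    · rw [inner_psi_eq_integral]
      simp [trigFun_one]
    · rw [inner_psi_one_even hl, if_neg (by omega)]
    · rw [inner_psi_one_odd hl, if_neg (by omega)]
    · rw [real_inner_comm, inner_psi_one_even hk, if_neg (by omega)]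
    · rw [inner_psi_even_even hk hl]; simp
    · rw [inner_psi_even_odd hk hl, if_neg (by omega)]
    · rw [real_inner_comm, inner_psi_one_odd hk, if_neg (by omega)]
    · rw [real_inner_comm, inner_psi_even_odd hl hk, if_neg (by omega)]
    · rw [inner_psi_odd_odd hk hl]; simp
  intro i j
  rw [key _ _ (by omega) (by omega)]
  simp

/-! ### Operator monotonicity of the square root -/

section Operators

variable {H : Type*} [NormedAddCommGroup H] [InnerProductSpace ℝ H]

/-- A positive operator is small wherever its quadratic form is small. -/
theorem norm_sq_le_mul_inner_of_nonneg {C : H →L[ℝ] H} (hsymm : ∀ x y, ⟪C x, y⟫ = ⟪x, C y⟫)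
    (hpos : ∀ x, 0 ≤ ⟪C x, x⟫) (x : H) : ‖C x‖ ^ 2 ≤ (‖C‖ + 1) * ⟪C x, x⟫ := by
  set K := ‖C‖ + 1 with hK
  have hK0 : 0 < K := by positivity
  have h1 : ⟪C (C x), C x⟫ ≤ K * ‖C x‖ ^ 2 := by
    refine (real_inner_le_norm _ _).trans ?_
    have := C.le_opNorm (C x)
    nlinarith [norm_nonneg (C x), sq_nonneg ‖C x‖]
  -- positivity of the form at `x - K⁻¹ C x`
  have h2 := hpos (x - K⁻¹ • C x)
  rw [map_sub, map_smul, inner_sub_left, inner_sub_right, inner_sub_right, inner_smul_left,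
    inner_smul_left, inner_smul_right, inner_smul_right, hsymm (C x) x,
    real_inner_self_eq_norm_sq] at h2
  simp only [conj_trivial] at h2
  have h3 : K⁻¹ * (K⁻¹ * ⟪C (C x), C x⟫) ≤ K⁻¹ * ‖C x‖ ^ 2 := by
    refine mul_le_mul_of_nonneg_left ?_ (by positivity)
    rwa [inv_mul_le_iff₀ hK0]
  have h4 : K⁻¹ * ‖C x‖ ^ 2 ≤ ⟪C x, x⟫ := by linarith
  rwa [inv_mul_le_iff₀ hK0] at h4

/-- The square root is operator monotone: the proof applies the hypothesis to an approximate
eigenvector of `A - B` for the supremum of its quadratic form on the unit sphere. -/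
theorem inner_apply_le_of_norm_apply_le {A B : H →L[ℝ] H}
    (hA : ∀ x y, ⟪A x, y⟫ = ⟪x, A y⟫) (hB : ∀ x y, ⟪B x, y⟫ = ⟪x, B y⟫)
    (hBpos : ∀ x, 0 ≤ ⟪B x, x⟫) (hAB : ∀ x, ‖A x‖ ≤ ‖B x‖) (x : H) :
    ⟪A x, x⟫ ≤ ⟪B x, x⟫ := by
  by_contra! hx
  set S : Set ℝ := {r | ∃ y : H, ‖y‖ = 1 ∧ ⟪A y, y⟫ - ⟪B y, y⟫ = r} with hS
  have hx0 : x ≠ 0 := by rintro rfl; simp at hx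
  have hxn : 0 < ‖x‖ := norm_pos_iff.2 hx0
  have hscale (y : H) : ⟪A y, y⟫ - ⟪B y, y⟫ =
      ‖y‖ ^ 2 * (⟪A (‖y‖⁻¹ • y), ‖y‖⁻¹ • y⟫ - ⟪B (‖y‖⁻¹ • y), ‖y‖⁻¹ • y⟫) := by
    rcases eq_or_ne y 0 with rfl | hy
    · simp
    have : ‖y‖ ≠ 0 := norm_ne_zero_iff.2 hy
    simp only [map_smul, inner_smul_left, inner_smul_right, conj_trivial]
    field_simp
  have hunit {y : H} (hy : y ≠ 0) : ‖‖y‖⁻¹ • y‖ = 1 := by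
    rw [norm_smul, norm_inv, norm_norm, inv_mul_cancel₀ (norm_ne_zero_iff.2 hy)]
  have hbdd : BddAbove S := by
    refine ⟨‖A‖, ?_⟩
    rintro r ⟨y, hy, rfl⟩
    have h1 := real_inner_le_norm (A y) y
    have h2 := A.le_opNorm y
    rw [hy] at h1 h2
    linarith [hBpos y]
  set μ := sSup S with hμ
  have hμ_le {y : H} (hy : ‖y‖ = 1) : ⟪A y, y⟫ - ⟪B y, y⟫ ≤ μ := le_csSup hbdd ⟨y, hy, rfl⟩
  have hμ0 : 0 < μ := by
    have h1 := hμ_le (hunit hx0)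
    have h2 := hscale x
    have h3 : 0 < ‖x‖ ^ 2 := by positivity
    by_contra! h
    nlinarith
  set C : H →L[ℝ] H := μ • ContinuousLinearMap.id ℝ H + B - A with hC
  have hCapply (y : H) : C y = μ • y + B y - A y := by simp [hC]
  have hCin (y : H) : ⟪C y, y⟫ = μ * ‖y‖ ^ 2 - (⟪A y, y⟫ - ⟪B y, y⟫) := by
    rw [hCapply, inner_sub_left, inner_add_left, inner_smul_left, real_inner_self_eq_norm_sq]
    simp only [conj_trivial]
    ring
  have hCsymm (y z : H) : ⟪C y, z⟫ = ⟪y, C z⟫ := by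
    simp only [hCapply, inner_sub_left, inner_add_left, inner_smul_left, inner_sub_right,
      inner_add_right, inner_smul_right, hA, hB, conj_trivial]
  have hCpos (y : H) : 0 ≤ ⟪C y, y⟫ := by
    rw [hCin]
    rcases eq_or_ne y 0 with rfl | hy
    · simp
    rw [hscale y]
    have := hμ_le (hunit hy)
    nlinarith [sq_nonneg ‖y‖]
  -- so small that `(‖B y‖ + r)² < ‖B y‖² + μ²` for unit vectors `y`
  set r := min 1 (μ ^ 2 / (2 * (2 * ‖B‖ + 1))) with hr
  have hr0 : 0 < r := lt_min one_pos (by positivity)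
  have hr1 : r ≤ 1 := min_le_left _ _
  have hr2 : r * (2 * ‖B‖ + 1) ≤ μ ^ 2 / 2 := by
    have := min_le_right 1 (μ ^ 2 / (2 * (2 * ‖B‖ + 1)))
    rw [← hr, le_div_iff₀ (by positivity)] at this
    linarith
  have hδ : 0 < r ^ 2 / (‖C‖ + 1) := by positivity
  obtain ⟨_, ⟨y, hy, rfl⟩, hyS⟩ := exists_lt_of_lt_csSup
    (⟨_, _, hunit hx0, rfl⟩ : S.Nonempty) (sub_lt_self μ hδ)
  -- `y` is an approximate eigenvector of `A - B` for `μ`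
  have hCy : ‖C y‖ ≤ r := by
    have h1 := norm_sq_le_mul_inner_of_nonneg hCsymm hCpos y
    rw [hCin, hy] at h1
    have h2 : μ * 1 ^ 2 - (⟪A y, y⟫ - ⟪B y, y⟫) ≤ r ^ 2 / (‖C‖ + 1) := by linarith
    have h3 : ‖C y‖ ^ 2 ≤ r ^ 2 := by
      refine h1.trans ((mul_le_mul_of_nonneg_left h2 (by positivity)).trans_eq ?_)
      field_simp
    exact le_of_abs_le (abs_le_of_sq_le_sq h3 hr0.le)
  have hBy : ‖B y‖ ≤ ‖B‖ := by simpa [hy] using B.le_opNorm y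
  -- `B y + μ y` is close to `A y`, hence not much longer than `B y`; but `⟪B y, y⟫ ≥ 0`
  have h1 : ‖B y + μ • y‖ ≤ ‖B y‖ + r := by
    have : B y + μ • y = A y + C y := by rw [hCapply]; abel
    rw [this]
    exact (norm_add_le _ _).trans (add_le_add (hAB y) hCy)
  have h2 : ‖B y + μ • y‖ ^ 2 = ‖B y‖ ^ 2 + 2 * (μ * ⟪B y, y⟫) + μ ^ 2 := by
    rw [norm_add_sq_real, inner_smul_right, norm_smul, hy, mul_one, Real.norm_eq_abs, sq_abs]
  have h3 : ‖B y + μ • y‖ ^ 2 ≤ (‖B y‖ + r) ^ 2 := by gcongr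
  have h4 := hBpos y
  nlinarith [mul_nonneg hμ0.le h4, norm_nonneg (B y)]

/-- The diagonal operator `f ↦ ∑_{j < M} w_j ⟨e_j, f⟩ e_j`. -/
noncomputable def diagOp (e : ℕ → H) (w : ℕ → ℝ) (M : ℕ) : H →L[ℝ] H :=
  ∑ j ∈ Finset.range M, w j • (innerSL ℝ (e j)).smulRight (e j)

theorem diagOp_apply (e : ℕ → H) (w : ℕ → ℝ) (M : ℕ) (f : H) :
    diagOp e w M f = ∑ j ∈ Finset.range M, (w j * ⟪f, e j⟫) • e j := by
  simp [diagOp, smul_smul, real_inner_comm f]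

theorem inner_diagOp (e : ℕ → H) (w : ℕ → ℝ) (M : ℕ) (f g : H) :
    ⟪diagOp e w M f, g⟫ = ∑ j ∈ Finset.range M, w j * ⟪f, e j⟫ * ⟪g, e j⟫ := by
  rw [diagOp_apply, sum_inner]
  exact Finset.sum_congr rfl fun j _ => by
    rw [inner_smul_left, conj_trivial, real_inner_comm g (e j)]

theorem diagOp_symm (e : ℕ → H) (w : ℕ → ℝ) (M : ℕ) (f g : H) :
    ⟪diagOp e w M f, g⟫ = ⟪f, diagOp e w M g⟫ := by
  rw [real_inner_comm (diagOp e w M g) f, inner_diagOp, inner_diagOp]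
  exact Finset.sum_congr rfl fun j _ => by ring

theorem inner_diagOp_self (e : ℕ → H) (w : ℕ → ℝ) (M : ℕ) (f : H) :
    ⟪diagOp e w M f, f⟫ = ∑ j ∈ Finset.range M, w j * ⟪f, e j⟫ ^ 2 := by
  rw [inner_diagOp]
  exact Finset.sum_congr rfl fun j _ => by ring

theorem norm_diagOp_sq {e : ℕ → H} (he : Orthonormal ℝ e) (w : ℕ → ℝ) (M : ℕ) (f : H) :
    ‖diagOp e w M f‖ ^ 2 = ∑ j ∈ Finset.range M, w j ^ 2 * ⟪f, e j⟫ ^ 2 := by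
  rw [diagOp_apply, ← real_inner_self_eq_norm_sq, he.inner_sum]
  exact Finset.sum_congr rfl fun j _ => by simp only [conj_trivial]; ring

/-- A lower bound of `Γ²` by a diagonal operator passes to the square roots. -/
theorem sum_mul_inner_sq_le_inner {e : ℕ → H} (he : Orthonormal ℝ e) {w : ℕ → ℝ}
    {Γ : H →L[ℝ] H} (hsymm : ∀ x y, ⟪Γ x, y⟫ = ⟪x, Γ y⟫)
    (hpos : ∀ x, 0 ≤ ⟪Γ x, x⟫) {d : ℝ} (hd : 0 ≤ d) {M : ℕ}
    (hlow : ∀ f, ∑ j ∈ Finset.range M, w j ^ 2 * ⟪f, e j⟫ ^ 2 ≤ d ^ 2 * ‖Γ f‖ ^ 2) (f : H) :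
    ∑ j ∈ Finset.range M, w j * ⟪f, e j⟫ ^ 2 ≤ d * ⟪Γ f, f⟫ := by
  have h := inner_apply_le_of_norm_apply_le (A := diagOp e w M) (B := d • Γ)
    (diagOp_symm e w M) (fun x y => by simp [inner_smul_left, inner_smul_right, hsymm])
    (fun x => by simpa [inner_smul_left] using mul_nonneg hd (hpos x))
    (fun x => by
      refine le_of_abs_le (abs_le_of_sq_le_sq ?_ (norm_nonneg _))
      rw [norm_diagOp_sq he]
      refine (hlow x).trans_eq ?_
      simp [norm_smul, mul_pow]) f
  rw [inner_diagOp_self] at h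
  simpa [inner_smul_left] using h

/-- An upper bound of `Γ²` by a diagonal operator passes to the square roots. Finitely many
diagonal entries `w_j` are kept, and the remaining ones are replaced by the constant `w_M`. -/
theorem inner_le_sum_mul_inner_sq {e : ℕ → H} (he : Orthonormal ℝ e) {w : ℕ → ℝ}
    (hw : ∀ j, 0 ≤ w j) {Γ : H →L[ℝ] H} (hsymm : ∀ x y, ⟪Γ x, y⟫ = ⟪x, Γ y⟫)
    {d : ℝ} (hd : 0 ≤ d) {M : ℕ}
    (hup : ∀ f, ‖Γ f‖ ^ 2 ≤
      d ^ 2 * (∑ j ∈ Finset.range M, w j ^ 2 * ⟪f, e j⟫ ^ 2 + w M ^ 2 * ‖f‖ ^ 2)) (f : H) :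
    ⟪Γ f, f⟫ ≤ d * (∑ j ∈ Finset.range M, w j * ⟪f, e j⟫ ^ 2 + w M * ‖f‖ ^ 2) := by
  set B : H →L[ℝ] H := d • (diagOp e w M + w M • ContinuousLinearMap.id ℝ H) with hB
  have hBapply (x : H) : B x = d • (diagOp e w M x + w M • x) := by simp [hB]
  have hBin (x : H) : ⟪B x, x⟫ =
      d * (∑ j ∈ Finset.range M, w j * ⟪x, e j⟫ ^ 2 + w M * ‖x‖ ^ 2) := by
    rw [hBapply, inner_smul_left, inner_add_left, inner_smul_left, inner_diagOp_self,
      real_inner_self_eq_norm_sq]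
    simp
  have hS (x : H) : 0 ≤ ∑ j ∈ Finset.range M, w j * ⟪x, e j⟫ ^ 2 :=
    Finset.sum_nonneg fun j _ => mul_nonneg (hw j) (sq_nonneg _)
  rw [← hBin]
  refine inner_apply_le_of_norm_apply_le hsymm (fun x y => ?_) (fun x => ?_) (fun x => ?_) f
  · simp only [hBapply, inner_smul_left, inner_smul_right, inner_add_left, inner_add_right,
      diagOp_symm, conj_trivial]
  · rw [hBin]
    exact mul_nonneg hd (add_nonneg (hS x) (mul_nonneg (hw M) (sq_nonneg _)))
  · refine le_of_abs_le (abs_le_of_sq_le_sq ((hup x).trans ?_) (norm_nonneg _))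
    rw [hBapply, norm_smul, mul_pow, Real.norm_eq_abs, sq_abs]
    refine mul_le_mul_of_nonneg_left ?_ (sq_nonneg d)
    rw [norm_add_sq_real, inner_smul_right, inner_diagOp_self, norm_diagOp_sq he, norm_smul,
      mul_pow, Real.norm_eq_abs, sq_abs]
    nlinarith [mul_nonneg (hw M) (hS x)]

end Operators

open Matrix

/-! ### The link condition and the Galerkin approximation -/

/-- The sequences `1 ≥ υ₁ ≥ υ₂ ≥ … > 0`. -/
structure IsDecay (υ : ℕ → ℝ) : Prop where
  pos : ∀ j, 0 < υ (j + 1)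
  anti : Antitone fun j => υ (j + 1)
  le_one : υ 1 ≤ 1

/-- The sequences `1 ≤ b₁ ≤ b₂ ≤ …`. -/
structure IsGrowth (b : ℕ → ℝ) : Prop where
  one_le : 1 ≤ b 1
  mono : Monotone fun j => b (j + 1)

theorem IsGrowth.one_le' {b : ℕ → ℝ} (hb : IsGrowth b) (j : ℕ) : 1 ≤ b (j + 1) :=
  hb.one_le.trans (hb.mono (Nat.zero_le j))

/-- The symmetric strictly positive operators that satisfy the link condition. -/
structure IsLinked (υ : ℕ → ℝ) (d : ℝ) (Γ : L2I →L[ℝ] L2I) : Prop where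
  symm : ∀ f g, ⟪Γ f, g⟫ = ⟪f, Γ g⟫
  pos : ∀ f, f ≠ 0 → 0 < ⟪Γ f, f⟫
  link : LinkCondition υ d Γ

/-- The element `∑_{l ≤ m} c_l ψ_l` with coordinates `c`. -/
noncomputable def synth {m : ℕ} (c : Fin m → ℝ) : L2I := ∑ l : Fin m, c l • psi (l + 1)

theorem synth_sub {m : ℕ} (c c' : Fin m → ℝ) : synth (c - c') = synth c - synth c' := by
  simp [synth, sub_smul, Finset.sum_sub_distrib]

theorem inner_synth {m : ℕ} (c : Fin m → ℝ) (f : L2I) : ⟪f, synth c⟫ = coords m f ⬝ᵥ c := by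
  simp [synth, inner_sum, inner_smul_right, coords, dotProduct, mul_comm]

theorem inner_synth_psi {m : ℕ} (c : Fin m → ℝ) (j : ℕ) :
    ⟪synth c, psi (j + 1)⟫ = if h : j < m then c ⟨j, h⟩ else 0 := by
  have he := orthonormal_iff_ite.1 orthonormal_psi
  simp only [synth, sum_inner, inner_smul_left, conj_trivial, he]
  split_ifs with h
  · rw [Finset.sum_eq_single ⟨j, h⟩] <;> simp +contextual [Fin.ext_iff]
  · refine Finset.sum_eq_zero fun l _ => ?_
    rw [if_neg (by omega), mul_zero]

theorem coords_synth {m : ℕ} (c : Fin m → ℝ) : coords m (synth c) = c := by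
  ext i
  simp [coords, inner_synth_psi]

theorem norm_synth_sq {m : ℕ} (c : Fin m → ℝ) : ‖synth c‖ ^ 2 = c ⬝ᵥ c := by
  rw [← real_inner_self_eq_norm_sq, inner_synth, coords_synth]

theorem coords_apply_synth {m : ℕ} (Γ : L2I →L[ℝ] L2I) (c : Fin m → ℝ) :
    coords m (Γ (synth c)) = opMatrix m Γ *ᵥ c := by
  ext i
  simp [coords, synth, opMatrix, mulVec, dotProduct, sum_inner, inner_smul_left, mul_comm]

theorem dotProduct_opMatrix_mulVec {m : ℕ} (Γ : L2I →L[ℝ] L2I) (c : Fin m → ℝ) :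
    c ⬝ᵥ (opMatrix m Γ *ᵥ c) = ⟪Γ (synth c), synth c⟫ := by
  rw [inner_synth, coords_apply_synth, dotProduct_comm]

theorem posDef_opMatrix {Γ : L2I →L[ℝ] L2I} (hsymm : ∀ f g, ⟪Γ f, g⟫ = ⟪f, Γ g⟫)
    (hpos : ∀ f, f ≠ 0 → 0 < ⟪Γ f, f⟫) (m : ℕ) : (opMatrix m Γ).PosDef := by
  refine PosDef.of_dotProduct_mulVec_pos ?_ fun c hc => ?_
  · ext i j
    simp only [opMatrix, conjTranspose_apply, of_apply, star_trivial]
    rw [hsymm, real_inner_comm]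
  · rw [star_trivial, dotProduct_opMatrix_mulVec]
    refine hpos _ fun h => hc ?_
    rw [← coords_synth c, h]
    ext i
    simp [coords]

theorem sum_range_le_of_weightedSq_le {w : ℕ → ℝ} (hw : ∀ j, 0 ≤ w (j + 1)) {f : L2I} {r : ℝ}
    (hr : 0 ≤ r) (h : weightedSq w f ≤ ENNReal.ofReal r) (s : Finset ℕ) :
    ∑ j ∈ s, w (j + 1) * ⟪f, psi (j + 1)⟫ ^ 2 ≤ r := by
  rw [← ENNReal.ofReal_le_ofReal_iff hr,
    ENNReal.ofReal_sum_of_nonneg fun j _ => mul_nonneg (hw j) (sq_nonneg _)]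
  exact (ENNReal.sum_le_tsum s).trans h

theorem sum_inner_sq_le (f : L2I) (s : Finset ℕ) : ∑ j ∈ s, ⟪f, psi (j + 1)⟫ ^ 2 ≤ ‖f‖ ^ 2 := by
  refine le_of_eq_of_le (Finset.sum_congr rfl fun j _ => ?_)
    (orthonormal_psi.sum_inner_products_le f (s := s))
  rw [real_inner_comm, Real.norm_eq_abs, sq_abs]

namespace IsLinked

variable {υ : ℕ → ℝ} {d : ℝ} {Γ : L2I →L[ℝ] L2I}

theorem nonneg (hΓ : IsLinked υ d Γ) (f : L2I) : 0 ≤ ⟪Γ f, f⟫ := by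
  rcases eq_or_ne f 0 with rfl | hf
  · simp
  · exact (hΓ.pos f hf).le

theorem sum_le_norm_sq (hΓ : IsLinked υ d Γ) (M : ℕ) (f : L2I) :
    ∑ j ∈ Finset.range M, υ (j + 1) ^ 2 * ⟪f, psi (j + 1)⟫ ^ 2 ≤ d ^ 2 * ‖Γ f‖ ^ 2 :=
  sum_range_le_of_weightedSq_le (w := fun j => υ j ^ 2) (fun j => sq_nonneg _) (by positivity)
    (hΓ.link f).1 _

theorem norm_sq_le (hΓ : IsLinked υ d Γ) (hυ : IsDecay υ) (M : ℕ) (f : L2I) :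
    ‖Γ f‖ ^ 2 ≤ d ^ 2 * (∑ j ∈ Finset.range M, υ (j + 1) ^ 2 * ⟪f, psi (j + 1)⟫ ^ 2
      + υ (M + 1) ^ 2 * ‖f‖ ^ 2) := by
  have hS : 0 ≤ ∑ j ∈ Finset.range M, υ (j + 1) ^ 2 * ⟪f, psi (j + 1)⟫ ^ 2 :=
    Finset.sum_nonneg fun j _ => by positivity
  have hw : weightedSq (fun j => υ j ^ 2) f ≤ ENNReal.ofReal
      (∑ j ∈ Finset.range M, υ (j + 1) ^ 2 * ⟪f, psi (j + 1)⟫ ^ 2 + υ (M + 1) ^ 2 * ‖f‖ ^ 2) := by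
    refine ENNReal.tsum_le_of_sum_range_le fun N => ?_
    rw [← ENNReal.ofReal_sum_of_nonneg fun j _ => by positivity]
    refine ENNReal.ofReal_le_ofReal ?_
    have h1 : ∀ j ∈ Finset.range N, υ (j + 1) ^ 2 * ⟪f, psi (j + 1)⟫ ^ 2 ≤
        (if j ∈ Finset.range M then υ (j + 1) ^ 2 * ⟪f, psi (j + 1)⟫ ^ 2 else 0)
          + υ (M + 1) ^ 2 * ⟪f, psi (j + 1)⟫ ^ 2 := by
      intro j _
      split_ifs with hj
      · have : 0 ≤ υ (M + 1) ^ 2 * ⟪f, psi (j + 1)⟫ ^ 2 := by positivity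
        linarith
      · rw [zero_add]
        have h2 : υ (j + 1) ≤ υ (M + 1) := hυ.anti (by simpa using hj)
        have h3 := (hυ.pos j).le
        gcongr
    refine (Finset.sum_le_sum h1).trans ?_
    rw [Finset.sum_add_distrib, ← Finset.mul_sum, Finset.sum_ite_mem]
    refine add_le_add (Finset.sum_le_sum_of_subset_of_nonneg Finset.inter_subset_right
      fun j _ _ => by positivity) ?_
    exact mul_le_mul_of_nonneg_left (sum_inner_sq_le f _) (sq_nonneg _)
  have h := (hΓ.link f).2.trans (mul_le_mul_right hw _)
  rw [← ENNReal.ofReal_mul (sq_nonneg d)] at h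
  exact (ENNReal.ofReal_le_ofReal_iff (by positivity)).1 h

/-- Under the link condition a strictly positive operator sees every direction only through its
trigonometric coefficients, so that the trigonometric system is total. -/
theorem eq_zero_of_inner_psi (hΓ : IsLinked υ d Γ) {f : L2I}
    (hf : ∀ j, ⟪f, psi (j + 1)⟫ = 0) : f = 0 := by
  by_contra h
  have h1 := (hΓ.link f).2
  simp only [weightedSq, hf] at h1
  simp only [ne_eq, OfNat.ofNat_ne_zero, not_false_eq_true, zero_pow, mul_zero,
    ENNReal.ofReal_zero, tsum_zero, nonpos_iff_eq_zero, ENNReal.ofReal_eq_zero] at h1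
  have h2 : ‖Γ f‖ = 0 := by nlinarith [norm_nonneg (Γ f)]
  have h3 := hΓ.pos f h
  rw [norm_eq_zero.1 h2, inner_zero_left] at h3
  exact h3.false

theorem hasSum_inner_sq (hΓ : IsLinked υ d Γ) (f : L2I) :
    HasSum (fun j => ⟪f, psi (j + 1)⟫ ^ 2) (‖f‖ ^ 2) := by
  have hsp : (Submodule.span ℝ (Set.range fun j : ℕ => psi (j + 1)))ᗮ = ⊥ := by
    rw [Submodule.eq_bot_iff]
    intro g hg
    refine hΓ.eq_zero_of_inner_psi fun j => ?_
    exact (Submodule.mem_orthogonal' _ g).1 hg _ (Submodule.subset_span ⟨j, rfl⟩)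
  have h := (HilbertBasis.mkOfOrthogonalEqBot orthonormal_psi hsp).hasSum_inner_mul_inner f f
  rw [real_inner_self_eq_norm_sq] at h
  simp only [HilbertBasis.coe_mkOfOrthogonalEqBot, real_inner_comm f, ← pow_two] at h
  exact h

theorem mul_norm_sq_le (hΓ : IsLinked υ d Γ) {w : ℕ → ℝ} (hw : ∀ j, 0 ≤ w (j + 1)) {f g : L2I}
    {r b : ℝ} (hr : 0 ≤ r) (hf : weightedSq w f ≤ ENNReal.ofReal r)
    (hfg : ∀ j, b * ⟪g, psi (j + 1)⟫ ^ 2 ≤ w (j + 1) * ⟪f, psi (j + 1)⟫ ^ 2) :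
    b * ‖g‖ ^ 2 ≤ r :=
  hasSum_le_of_sum_le ((hΓ.hasSum_inner_sq g).mul_left b) fun s =>
    (Finset.sum_le_sum fun j _ => hfg j).trans (sum_range_le_of_weightedSq_le hw hr hf s)

theorem inner_le_of_coords_eq_zero (hΓ : IsLinked υ d Γ) (hυ : IsDecay υ) (hd : 0 ≤ d) (M : ℕ)
    {f : L2I} (hf : ∀ j < M, ⟪f, psi (j + 1)⟫ = 0) :
    ⟪Γ f, f⟫ ≤ d * υ (M + 1) * ‖f‖ ^ 2 := by
  have h := inner_le_sum_mul_inner_sq orthonormal_psi (w := fun j => υ (j + 1))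
    (fun j => (hυ.pos j).le) hΓ.symm hd (hΓ.norm_sq_le hυ M) f
  rw [Finset.sum_eq_zero fun j hj => by rw [hf j (Finset.mem_range.1 hj)]; ring, zero_add] at h
  linarith

theorem inner_le (hΓ : IsLinked υ d Γ) (hυ : IsDecay υ) (hd : 0 ≤ d) (f : L2I) :
    ⟪Γ f, f⟫ ≤ d * ‖f‖ ^ 2 := by
  refine (hΓ.inner_le_of_coords_eq_zero hυ hd 0 (by simp)).trans ?_
  have := hυ.le_one
  gcongr
  exact mul_le_of_le_one_right hd this

theorem inner_psi_le (hΓ : IsLinked υ d Γ) (hυ : IsDecay υ) (hd : 0 ≤ d) (j : ℕ) :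
    ⟪Γ (psi (j + 1)), psi (j + 1)⟫ ≤ d * υ (j + 1) := by
  have h := hΓ.inner_le_of_coords_eq_zero hυ hd j (f := psi (j + 1)) fun i hi =>
    orthonormal_psi.2 (i := j) (j := i) hi.ne'
  rwa [orthonormal_psi.1 j, one_pow, mul_one] at h

theorem mul_dotProduct_le (hΓ : IsLinked υ d Γ) (hυ : IsDecay υ) (hd : 0 ≤ d) {m : ℕ}
    (c : Fin (m + 1) → ℝ) :
    υ (m + 1) * (c ⬝ᵥ c) ≤ d * ⟪Γ (synth c), synth c⟫ := by
  have h := sum_mul_inner_sq_le_inner orthonormal_psi (w := fun j => υ (j + 1)) hΓ.symm hΓ.nonneg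
    hd (hΓ.sum_le_norm_sq (m + 1)) (synth c)
  refine le_trans ?_ h
  rw [Finset.sum_range, dotProduct, Finset.mul_sum]
  refine Finset.sum_le_sum fun j _ => ?_
  rw [inner_synth_psi, dif_pos j.2, ← pow_two]
  exact mul_le_mul_of_nonneg_right (hυ.anti (by omega)) (sq_nonneg _)

/-- The Galerkin approximation of `β` in the span of `ψ_1, …, ψ_{m+1}`, which is its orthogonal
projection for the inner product induced by `Γ`. -/
theorem exists_galerkin (hΓ : IsLinked υ d Γ) (hυ : IsDecay υ) (hd : 1 ≤ d) {b : ℕ → ℝ}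
    (hb : IsGrowth b) {ρ : ℝ} (hρ : 0 ≤ ρ) {β : L2I} (hβ : weightedSq b β ≤ ENNReal.ofReal ρ)
    (m : ℕ) :
    ∃ c : Fin (m + 1) → ℝ, coords (m + 1) (Γ (β - synth c)) = 0 ∧
      ⟪Γ (β - synth c), β - synth c⟫ ≤ d * ρ * (υ (m + 2) / b (m + 2)) ∧
      ‖β - synth c‖ ^ 2 ≤ 4 * d ^ 2 * ρ ∧ ‖β‖ ^ 2 ≤ ρ := by
  have hd0 : 0 ≤ d := zero_le_one.trans hd
  have hb0 (j : ℕ) : 0 ≤ b (j + 1) := zero_le_one.trans (hb.one_le' j)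
  have hunit := (posDef_opMatrix hΓ.symm hΓ.pos (m + 1)).isUnit
  set c := (opMatrix (m + 1) Γ)⁻¹ *ᵥ coords (m + 1) (Γ β) with hc
  have horth : coords (m + 1) (Γ (β - synth c)) = 0 := by
    have h1 : coords (m + 1) (Γ (synth c)) = coords (m + 1) (Γ β) := by
      rw [coords_apply_synth, hc, mulVec_mulVec,
        mul_nonsing_inv _ ((isUnit_iff_isUnit_det _).1 hunit), one_mulVec]
    ext i
    have h2 := congrFun h1 i
    simp only [coords] at h2
    simp [coords, map_sub, inner_sub_left, h2]
  have hnorm : ‖β‖ ^ 2 ≤ ρ := by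
    have := hΓ.mul_norm_sq_le hb0 (b := 1) (g := β) hρ hβ fun j =>
      mul_le_mul_of_nonneg_right (hb.one_le' j) (sq_nonneg _)
    linarith
  -- the residual of the orthogonal projection, with which the Galerkin residual is compared
  set π := β - synth (coords (m + 1) β) with hπ
  have hπj (j : ℕ) : ⟪π, psi (j + 1)⟫ = if j < m + 1 then 0 else ⟪β, psi (j + 1)⟫ := by
    rw [hπ, inner_sub_left, inner_synth_psi]
    split_ifs <;> simp [coords]
  have hπnorm : b (m + 2) * ‖π‖ ^ 2 ≤ ρ := by
    refine hΓ.mul_norm_sq_le hb0 hρ hβ fun j => ?_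
    rw [hπj]
    split_ifs with h
    · have := mul_nonneg (hb0 j) (sq_nonneg ⟪β, psi (j + 1)⟫)
      simpa using this
    · exact mul_le_mul_of_nonneg_right (hb.mono (by omega : m + 1 ≤ j)) (sq_nonneg _)
  have hbm := hb.one_le' (m + 1)
  have hπ1 : ‖π‖ ^ 2 ≤ ρ := by nlinarith [sq_nonneg ‖π‖]
  have hπ2 : ⟪Γ π, π⟫ ≤ d * ρ * (υ (m + 2) / b (m + 2)) := by
    refine (hΓ.inner_le_of_coords_eq_zero hυ hd0 (m + 1) fun j hj => by
      rw [hπj, if_pos hj]).trans ?_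
    have h1 : ‖π‖ ^ 2 ≤ ρ / b (m + 2) := by
      rw [le_div_iff₀ (by linarith)]
      linarith
    have h2 := (hυ.pos (m + 1)).le
    calc d * υ (m + 1 + 1) * ‖π‖ ^ 2 ≤ d * υ (m + 1 + 1) * (ρ / b (m + 2)) := by gcongr
      _ = _ := by ring
  set δ := c - coords (m + 1) β with hδ
  have hdecomp : π = (β - synth c) + synth δ := by
    rw [hδ, synth_sub, hπ]
    abel
  have hcross : ⟪Γ (β - synth c), synth δ⟫ = 0 := by
    rw [inner_synth, horth, zero_dotProduct]
  have hpyth : ⟪Γ π, π⟫ = ⟪Γ (β - synth c), β - synth c⟫ + ⟪Γ (synth δ), synth δ⟫ := by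
    rw [hdecomp, map_add, inner_add_left, inner_add_right, inner_add_right, hcross,
      hΓ.symm (synth δ), real_inner_comm _ (synth δ), hcross]
    ring
  have h1 := hΓ.nonneg (synth δ)
  have h2 := hΓ.nonneg (β - synth c)
  refine ⟨c, horth, by linarith, ?_, hnorm⟩
  have h3 : ‖synth δ‖ ^ 2 ≤ d ^ 2 * ρ := by
    have h4 := hΓ.mul_dotProduct_le hυ hd0 δ
    rw [← norm_synth_sq] at h4
    have h5 : ⟪Γ (synth δ), synth δ⟫ ≤ d * ρ * υ (m + 1) := by
      refine le_trans (by linarith) (hπ2.trans ?_)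
      refine mul_le_mul_of_nonneg_left ?_ (by positivity)
      refine (div_le_self (hυ.pos (m + 1)).le hbm).trans (hυ.anti (by omega))
    have h6 : υ (m + 1) * ‖synth δ‖ ^ 2 ≤ υ (m + 1) * (d ^ 2 * ρ) := by
      refine h4.trans ((mul_le_mul_of_nonneg_left h5 hd0).trans_eq (by ring))
    exact le_of_mul_le_mul_left h6 (hυ.pos m)
  have h7 : ‖β - synth c‖ ≤ ‖π‖ + ‖synth δ‖ := by
    rw [show β - synth c = π - synth δ by rw [hdecomp]; abel]
    exact norm_sub_le _ _
  have h8 : ‖β - synth c‖ ^ 2 ≤ 2 * ‖π‖ ^ 2 + 2 * ‖synth δ‖ ^ 2 := by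
    have : ‖β - synth c‖ ^ 2 ≤ (‖π‖ + ‖synth δ‖) ^ 2 := by gcongr
    nlinarith [sq_nonneg (‖π‖ - ‖synth δ‖)]
  have h9 : ρ ≤ d ^ 2 * ρ := le_mul_of_one_le_left hρ (one_le_pow₀ hd)
  linarith

end IsLinked

/-! ### Deterministic bounds for the estimator -/

theorem norm_toLp_sq {m : ℕ} (v : Fin m → ℝ) : ‖WithLp.toLp 2 v‖ ^ 2 = v ⬝ᵥ v := by
  refine (EuclideanSpace.norm_sq_eq (WithLp.toLp 2 v)).trans ?_
  simp [dotProduct, pow_two]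

theorem dotProduct_sq_le {m : ℕ} (v w : Fin m → ℝ) : (v ⬝ᵥ w) ^ 2 ≤ (v ⬝ᵥ v) * (w ⬝ᵥ w) := by
  simpa only [dotProduct, pow_two] using Finset.sum_mul_sq_le_sq_mul_sq Finset.univ v w

theorem dotProduct_self_nonneg' {m : ℕ} (v : Fin m → ℝ) : 0 ≤ v ⬝ᵥ v :=
  Finset.sum_nonneg fun i _ => mul_self_nonneg (v i)

theorem isUnit_det_and_norm_inv_le {m : ℕ} {A : Matrix (Fin m) (Fin m) ℝ} {κ : ℝ} (hκ : 0 < κ)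
    (hA : ∀ c, κ * (c ⬝ᵥ c) ≤ c ⬝ᵥ (A *ᵥ c)) :
    IsUnit A.det ∧ ‖Matrix.toEuclideanCLM (𝕜 := ℝ) A⁻¹‖ ≤ κ⁻¹ := by
  have hdet : A.det ≠ 0 := by
    intro h
    obtain ⟨c, hc, hc0⟩ := exists_mulVec_eq_zero_iff.2 h
    have h1 := hA c
    rw [hc0, dotProduct_zero] at h1
    have h2 : 0 ≤ c ⬝ᵥ c := dotProduct_self_nonneg' c
    have h3 : c ⬝ᵥ c = 0 := by nlinarith
    exact hc (dotProduct_self_eq_zero.1 h3)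
  refine ⟨hdet.isUnit, ContinuousLinearMap.opNorm_le_bound _ (inv_nonneg.2 hκ.le) fun x => ?_⟩
  set v := WithLp.ofLp x with hv
  have hx : x = WithLp.toLp 2 v := rfl
  rw [hx, toEuclideanCLM_toLp]
  set c := A⁻¹ *ᵥ v with hc
  have hAc : A *ᵥ c = v := by
    rw [hc, mulVec_mulVec, mul_nonsing_inv _ hdet.isUnit, one_mulVec]
  have h1 := hA c
  rw [hAc, ← norm_toLp_sq] at h1
  have h2 := dotProduct_sq_le c v
  rw [← norm_toLp_sq, ← norm_toLp_sq, ← mul_pow] at h2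
  have h3 : c ⬝ᵥ v ≤ ‖WithLp.toLp 2 c‖ * ‖WithLp.toLp 2 v‖ :=
    le_of_abs_le (abs_le_of_sq_le_sq h2 (by positivity))
  rw [le_inv_mul_iff₀ hκ]
  rcases (norm_nonneg (WithLp.toLp 2 c)).eq_or_lt with h | h
  · rw [← h]
    simp
  · refine le_of_mul_le_mul_left ?_ h
    linarith

theorem invSqrt_transpose {m : ℕ} (A : Matrix (Fin m) (Fin m) ℝ) :
    (invSqrt A)ᵀ = invSqrt A := by
  have h : IsSelfAdjoint (invSqrt A) := cfc_predicate _ A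
  rw [isSelfAdjoint_iff, star_eq_conjTranspose, conjTranspose_eq_transpose_of_trivial] at h
  exact h

theorem invSqrt_mul_mul_invSqrt {m : ℕ} {A : Matrix (Fin m) (Fin m) ℝ} (hA : A.PosDef) :
    invSqrt A * A * invSqrt A = 1 := by
  have hcont (f : ℝ → ℝ) : ContinuousOn f (spectrum ℝ A) :=
    (Matrix.finite_real_spectrum (A := A)).continuousOn f
  have hsa : IsSelfAdjoint A := hA.isHermitian
  have hid : cfc (fun x : ℝ => x) A = A := cfc_id' ℝ A
  have h : invSqrt A * A * invSqrt A =
      invSqrt A * cfc (fun x : ℝ => x) A * invSqrt A := by rw [hid]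
  rw [h, invSqrt, ← cfc_mul _ _ A (hcont _) (hcont _), ← cfc_mul _ _ A (hcont _) (hcont _),
    ← cfc_one ℝ A]
  refine cfc_congr fun x hx => ?_
  have hpos : 0 < x := by
    rw [hA.isHermitian.spectrum_real_eq_range_eigenvalues] at hx
    obtain ⟨i, rfl⟩ := hx
    exact hA.eigenvalues_pos i
  have h2 : √x ≠ 0 := (Real.sqrt_pos.2 hpos).ne'
  simp only [Pi.one_apply]
  field_simp
  exact (Real.sq_sqrt hpos.le).symm

theorem opMatrix_empCov_mulVec {n m : ℕ} (x : Fin n → L2I) (c : Fin m → ℝ) :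
    opMatrix m (empCov x) *ᵥ c = (n : ℝ)⁻¹ • ∑ i, (coords m (x i) ⬝ᵥ c) • coords m (x i) := by
  ext k
  simp only [mulVec, dotProduct, opMatrix, of_apply, empCov, inner_smul_left, sum_inner,
    conj_trivial, Pi.smul_apply, Finset.sum_apply, smul_eq_mul, coords]
  simp_rw [mul_assoc, ← Finset.mul_sum, Finset.sum_mul]
  rw [Finset.sum_comm]
  congr 1
  exact Finset.sum_congr rfl fun i _ => Finset.sum_congr rfl fun j _ => by ring

theorem dotProduct_opMatrix_empCov {n m : ℕ} (x : Fin n → L2I) (c : Fin m → ℝ) :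
    c ⬝ᵥ (opMatrix m (empCov x) *ᵥ c) = (n : ℝ)⁻¹ * ∑ i, (coords m (x i) ⬝ᵥ c) ^ 2 := by
  rw [opMatrix_empCov_mulVec, dotProduct_smul, dotProduct_sum, smul_eq_mul]
  congr 1
  refine Finset.sum_congr rfl fun i _ => ?_
  rw [dotProduct_smul, smul_eq_mul, dotProduct_comm c, pow_two]

theorem coords_empCross {n m : ℕ} (x : Fin n → L2I) (y : Fin n → ℝ) :
    coords m (empCross x y) = (n : ℝ)⁻¹ • ∑ i, y i • coords m (x i) := by
  ext k
  simp [coords, empCross, inner_smul_left, sum_inner]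

theorem norm_estimator_le {n : ℕ} (m : ℕ) {γ : ℝ} (hγ : 0 ≤ γ) (x : Fin n → L2I)
    (y : Fin n → ℝ) : ‖estimator m γ x y‖ ≤ γ * ‖empCross x y‖ := by
  rw [estimator]
  split_ifs with h
  · change ‖synth _‖ ≤ _
    set v := coords m (empCross x y) with hv
    have h1 : ‖synth ((opMatrix m (empCov x))⁻¹ *ᵥ v)‖ =
        ‖WithLp.toLp 2 ((opMatrix m (empCov x))⁻¹ *ᵥ v)‖ := by
      rw [← sq_eq_sq₀ (norm_nonneg _) (norm_nonneg _), norm_synth_sq, norm_toLp_sq]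
    have h2 : ‖WithLp.toLp 2 v‖ ≤ ‖empCross x y‖ := by
      refine le_of_abs_le (abs_le_of_sq_le_sq ?_ (norm_nonneg _))
      rw [norm_toLp_sq]
      have := sum_inner_sq_le (empCross x y) (Finset.range m)
      rw [Finset.sum_range] at this
      simpa only [hv, coords, dotProduct, ← pow_two] using this
    rw [h1, ← toEuclideanCLM_toLp]
    exact (ContinuousLinearMap.le_opNorm _ _).trans
      (mul_le_mul h.2 h2 (norm_nonneg _) hγ)
  · rw [norm_zero]
    positivity

/-- If the empirical second moments dominate half of the population ones on the span of
`ψ_1, …, ψ_m`, then the prediction error splits into the approximation error of the Galerkin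
approximation and the size of the standardised mean score. -/
theorem gammaSq_estimator_sub_le {n m : ℕ} {γ κ σ : ℝ} {Γ : L2I →L[ℝ] L2I}
    (hsymm : ∀ f g, ⟪Γ f, g⟫ = ⟪f, Γ g⟫) (hpos : ∀ f, f ≠ 0 → 0 < ⟪Γ f, f⟫)
    (hκ : 0 < κ) (hκγ : (κ / 2)⁻¹ ≤ γ)
    (hlow : ∀ c : Fin m → ℝ, κ * (c ⬝ᵥ c) ≤ ⟪Γ (synth c), synth c⟫)
    {x : Fin n → L2I} {e : Fin n → ℝ} {β : L2I} {c₀ : Fin m → ℝ}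
    (hgal : coords m (Γ (β - synth c₀)) = 0)
    (hgood : ∀ c : Fin m → ℝ, 1 / 2 * ⟪Γ (synth c), synth c⟫ ≤
      (n : ℝ)⁻¹ * ∑ i, (coords m (x i) ⬝ᵥ c) ^ 2) :
    gammaSq Γ (estimator m γ x (fun i => ⟪β, x i⟫ + σ * e i) - β) ≤
      ⟪Γ (β - synth c₀), β - synth c₀⟫ + 4 * ∑ j, ((n : ℝ)⁻¹ * ∑ i,
        (⟪β - synth c₀, x i⟫ + σ * e i) *
          ((invSqrt (opMatrix m Γ)) *ᵥ (coords m (x i))) j) ^ 2 := by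
  set A := opMatrix m (empCov x) with hA
  set G := opMatrix m Γ with hG
  set R := invSqrt G with hR
  have hAq (c : Fin m → ℝ) : 1 / 2 * ⟪Γ (synth c), synth c⟫ ≤ c ⬝ᵥ (A *ᵥ c) := by
    rw [hA, dotProduct_opMatrix_empCov]
    exact hgood c
  obtain ⟨hdet, hnorm⟩ := isUnit_det_and_norm_inv_le (A := A) (half_pos hκ) fun c => by
    linarith [hAq c, hlow c]
  rw [estimator, if_pos ⟨hdet, hnorm.trans hκγ⟩]
  change gammaSq Γ (synth (A⁻¹ *ᵥ coords m (empCross x fun i => ⟪β, x i⟫ + σ * e i)) - β) ≤ _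
  set T : Fin m → ℝ :=
    (n : ℝ)⁻¹ • ∑ i, (⟪β - synth c₀, x i⟫ + σ * e i) • coords m (x i) with hT
  set coef := A⁻¹ *ᵥ coords m (empCross x fun i => ⟪β, x i⟫ + σ * e i) with h_coef
  set a := coef - c₀ with ha
  have hAa : A *ᵥ a = T := by
    rw [ha, mulVec_sub, h_coef, mulVec_mulVec, mul_nonsing_inv _ hdet, one_mulVec, coords_empCross,
      hA, opMatrix_empCov_mulVec, hT, ← smul_sub, ← Finset.sum_sub_distrib]
    congr 1
    refine Finset.sum_congr rfl fun i _ => ?_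
    rw [← sub_smul, ← inner_synth, inner_sub_left, real_inner_comm (synth c₀)]
    congr 1
    ring
  have hV (j : Fin m) : (n : ℝ)⁻¹ * ∑ i, (⟪β - synth c₀, x i⟫ + σ * e i) *
      (R *ᵥ (coords m (x i))) j = (R *ᵥ T) j := by
    rw [hT, mulVec_smul, mulVec_sum]
    simp [mulVec_smul]
  have hgoal : synth coef - β = synth a - (β - synth c₀) := by
    rw [ha, synth_sub]
    abel
  have hcross : ⟪Γ (β - synth c₀), synth a⟫ = 0 := by
    rw [inner_synth, hgal, zero_dotProduct]
  have hsplit : gammaSq Γ (synth coef - β) =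
      ⟪Γ (synth a), synth a⟫ + ⟪Γ (β - synth c₀), β - synth c₀⟫ := by
    have h : ⟪Γ (synth a), β - synth c₀⟫ = 0 := by rw [hsymm, real_inner_comm, hcross]
    rw [hgoal, gammaSq, map_sub, inner_sub_left, inner_sub_right, h,
      inner_sub_right (Γ (β - synth c₀)), hcross]
    ring
  have hRGR : R * G * R = 1 := invSqrt_mul_mul_invSqrt (posDef_opMatrix hsymm hpos m)
  have hRt : Rᵀ = R := invSqrt_transpose G
  -- the coordinates of `a` for the standardised regressor
  set θ := (G * R) *ᵥ a with hθ
  have hRθ : R *ᵥ θ = a := by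
    rw [hθ, mulVec_mulVec, ← mul_assoc, hRGR, one_mulVec]
  have hRdot (v w : Fin m → ℝ) : (R *ᵥ v) ⬝ᵥ w = v ⬝ᵥ (R *ᵥ w) := by
    rw [dotProduct_mulVec, ← mulVec_transpose, hRt]
  have hq : ⟪Γ (synth a), synth a⟫ = θ ⬝ᵥ θ := by
    rw [← dotProduct_opMatrix_mulVec, ← hG]
    conv_lhs => rw [← hRθ]
    rw [hRdot, mulVec_mulVec, mulVec_mulVec, hRGR, one_mulVec]
  have h1 := hAq a
  rw [hAa, hq] at h1
  have h2 : a ⬝ᵥ T = θ ⬝ᵥ (R *ᵥ T) := by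
    rw [← hRdot, hRθ]
  have h3 := dotProduct_sq_le θ (R *ᵥ T)
  have h4 : 0 ≤ θ ⬝ᵥ θ := dotProduct_self_nonneg' θ
  have h5 : θ ⬝ᵥ θ ≤ 4 * ((R *ᵥ T) ⬝ᵥ (R *ᵥ T)) := by
    rcases h4.eq_or_lt with h | h
    · rw [← h]
      linarith [dotProduct_self_nonneg' (R *ᵥ T)]
    · refine le_of_mul_le_mul_left ?_ h
      have : (1 / 2 * (θ ⬝ᵥ θ)) ^ 2 ≤ (θ ⬝ᵥ (R *ᵥ T)) ^ 2 := by
        rw [← h2]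
        gcongr
      nlinarith
  have h6 : ∑ j, ((n : ℝ)⁻¹ * ∑ i, (⟪β - synth c₀, x i⟫ + σ * e i) *
      (R *ᵥ (coords m (x i))) j) ^ 2 = (R *ᵥ T) ⬝ᵥ (R *ᵥ T) := by
    simp_rw [hV, dotProduct, pow_two]
  rw [hsplit, hq, h6]
  linarith

/-! ### A Bernstein bound and the lower tail of the empirical second moments -/

section Bernstein

variable {Ω : Type*} [MeasurableSpace Ω] {P : Measure Ω} [IsProbabilityMeasure P]

/-- Bernstein's bound for the moment generating function, from `exp x ≤ 1 + x + x²` for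
`|x| ≤ 1`. -/
theorem mgf_le_exp_of_bounded {ξ : Ω → ℝ} (hm : AEMeasurable ξ P) {B v t : ℝ}
    (hB : ∀ ω, |ξ ω| ≤ B) (h0 : ∫ ω, ξ ω ∂P = 0) (hv : ∫ ω, ξ ω ^ 2 ∂P ≤ v) (ht : 0 ≤ t)
    (htB : t * B ≤ 1) : mgf ξ P t ≤ Real.exp (t ^ 2 * v) := by
  have hint : Integrable ξ P := Integrable.of_bound hm.aestronglyMeasurable B (ae_of_all _ hB)
  have hint2 : Integrable (fun ω => ξ ω ^ 2) P :=
    Integrable.of_bound (hm.pow_const 2).aestronglyMeasurable (B ^ 2) (ae_of_all _ fun ω => by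
      rw [Real.norm_eq_abs, abs_pow]
      exact pow_le_pow_left₀ (abs_nonneg _) (hB ω) 2)
  have habs (ω : Ω) : |t * ξ ω| ≤ 1 := by
    rw [abs_mul, abs_of_nonneg ht]
    exact (mul_le_mul_of_nonneg_left (hB ω) ht).trans htB
  have hpt (ω : Ω) : Real.exp (t * ξ ω) ≤ 1 + t * ξ ω + t ^ 2 * ξ ω ^ 2 := by
    have := le_of_abs_le (Real.abs_exp_sub_one_sub_id_le (habs ω))
    linarith [mul_pow t (ξ ω) 2]
  have hi1 : Integrable (fun ω => 1 + t * ξ ω) P := (integrable_const 1).add (hint.const_mul t)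
  calc mgf ξ P t ≤ ∫ ω, (1 + t * ξ ω + t ^ 2 * ξ ω ^ 2) ∂P := by
        refine integral_mono ?_ (hi1.add (hint2.const_mul _)) hpt
        refine Integrable.of_bound (hm.const_mul t).exp.aestronglyMeasurable (Real.exp 1)
          (ae_of_all _ fun ω => ?_)
        rw [Real.norm_eq_abs, Real.abs_exp]
        exact Real.exp_le_exp.2 (le_of_abs_le (habs ω))
    _ = 1 + t ^ 2 * ∫ ω, ξ ω ^ 2 ∂P := by
        rw [integral_add hi1 (hint2.const_mul _), integral_add (integrable_const 1)
          (hint.const_mul t), integral_const_mul, integral_const_mul, h0]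
        simp
    _ ≤ 1 + t ^ 2 * v := by gcongr
    _ ≤ Real.exp (t ^ 2 * v) := by linarith [Real.add_one_le_exp (t ^ 2 * v)]

theorem measure_sum_ge_le_exp {n : ℕ} {ξ : Fin n → Ω → ℝ} (hind : iIndepFun ξ P)
    (hm : ∀ i, AEMeasurable (ξ i) P) {B v t : ℝ} (hB : ∀ i ω, |ξ i ω| ≤ B)
    (h0 : ∀ i, ∫ ω, ξ i ω ∂P = 0) (hv : ∀ i, ∫ ω, ξ i ω ^ 2 ∂P ≤ v) (ht : 0 ≤ t)
    (htB : t * B ≤ 1) (r : ℝ) :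
    P {ω | n * r ≤ ∑ i, ξ i ω} ≤ ENNReal.ofReal (Real.exp (n * (t ^ 2 * v - t * r))) := by
  have hsm : AEMeasurable (∑ i, ξ i) P := Finset.aemeasurable_sum _ fun i _ => hm i
  have hint : Integrable (fun ω => Real.exp (t * (∑ i, ξ i) ω)) P := by
    refine Integrable.of_bound (hsm.const_mul t).exp.aestronglyMeasurable (Real.exp (t * (n * B)))
      (ae_of_all _ fun ω => ?_)
    rw [Real.norm_eq_abs, Real.abs_exp, Real.exp_le_exp]
    refine mul_le_mul_of_nonneg_left ?_ ht
    rw [Finset.sum_apply]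
    refine (Finset.sum_le_card_nsmul _ _ B fun i _ => le_of_abs_le (hB i ω)).trans_eq ?_
    simp
  have h := measure_ge_le_exp_mul_mgf (n * r) ht hint
  simp only [Finset.sum_apply] at h
  rw [← ofReal_measureReal (by finiteness)]
  refine ENNReal.ofReal_le_ofReal (h.trans ?_)
  rw [hind.mgf_sum₀ hm]
  have h1 : ∏ i, mgf (ξ i) P t ≤ ∏ _i : Fin n, Real.exp (t ^ 2 * v) :=
    Finset.prod_le_prod (fun i _ => mgf_nonneg)
      fun i _ => mgf_le_exp_of_bounded (hm i) (hB i) (h0 i) (hv i) ht htB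
  refine (mul_le_mul_of_nonneg_left h1 (Real.exp_pos _).le).trans_eq ?_
  rw [Finset.prod_const, Finset.card_univ, Fintype.card_fin, ← Real.exp_nat_mul, ← Real.exp_add]
  congr 1
  ring

theorem measure_abs_sum_ge_le_exp {n : ℕ} {ξ : Fin n → Ω → ℝ} (hind : iIndepFun ξ P)
    (hm : ∀ i, AEMeasurable (ξ i) P) {B v t : ℝ} (hB : ∀ i ω, |ξ i ω| ≤ B)
    (h0 : ∀ i, ∫ ω, ξ i ω ∂P = 0) (hv : ∀ i, ∫ ω, ξ i ω ^ 2 ∂P ≤ v) (ht : 0 ≤ t)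
    (htB : t * B ≤ 1) (r : ℝ) :
    P {ω | n * r ≤ |∑ i, ξ i ω|} ≤
      ENNReal.ofReal (2 * Real.exp (n * (t ^ 2 * v - t * r))) := by
  have h1 := measure_sum_ge_le_exp hind hm hB h0 hv ht htB r
  have h2 := measure_sum_ge_le_exp (ξ := fun i ω => -ξ i ω)
    (hind.comp (fun _ x => -x) fun _ => measurable_neg) (fun i => (hm i).neg)
    (by simpa using hB) (fun i => by rw [integral_neg, h0, neg_zero]) (by simpa using hv) ht htB r
  rw [two_mul, ENNReal.ofReal_add (by positivity) (by positivity)]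
  refine (measure_mono ?_).trans ((measure_union_le _ _).trans (add_le_add h1 h2))
  intro ω hω
  simp only [Set.mem_ofPred_eq, Set.mem_union, Finset.sum_neg_distrib] at hω ⊢
  exact le_abs.1 hω

theorem integrable_abs_pow_of_lintegral_le {f : Ω → ℝ} (hf : AEMeasurable f P) {K : ℕ} {η : ℝ}
    (hη : 1 ≤ η) (h : ∫⁻ ω, ENNReal.ofReal (|f ω| ^ K) ∂P ≤ ENNReal.ofReal η) {r : ℕ}
    (hr : r ≤ K) :
    Integrable (fun ω => |f ω| ^ r) P ∧ ∫ ω, |f ω| ^ r ∂P ≤ 2 * η := by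
  have hm (s : ℕ) : AEStronglyMeasurable (fun ω => |f ω| ^ s) P := by
    simpa using (hf.norm.pow_const s).aestronglyMeasurable
  have hK : Integrable (fun ω => |f ω| ^ K) P := by
    refine ⟨hm K, ?_⟩
    rw [hasFiniteIntegral_iff_ofReal (ae_of_all _ fun ω => by positivity)]
    exact h.trans_lt ENNReal.ofReal_lt_top
  have hKle : ∫ ω, |f ω| ^ K ∂P ≤ η := by
    rw [← ofReal_integral_eq_lintegral_ofReal hK (ae_of_all _ fun ω => by positivity)] at h
    exact (ENNReal.ofReal_le_ofReal_iff (by linarith)).1 h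
  have hpt (ω : Ω) : |f ω| ^ r ≤ 1 + |f ω| ^ K := by
    rcases le_total |f ω| 1 with h1 | h1
    · have := pow_le_one₀ (n := r) (abs_nonneg (f ω)) h1
      have : 0 ≤ |f ω| ^ K := by positivity
      linarith
    · have := pow_le_pow_right₀ h1 hr
      linarith
  have hdom : Integrable (fun ω => 1 + |f ω| ^ K) P := (integrable_const 1).add hK
  have hint : Integrable (fun ω => |f ω| ^ r) P := hdom.mono' (hm r) (ae_of_all _ fun ω => by
    rw [Real.norm_eq_abs, abs_of_nonneg (by positivity)]
    exact hpt ω)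
  refine ⟨hint, (integral_mono hint hdom hpt).trans ?_⟩
  rw [integral_add (integrable_const 1) hK]
  simp
  linarith

end Bernstein

/-- The truncated products `z_j z_l 1(|z|² ≤ L)`. -/
noncomputable def truncProd {m : ℕ} (L : ℝ) (j l : Fin m) (z : Fin m → ℝ) : ℝ :=
  if z ⬝ᵥ z ≤ L then z j * z l else 0

theorem measurable_truncProd {m : ℕ} (L : ℝ) (j l : Fin m) : Measurable (truncProd L j l) := by
  have h : Measurable fun z : Fin m → ℝ => z ⬝ᵥ z := by
    unfold dotProduct
    fun_prop
  exact Measurable.ite (measurableSet_le h measurable_const) (by fun_prop) measurable_const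

theorem abs_truncProd_le_mul {m : ℕ} (L : ℝ) (j l : Fin m) (z : Fin m → ℝ) :
    |truncProd L j l z| ≤ |z j| * |z l| := by
  unfold truncProd
  split_ifs
  · rw [abs_mul]
  · simp only [abs_zero]
    positivity

theorem abs_truncProd_le {m : ℕ} {L : ℝ} (hL : 0 ≤ L) (j l : Fin m) (z : Fin m → ℝ) :
    |truncProd L j l z| ≤ L := by
  unfold truncProd
  split_ifs with h
  · have h1 (i : Fin m) : z i * z i ≤ L :=
      (Finset.single_le_sum (fun i _ => mul_self_nonneg (z i)) (Finset.mem_univ i)).trans h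
    have := h1 j
    have := h1 l
    rw [abs_le]
    constructor <;> nlinarith [sq_nonneg (z j - z l), sq_nonneg (z j + z l)]
  · simpa using hL

theorem sum_truncProd {m : ℕ} (L : ℝ) (z θ : Fin m → ℝ) :
    ∑ j, ∑ l, θ j * θ l * truncProd L j l z = if z ⬝ᵥ z ≤ L then (z ⬝ᵥ θ) ^ 2 else 0 := by
  unfold truncProd
  split_ifs
  · rw [pow_two, dotProduct, Finset.sum_mul_sum]
    exact Finset.sum_congr rfl fun j _ => Finset.sum_congr rfl fun l _ => by ring
  · simp

section LowerTail

variable {Ω : Type*} [MeasurableSpace Ω] {P : Measure Ω} {n m q : ℕ} {η L : ℝ}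

/-- The second moment lost by truncation. On the tail `|z|² ≤ L^{-q} |z|^{2(q+1)}`, and the power
mean inequality bounds `|z|^{2(q+1)}` by `m^q ∑ z_j^{2(q+1)}`. -/
theorem integral_tail_le {Z : Ω → Fin m → ℝ} (hZ : AEMeasurable Z P)
    (hmom : ∀ j, Integrable (fun ω => |Z ω j| ^ (2 * (q + 1))) P ∧
      ∫ ω, |Z ω j| ^ (2 * (q + 1)) ∂P ≤ η)
    (hL0 : 0 < L) (hL : 4 * η * m ^ (q + 1) ≤ L ^ q) :
    Integrable (fun ω => if Z ω ⬝ᵥ Z ω ≤ L then 0 else Z ω ⬝ᵥ Z ω) P ∧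
      ∫ ω, (if Z ω ⬝ᵥ Z ω ≤ L then 0 else Z ω ⬝ᵥ Z ω) ∂P ≤ 1 / 4 := by
  have hZj (j : Fin m) : AEMeasurable (fun ω => Z ω j) P :=
    (measurable_pi_apply j).comp_aemeasurable hZ
  have hmeas : Measurable fun z : Fin m → ℝ => if z ⬝ᵥ z ≤ L then 0 else z ⬝ᵥ z := by
    have h : Measurable fun z : Fin m → ℝ => z ⬝ᵥ z := by
      unfold dotProduct
      fun_prop
    exact Measurable.ite (measurableSet_le h measurable_const) measurable_const h
  have hpt (z : Fin m → ℝ) : (if z ⬝ᵥ z ≤ L then 0 else z ⬝ᵥ z) ≤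
      (L ^ q)⁻¹ * (m ^ q * ∑ j, |z j| ^ (2 * (q + 1))) := by
    split_ifs with h
    · positivity
    · rw [le_inv_mul_iff₀ (by positivity)]
      push Not at h
      have h0 := dotProduct_self_nonneg' z
      have h1 : L ^ q * (z ⬝ᵥ z) ≤ (z ⬝ᵥ z) ^ (q + 1) := by
        rw [pow_succ]
        gcongr
      refine h1.trans ?_
      have h2 := pow_sum_div_card_le_sum_pow (s := Finset.univ) (f := fun j => |z j| ^ 2)
        (fun j _ => by positivity) q
      have h3 : z ⬝ᵥ z = ∑ j, |z j| ^ 2 := by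
        simp [dotProduct, pow_two]
      rw [h3]
      rcases Nat.eq_zero_or_pos m with rfl | hm
      · simp
      rw [Finset.card_univ, Fintype.card_fin, div_le_iff₀ (by positivity)] at h2
      simp_rw [pow_mul]
      linarith
  have hnn (z : Fin m → ℝ) : 0 ≤ (if z ⬝ᵥ z ≤ L then 0 else z ⬝ᵥ z) := by
    split_ifs
    · exact le_rfl
    · exact dotProduct_self_nonneg' z
  have hdom : Integrable (fun ω => (L ^ q)⁻¹ * (m ^ q * ∑ j, |Z ω j| ^ (2 * (q + 1)))) P :=
    ((integrable_finsetSum _ fun j _ => (hmom j).1).const_mul _).const_mul _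
  have hint : Integrable (fun ω => if Z ω ⬝ᵥ Z ω ≤ L then 0 else Z ω ⬝ᵥ Z ω) P :=
    hdom.mono' (hmeas.comp_aemeasurable hZ).aestronglyMeasurable (ae_of_all _ fun ω => by
      rw [Real.norm_eq_abs, abs_of_nonneg (hnn _)]
      exact hpt _)
  refine ⟨hint, (integral_mono hint hdom fun ω => hpt _).trans ?_⟩
  rw [integral_const_mul, integral_const_mul, integral_finsetSum _ fun j _ => (hmom j).1,
    inv_mul_le_iff₀ (by positivity)]
  have h1 : ∑ j, ∫ ω, |Z ω j| ^ (2 * (q + 1)) ∂P ≤ m * η := by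
    refine (Finset.sum_le_card_nsmul _ _ η fun j _ => (hmom j).2).trans_eq ?_
    simp
  calc (m : ℝ) ^ q * ∑ j, ∫ ω, |Z ω j| ^ (2 * (q + 1)) ∂P ≤ m ^ q * (m * η) := by gcongr
    _ ≤ L ^ q * (1 / 4) := by rw [pow_succ] at hL; linarith

/-- With high probability the empirical second moments of a standardised vector dominate half of
the population ones in all directions. For this lower bound the vectors may be truncated, so that
finitely many moments give an exponentially small probability. -/
theorem exists_bad_set [IsProbabilityMeasure P] {Z : Ω → Fin m → ℝ}
    {Zs : Fin n → Ω → Fin m → ℝ} (hZ : AEMeasurable Z P)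
    (hn : 0 < n) (hind : iIndepFun Zs P) (hid : ∀ i, IdentDistrib (Zs i) Z P P)
    (hcov : ∀ j l, ∫ ω, Z ω j * Z ω l ∂P = if j = l then 1 else 0)
    (hη : 1 ≤ η)
    (hmom4 : ∀ j, Integrable (fun ω => |Z ω j| ^ 4) P ∧ ∫ ω, |Z ω j| ^ 4 ∂P ≤ η)
    (hmom : ∀ j, Integrable (fun ω => |Z ω j| ^ (2 * (q + 1))) P ∧
      ∫ ω, |Z ω j| ^ (2 * (q + 1)) ∂P ≤ η)
    (hm : 0 < m) (hmL : m ≤ L) (hL : 4 * η * m ^ (q + 1) ≤ L ^ q) :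
    ∃ B : Set Ω, P B ≤ ENNReal.ofReal (2 * m ^ 2 * Real.exp (-(n / (64 * η * m * L)))) ∧
      ∀ ω ∉ B, ∀ θ : Fin m → ℝ, 1 / 2 * (θ ⬝ᵥ θ) ≤ (n : ℝ)⁻¹ * ∑ i, (Zs i ω ⬝ᵥ θ) ^ 2 := by
  have hm0 : (0 : ℝ) < m := by exact_mod_cast hm
  have hn0 : (0 : ℝ) < n := by exact_mod_cast hn
  have hL0 : 0 < L := hm0.trans_le hmL
  have hZj (j : Fin m) : AEMeasurable (fun ω => Z ω j) P :=
    (measurable_pi_apply j).comp_aemeasurable hZ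
  set μ : Fin m → Fin m → ℝ := fun j l => ∫ ω, truncProd L j l (Z ω) ∂P with hμ
  have htm (j l : Fin m) : AEMeasurable (fun ω => truncProd L j l (Z ω)) P :=
    (measurable_truncProd L j l).comp_aemeasurable hZ
  have htint (j l : Fin m) : Integrable (fun ω => truncProd L j l (Z ω)) P :=
    Integrable.of_bound (htm j l).aestronglyMeasurable L
      (ae_of_all _ fun ω => abs_truncProd_le hL0.le _ _ _)
  have hμL (j l : Fin m) : |μ j l| ≤ L := by
    have := norm_integral_le_of_norm_le_const (μ := P) (f := fun ω => truncProd L j l (Z ω))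
      (ae_of_all _ fun ω => abs_truncProd_le hL0.le j l (Z ω))
    simpa using this
  set ξ : Fin m → Fin m → Fin n → Ω → ℝ :=
    fun j l i ω => truncProd L j l (Zs i ω) - μ j l with hξ
  have hξid (j l : Fin m) (i : Fin n) :
      IdentDistrib (ξ j l i) (fun ω => truncProd L j l (Z ω) - μ j l) P P :=
    (hid i).comp (u := fun z => truncProd L j l z - μ j l)
      ((measurable_truncProd L j l).sub_const _)
  have hsq (j l : Fin m) (ω : Ω) :
      truncProd L j l (Z ω) ^ 2 ≤ 1 / 2 * (|Z ω j| ^ 4 + |Z ω l| ^ 4) := by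
    have h1 : truncProd L j l (Z ω) ^ 2 ≤ (|Z ω j| * |Z ω l|) ^ 2 := by
      rw [← sq_abs]
      exact pow_le_pow_left₀ (abs_nonneg _) (abs_truncProd_le_mul L j l _) 2
    nlinarith [sq_nonneg (|Z ω j| ^ 2 - |Z ω l| ^ 2)]
  have hvar (j l : Fin m) (i : Fin n) : ∫ ω, ξ j l i ω ^ 2 ∂P ≤ η := by
    have h1 := ((hξid j l i).comp (u := fun x => x ^ 2) (by fun_prop)).integral_eq
    simp only [Function.comp_def] at h1
    rw [h1]
    have hint2 : Integrable (fun ω => truncProd L j l (Z ω) ^ 2) P :=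
      Integrable.of_bound ((htm j l).pow_const 2).aestronglyMeasurable (L ^ 2)
        (ae_of_all _ fun ω => by
          rw [Real.norm_eq_abs, abs_pow]
          exact pow_le_pow_left₀ (abs_nonneg _) (abs_truncProd_le hL0.le _ _ _) 2)
    have h2 : ∫ ω, (truncProd L j l (Z ω) - μ j l) ^ 2 ∂P =
        ∫ ω, truncProd L j l (Z ω) ^ 2 ∂P - μ j l ^ 2 := by
      have h3 (ω : Ω) : (truncProd L j l (Z ω) - μ j l) ^ 2 =
          truncProd L j l (Z ω) ^ 2 - 2 * μ j l * truncProd L j l (Z ω) + μ j l ^ 2 := by ring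
      simp_rw [h3]
      have h4 : Integrable (fun ω => truncProd L j l (Z ω) ^ 2 -
          2 * μ j l * truncProd L j l (Z ω)) P := hint2.sub ((htint j l).const_mul _)
      rw [integral_add h4 (integrable_const _), integral_sub hint2 ((htint j l).const_mul _),
        integral_const_mul]
      simp only [integral_const, probReal_univ, smul_eq_mul, one_mul]
      change _ - 2 * μ j l * μ j l + _ = _
      ring
    have h4 : ∫ ω, truncProd L j l (Z ω) ^ 2 ∂P ≤ η := by
      refine (integral_mono hint2 (((hmom4 j).1.add (hmom4 l).1).const_mul _) (hsq j l)).trans ?_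
      have h5 := integral_add (hmom4 j).1 (hmom4 l).1
      simp only [Pi.add_apply] at h5 ⊢
      rw [integral_const_mul, h5]
      linarith [(hmom4 j).2, (hmom4 l).2]
    rw [h2]
    linarith [sq_nonneg (μ j l)]
  have hmean (j l : Fin m) (i : Fin n) : ∫ ω, ξ j l i ω ∂P = 0 := by
    rw [(hξid j l i).integral_eq, integral_sub (htint j l) (integrable_const _)]
    simp [hμ]
  -- the choice of `t` balances the two terms of the exponent, using `m ≤ L`
  set t : ℝ := 1 / (8 * η * L) with ht
  have ht0 : 0 ≤ t := by positivity
  have htB : t * (2 * L) ≤ 1 := by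
    rw [ht, div_mul_eq_mul_div, div_le_one (by positivity)]
    nlinarith
  have hprob (j l : Fin m) : P {ω | n * (1 / (4 * m)) ≤ |∑ i, ξ j l i ω|} ≤
      ENNReal.ofReal (2 * Real.exp (-(n / (64 * η * m * L)))) := by
    refine (measure_abs_sum_ge_le_exp
      (hind.comp (fun _ z => truncProd L j l z - μ j l)
        fun _ => (measurable_truncProd L j l).sub_const _)
      (fun i => (hξid j l i).aemeasurable_fst) (B := 2 * L) (v := η) (fun i ω => ?_) (hmean j l)
      (hvar j l) ht0 htB _).trans (ENNReal.ofReal_le_ofReal ?_)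
    · have h1 := abs_truncProd_le hL0.le j l (Zs i ω)
      have h2 := hμL j l
      exact (abs_sub _ _).trans (by linarith)
    · have h1 : t ^ 2 * η - t * (1 / (4 * m)) ≤ -(1 / (64 * η * m * L)) := by
        have e1 : t ^ 2 * η - t * (1 / (4 * m)) =
            -(1 / (64 * η * m * L)) * (2 - m / L) := by
          rw [ht]
          field_simp
          ring
        have e2 : m / L ≤ 1 := (div_le_one hL0).2 hmL
        have e3 : 0 ≤ 1 / (64 * η * m * L) := by positivity
        rw [e1]
        nlinarith
      have h2 : n * (t ^ 2 * η - t * (1 / (4 * m))) ≤ -(n / (64 * η * m * L)) := by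
        refine (mul_le_mul_of_nonneg_left h1 hn0.le).trans_eq ?_
        ring
      gcongr
  -- entrywise deviations below `1 / (4m)` change the quadratic form by at most `|θ|² / 4`
  refine ⟨⋃ j, ⋃ l, {ω | n * (1 / (4 * m)) ≤ |∑ i, ξ j l i ω|}, ?_, fun ω hω θ => ?_⟩
  · refine (measure_iUnion_fintype_le _ _).trans ?_
    refine (Finset.sum_le_sum fun j _ => (measure_iUnion_fintype_le _ _).trans
      (Finset.sum_le_sum fun l _ => hprob j l)).trans_eq ?_
    simp only [Finset.sum_const, Finset.card_univ, Fintype.card_fin, nsmul_eq_mul]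
    rw [← ENNReal.ofReal_natCast m, ← ENNReal.ofReal_mul (by positivity),
      ← ENNReal.ofReal_mul (by positivity)]
    congr 1
    ring
  · simp only [Set.mem_iUnion, Set.mem_ofPred_eq, not_exists, not_le] at hω
    have hθ0 : 0 ≤ θ ⬝ᵥ θ := dotProduct_self_nonneg' θ
    -- the truncated population second moment
    have hpop : 3 / 4 * (θ ⬝ᵥ θ) ≤ ∑ j, ∑ l, θ j * θ l * μ j l := by
      obtain ⟨htail, htail_le⟩ := integral_tail_le hZ hmom hL0 hL
      have hprodint (j l : Fin m) : Integrable (fun ω => Z ω j * Z ω l) P := by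
        have hdom : Integrable (fun ω => 1 + 1 / 2 * (|Z ω j| ^ 4 + |Z ω l| ^ 4)) P :=
          (integrable_const 1).add (((hmom4 j).1.add (hmom4 l).1).const_mul _)
        refine hdom.mono' ((hZj j).mul (hZj l)).aestronglyMeasurable (ae_of_all _ fun ω => ?_)
        rw [Real.norm_eq_abs, abs_mul]
        nlinarith [sq_nonneg (|Z ω j| ^ 2 - |Z ω l| ^ 2), sq_nonneg (|Z ω j| * |Z ω l| - 1),
          abs_nonneg (Z ω j), abs_nonneg (Z ω l)]
      have e1 : ∑ j, ∑ l, θ j * θ l * μ j l =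
          ∫ ω, (if Z ω ⬝ᵥ Z ω ≤ L then (Z ω ⬝ᵥ θ) ^ 2 else 0) ∂P := by
        simp_rw [← sum_truncProd]
        rw [integral_finsetSum _ fun j _ => integrable_finsetSum _ fun l _ =>
          (htint j l).const_mul _]
        refine Finset.sum_congr rfl fun j _ => ?_
        rw [integral_finsetSum _ fun l _ => (htint j l).const_mul _]
        exact Finset.sum_congr rfl fun l _ => (integral_const_mul _ _).symm
      have hsqeq (z : Fin m → ℝ) : (z ⬝ᵥ θ) ^ 2 = ∑ j, ∑ l, θ j * θ l * (z j * z l) := by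
        rw [pow_two, dotProduct, Finset.sum_mul_sum]
        exact Finset.sum_congr rfl fun j _ => Finset.sum_congr rfl fun l _ => by ring
      have hsqint : Integrable (fun ω => (Z ω ⬝ᵥ θ) ^ 2) P := by
        simp_rw [hsqeq]
        exact integrable_finsetSum _ fun j _ => integrable_finsetSum _ fun l _ =>
          (hprodint j l).const_mul _
      have e2 : ∫ ω, (Z ω ⬝ᵥ θ) ^ 2 ∂P = θ ⬝ᵥ θ := by
        simp_rw [hsqeq]
        rw [integral_finsetSum _ fun j _ => integrable_finsetSum _ fun l _ =>
          (hprodint j l).const_mul _]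
        refine Finset.sum_congr rfl fun j _ => ?_
        rw [integral_finsetSum _ fun l _ => (hprodint j l).const_mul _]
        simp_rw [integral_const_mul, hcov]
        simp
      have e3 : ∫ ω, ((Z ω ⬝ᵥ θ) ^ 2 - (θ ⬝ᵥ θ) *
          (if Z ω ⬝ᵥ Z ω ≤ L then 0 else Z ω ⬝ᵥ Z ω)) ∂P ≤
          ∫ ω, (if Z ω ⬝ᵥ Z ω ≤ L then (Z ω ⬝ᵥ θ) ^ 2 else 0) ∂P := by
        refine integral_mono (hsqint.sub (htail.const_mul _)) ?_ fun ω => ?_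
        · simp_rw [← sum_truncProd]
          exact integrable_finsetSum _ fun j _ => integrable_finsetSum _ fun l _ =>
            (htint j l).const_mul _
        · dsimp only
          split_ifs
          · simp
          · have := dotProduct_sq_le (Z ω) θ
            linarith
      rw [integral_sub hsqint (htail.const_mul _), integral_const_mul, e2] at e3
      rw [e1]
      nlinarith
    have hdev : |∑ j, ∑ l, θ j * θ l * (∑ i, ξ j l i ω)| ≤ n * (1 / 4) * (θ ⬝ᵥ θ) := by
      have h1 : |∑ j, ∑ l, θ j * θ l * (∑ i, ξ j l i ω)| ≤
          ∑ j, ∑ l, |θ j| * |θ l| * (n * (1 / (4 * m))) := by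
        refine (Finset.abs_sum_le_sum_abs _ _).trans (Finset.sum_le_sum fun j _ => ?_)
        refine (Finset.abs_sum_le_sum_abs _ _).trans (Finset.sum_le_sum fun l _ => ?_)
        rw [abs_mul, abs_mul]
        exact mul_le_mul_of_nonneg_left (hω j l).le (by positivity)
      have h2 : ∑ j, ∑ l, |θ j| * |θ l| * (n * (1 / (4 * m))) =
          (∑ j, |θ j|) ^ 2 * (n * (1 / (4 * m))) := by
        rw [pow_two, Finset.sum_mul_sum, Finset.sum_mul]
        exact Finset.sum_congr rfl fun j _ => by rw [Finset.sum_mul]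
      have h3 : (∑ j, |θ j|) ^ 2 ≤ m * (θ ⬝ᵥ θ) := by
        have := sq_sum_le_card_mul_sum_sq (s := Finset.univ) (f := fun j => |θ j|)
        simpa [dotProduct, ← pow_two] using this
      rw [h2] at h1
      refine h1.trans ((mul_le_mul_of_nonneg_right h3 (by positivity)).trans_eq ?_)
      field_simp
    have hemp : ∑ j, ∑ l, θ j * θ l * (∑ i, ξ j l i ω) =
        ∑ i, (if Zs i ω ⬝ᵥ Zs i ω ≤ L then (Zs i ω ⬝ᵥ θ) ^ 2 else 0) -
          n * ∑ j, ∑ l, θ j * θ l * μ j l := by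
      simp_rw [← sum_truncProd, hξ, Finset.sum_sub_distrib, mul_sub, Finset.sum_sub_distrib]
      congr 1
      · rw [Finset.sum_comm (s := (Finset.univ : Finset (Fin n)))]
        refine Finset.sum_congr rfl fun j _ => ?_
        rw [Finset.sum_comm (s := (Finset.univ : Finset (Fin n)))]
        exact Finset.sum_congr rfl fun l _ => Finset.mul_sum _ _ _
      · simp only [Finset.sum_const, Finset.card_univ, Fintype.card_fin, nsmul_eq_mul,
          Finset.mul_sum]
        exact Finset.sum_congr rfl fun j _ => Finset.sum_congr rfl fun l _ => by ring
    have hle : ∑ i, (if Zs i ω ⬝ᵥ Zs i ω ≤ L then (Zs i ω ⬝ᵥ θ) ^ 2 else 0) ≤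
        ∑ i, (Zs i ω ⬝ᵥ θ) ^ 2 := by
      refine Finset.sum_le_sum fun i _ => ?_
      split_ifs
      · exact le_rfl
      · exact sq_nonneg _
    rw [le_inv_mul_iff₀ hn0]
    rw [hemp] at hdev
    have h1 := neg_le_of_abs_le hdev
    have h2 := mul_le_mul_of_nonneg_left hpop hn0.le
    nlinarith

end LowerTail

/-! ### Moments of the regressor and of the standardised vectors -/

theorem measurable_inner_left (f : L2I) : Measurable fun x : L2I => ⟪f, x⟫ :=
  (continuous_const.inner continuous_id).measurable

theorem measurable_inner_right (f : L2I) : Measurable fun x : L2I => ⟪x, f⟫ :=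
  (continuous_id.inner continuous_const).measurable

theorem measurable_coords (m : ℕ) : Measurable (coords m) :=
  measurable_pi_lambda _ fun i => measurable_inner_right (psi (i + 1))

theorem measurable_mulVec_coords {m : ℕ} (R : Matrix (Fin m) (Fin m) ℝ) :
    Measurable fun x : L2I => R *ᵥ coords m x :=
  (Continuous.matrix_mulVec continuous_const continuous_id).measurable.comp (measurable_coords m)

namespace RegressorClass

variable {Ω : Type*} [MeasurableSpace Ω] {P : Measure Ω} {K : ℕ} {η : ℝ}
  {X : Ω → L2I}

/-- The covariance operator is the one given by the moments. Its defining Bochner integral is over the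
law of `X`, so `id` has to be strongly measurable for that law: it is carried by a separable set. -/
theorem covOp_inner (hX : RegressorClass K η P X) (f g : L2I) :
    ⟪covOp P X f, g⟫ = ∫ ω, ⟪f, X ω⟫ * ⟪g, X ω⟫ ∂P := by
  have hid : MemLp id 2 (P.map X) := by
    refine (memLp_map_measure_iff ?_ hX.measurable.aemeasurable).2 hX.memLp
    obtain ⟨t, ht, hXt⟩ := (aestronglyMeasurable_iff_aemeasurable_separable.1
      hX.memLp.aestronglyMeasurable).2
    refine aestronglyMeasurable_iff_aemeasurable_separable.2
      ⟨aemeasurable_id, closure t, ht.closure, ?_⟩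
    refine (ae_map_iff (p := fun x => x ∈ closure t) hX.measurable.aemeasurable
      isClosed_closure.measurableSet).2 ?_
    exact hXt.mono fun ω hω => subset_closure hω
  rw [covOp, covarianceOperator_inner hid, integral_map hX.measurable.aemeasurable]
  exact ((measurable_inner_left f).mul (measurable_inner_left g)).aestronglyMeasurable

theorem covOp_symm (hX : RegressorClass K η P X) (f g : L2I) :
    ⟪covOp P X f, g⟫ = ⟪f, covOp P X g⟫ := by
  rw [real_inner_comm (covOp P X g), hX.covOp_inner, hX.covOp_inner]
  exact integral_congr_ae (ae_of_all _ fun ω => mul_comm _ _)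

theorem isLinked (hX : RegressorClass K η P X) {υ : ℕ → ℝ} {d : ℝ}
    (hlink : LinkCondition υ d (covOp P X)) : IsLinked υ d (covOp P X) where
  symm := hX.covOp_symm
  pos := hX.pos
  link := hlink

theorem std_apply {m : ℕ} (R : Matrix (Fin m) (Fin m) ℝ) (x : L2I) (j : Fin m) :
    (R *ᵥ coords m x) j = ⟪synth (R j), x⟫ := by
  rw [real_inner_comm, inner_synth, dotProduct_comm]
  rfl

theorem integral_std_mul_std (hX : RegressorClass K η P X) (m : ℕ) (j l : Fin m) :
    ∫ ω, (invSqrt (opMatrix m (covOp P X)) *ᵥ coords m (X ω)) j *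
      (invSqrt (opMatrix m (covOp P X)) *ᵥ coords m (X ω)) l ∂P = if j = l then 1 else 0 := by
  set G := opMatrix m (covOp P X) with hG
  set R := invSqrt G with hR
  have hRGR : R * G * R = 1 := invSqrt_mul_mul_invSqrt (posDef_opMatrix hX.covOp_symm hX.pos m)
  have hRt : Rᵀ = R := invSqrt_transpose G
  simp_rw [std_apply]
  rw [← hX.covOp_inner, inner_synth, coords_apply_synth, dotProduct_comm, ← hG]
  have h : R l ⬝ᵥ (G *ᵥ R j) = (R * G * R) l j := by
    rw [mul_assoc, mul_apply, dotProduct]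
    refine Finset.sum_congr rfl fun a _ => ?_
    rw [mul_apply, mulVec, dotProduct]
    congr 1
    refine Finset.sum_congr rfl fun b _ => ?_
    congr 1
    exact congrFun (congrFun hRt b) j
  rw [h, hRGR, one_apply]
  simp only [eq_comm]

/-- The norm of the regressor has an eighth moment that depends on the class only, because the
variances of its coordinates are bounded by the summable sequence `d υ_j`. -/
theorem integral_norm_pow_eight_le [IsProbabilityMeasure P] (hX : RegressorClass K η P X)
    (hK : 8 ≤ K) (hη : 1 ≤ η)
    {υ : ℕ → ℝ} {d S : ℝ} (hυ : IsDecay υ) (hd : 1 ≤ d)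
    (hlink : LinkCondition υ d (covOp P X))
    (hS : ∀ N, ∑ j ∈ Finset.range N, υ (j + 1) ≤ S) :
    Integrable (fun ω => ‖X ω‖ ^ 8) P ∧ ∫ ω, ‖X ω‖ ^ 8 ∂P ≤ 2 * η * d ^ 4 * S ^ 4 := by
  have hΓ := hX.isLinked hlink
  have hd0 : 0 ≤ d := zero_le_one.trans hd
  have hS0 : 0 ≤ S := by simpa using hS 0
  have hm (j : ℕ) : Measurable fun ω => ⟪X ω, psi (j + 1)⟫ :=
    (measurable_inner_right _).comp hX.measurable
  -- eighth moments of the coordinates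
  have hcoord (j : ℕ) : Integrable (fun ω => ⟪X ω, psi (j + 1)⟫ ^ 8) P ∧
      ∫ ω, ⟪X ω, psi (j + 1)⟫ ^ 8 ∂P ≤ (d * υ (j + 1)) ^ 4 * (2 * η) := by
    set v := ⟪covOp P X (psi (j + 1)), psi (j + 1)⟫ with hv
    have hv0 : 0 < v := hX.pos _ fun h => by
      have := orthonormal_psi.1 j
      simp [h] at this
    obtain ⟨h1, h2⟩ := integrable_abs_pow_of_lintegral_le
      ((hm j).div_const (√v)).aemeasurable hη (hX.moment_coord j) hK
    have heq (ω : Ω) : ⟪X ω, psi (j + 1)⟫ ^ 8 = v ^ 4 * |⟪X ω, psi (j + 1)⟫ / √v| ^ 8 := by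
      have h3 : |⟪X ω, psi (j + 1)⟫ / √v| ^ 8 = ⟪X ω, psi (j + 1)⟫ ^ 8 / (√v ^ 2) ^ 4 := by
        rw [Even.pow_abs (by decide), div_pow]
        ring
      rw [h3, Real.sq_sqrt hv0.le]
      field_simp
    simp_rw [heq]
    refine ⟨h1.const_mul _, ?_⟩
    rw [integral_const_mul]
    have := hΓ.inner_psi_le hυ hd0 j
    gcongr
  -- Jensen's inequality for the weights `υ`, as two applications of the Cauchy-Schwarz inequality
  have hpow (N : ℕ) (x : ℕ → ℝ) : (∑ j ∈ Finset.range N, x j ^ 2) ^ 4 ≤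
      S ^ 3 * ∑ j ∈ Finset.range N, x j ^ 8 / υ (j + 1) ^ 3 := by
    have hp (j : ℕ) := hυ.pos j
    have hne (j : ℕ) := (hυ.pos j).ne'
    have e1 := Finset.sum_sq_le_sum_mul_sum_of_sq_le_mul (Finset.range N)
      (r := fun j => x j ^ 2) (f := fun j => υ (j + 1)) (g := fun j => x j ^ 4 / υ (j + 1))
      (fun j _ => (hp j).le) (fun j _ => div_nonneg (by positivity) (hp j).le)
      (fun j _ => by have := hne j; field_simp; exact le_rfl)
    have e2 := Finset.sum_sq_le_sum_mul_sum_of_sq_le_mul (Finset.range N)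
      (r := fun j => x j ^ 4 / υ (j + 1)) (f := fun j => υ (j + 1))
      (g := fun j => x j ^ 8 / υ (j + 1) ^ 3)
      (fun j _ => (hp j).le) (fun j _ => div_nonneg (by positivity) (pow_nonneg (hp j).le 3))
      (fun j _ => by have := hne j; field_simp; exact le_rfl)
    set A := ∑ j ∈ Finset.range N, υ (j + 1)
    have hA0 : 0 ≤ A := Finset.sum_nonneg fun j _ => (hp j).le
    have hA := hS N
    set C := ∑ j ∈ Finset.range N, x j ^ 4 / υ (j + 1)
    set D := ∑ j ∈ Finset.range N, x j ^ 8 / υ (j + 1) ^ 3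
    have hD0 : 0 ≤ D :=
      Finset.sum_nonneg fun j _ => div_nonneg (by positivity) (pow_nonneg (hp j).le 3)
    calc (∑ j ∈ Finset.range N, x j ^ 2) ^ 4 = ((∑ j ∈ Finset.range N, x j ^ 2) ^ 2) ^ 2 := by ring
      _ ≤ (A * C) ^ 2 := by gcongr
      _ = A ^ 2 * C ^ 2 := by ring
      _ ≤ A ^ 2 * (A * D) := by gcongr
      _ = A ^ 3 * D := by ring
      _ ≤ S ^ 3 * D := by gcongr
  have hfin (N : ℕ) : ∫⁻ ω, ENNReal.ofReal ((∑ j ∈ Finset.range N, ⟪X ω, psi (j + 1)⟫ ^ 2) ^ 4) ∂P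
      ≤ ENNReal.ofReal (2 * η * d ^ 4 * S ^ 4) := by
    have hint : Integrable (fun ω => S ^ 3 *
        ∑ j ∈ Finset.range N, ⟪X ω, psi (j + 1)⟫ ^ 8 / υ (j + 1) ^ 3) P :=
      (integrable_finsetSum _ fun j _ => (hcoord j).1.div_const _).const_mul _
    refine (lintegral_mono fun ω => ENNReal.ofReal_le_ofReal
      (hpow N fun j => ⟪X ω, psi (j + 1)⟫)).trans ?_
    rw [← ofReal_integral_eq_lintegral_ofReal hint (ae_of_all _ fun ω => mul_nonneg (by positivity)
      (Finset.sum_nonneg fun j _ => div_nonneg (by positivity) (pow_nonneg (hυ.pos j).le 3)))]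
    refine ENNReal.ofReal_le_ofReal ?_
    rw [integral_const_mul, integral_finsetSum _ fun j _ => (hcoord j).1.div_const _]
    have h1 : ∑ j ∈ Finset.range N, ∫ ω, ⟪X ω, psi (j + 1)⟫ ^ 8 / υ (j + 1) ^ 3 ∂P ≤
        ∑ j ∈ Finset.range N, υ (j + 1) * (d ^ 4 * (2 * η)) := by
      refine Finset.sum_le_sum fun j _ => ?_
      rw [integral_div, div_le_iff₀ (pow_pos (hυ.pos j) 3)]
      refine (hcoord j).2.trans_eq ?_
      ring
    rw [← Finset.sum_mul] at h1
    have h2 : (∑ j ∈ Finset.range N, υ (j + 1)) * (d ^ 4 * (2 * η)) ≤ S * (d ^ 4 * (2 * η)) :=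
      mul_le_mul_of_nonneg_right (hS N) (by positivity)
    calc S ^ 3 * ∑ j ∈ Finset.range N, ∫ ω, ⟪X ω, psi (j + 1)⟫ ^ 8 / υ (j + 1) ^ 3 ∂P
        ≤ S ^ 3 * (S * (d ^ 4 * (2 * η))) := by gcongr; exact h1.trans h2
      _ = _ := by ring
  have hlim (ω : Ω) : Tendsto (fun N => ENNReal.ofReal
      ((∑ j ∈ Finset.range N, ⟪X ω, psi (j + 1)⟫ ^ 2) ^ 4)) atTop
      (nhds (ENNReal.ofReal (‖X ω‖ ^ 8))) := by
    have h := ((hΓ.hasSum_inner_sq (X ω)).tendsto_sum_nat.pow 4)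
    rw [← pow_mul] at h
    exact (ENNReal.continuous_ofReal.tendsto _).comp h
  have hlint : ∫⁻ ω, ENNReal.ofReal (‖X ω‖ ^ 8) ∂P ≤ ENNReal.ofReal (2 * η * d ^ 4 * S ^ 4) := by
    calc ∫⁻ ω, ENNReal.ofReal (‖X ω‖ ^ 8) ∂P
        = ∫⁻ ω, liminf (fun N => ENNReal.ofReal
          ((∑ j ∈ Finset.range N, ⟪X ω, psi (j + 1)⟫ ^ 2) ^ 4)) atTop ∂P :=
          lintegral_congr fun ω => (hlim ω).liminf_eq.symm
      _ ≤ liminf (fun N => ∫⁻ ω, ENNReal.ofReal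
          ((∑ j ∈ Finset.range N, ⟪X ω, psi (j + 1)⟫ ^ 2) ^ 4) ∂P) atTop :=
          lintegral_liminf_le fun N => ENNReal.measurable_ofReal.comp
            ((Finset.measurable_sum _ fun j _ => (hm j).pow_const 2).pow_const 4)
      _ ≤ _ := by
          refine (liminf_le_liminf (Eventually.of_forall hfin)).trans_eq ?_
          exact liminf_const _
  have hint : Integrable (fun ω => ‖X ω‖ ^ 8) P := by
    refine ⟨(hX.measurable.norm.pow_const 8).aestronglyMeasurable, ?_⟩
    rw [hasFiniteIntegral_iff_ofReal (ae_of_all _ fun ω => by positivity)]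
    exact hlint.trans_lt ENNReal.ofReal_lt_top
  refine ⟨hint, ?_⟩
  rw [← ofReal_integral_eq_lintegral_ofReal hint (ae_of_all _ fun ω => by positivity)] at hlint
  exact (ENNReal.ofReal_le_ofReal_iff (by positivity)).1 hlint

end RegressorClass

theorem integral_mean_sq {Ω : Type*} [MeasurableSpace Ω] {P : Measure Ω} [IsProbabilityMeasure P]
    {n : ℕ} (hn : 0 < n) {ξ : Ω → ℝ} {ξs : Fin n → Ω → ℝ} (hind : iIndepFun ξs P)
    (hid : ∀ i, IdentDistrib (ξs i) ξ P P) (hξ : MemLp ξ 2 P) (h0 : ∫ ω, ξ ω ∂P = 0) :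
    Integrable (fun ω => ((n : ℝ)⁻¹ * ∑ i, ξs i ω) ^ 2) P ∧
      ∫ ω, ((n : ℝ)⁻¹ * ∑ i, ξs i ω) ^ 2 ∂P = (n : ℝ)⁻¹ * ∫ ω, ξ ω ^ 2 ∂P := by
  have hL2 (i : Fin n) : MemLp (ξs i) 2 P := (hid i).memLp_iff.2 hξ
  have hmean (i : Fin n) : ∫ ω, ξs i ω ∂P = 0 := (hid i).integral_eq.trans h0
  have hsum : MemLp (fun ω => ∑ i, ξs i ω) 2 P := memLp_finsetSum _ fun i _ => hL2 i
  simp_rw [mul_pow]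
  refine ⟨hsum.integrable_sq.const_mul _, ?_⟩
  have hvar := IndepFun.variance_sum (s := Finset.univ) (fun i _ => hL2 i)
    fun i _ j _ hij => hind.indepFun hij
  have h1 : ∫ ω, (∑ i, ξs i ω) ∂P = 0 := by
    rw [integral_finsetSum _ fun i _ => (hL2 i).integrable one_le_two]
    exact Finset.sum_eq_zero fun i _ => hmean i
  have h2 : variance (∑ i, ξs i) P = ∫ ω, (∑ i, ξs i ω) ^ 2 ∂P := by
    have e : (∑ i, ξs i) = fun ω => ∑ i, ξs i ω := by
      ext ω
      simp
    rw [e]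
    exact variance_of_integral_eq_zero hsum.aestronglyMeasurable.aemeasurable h1
  have h3 (i : Fin n) : variance (ξs i) P = ∫ ω, ξ ω ^ 2 ∂P := by
    rw [(hid i).variance_eq]
    exact variance_of_integral_eq_zero hξ.aestronglyMeasurable.aemeasurable h0
  rw [integral_const_mul, ← h2, hvar]
  simp_rw [h3]
  rw [Finset.sum_const, Finset.card_univ, Fintype.card_fin, nsmul_eq_mul]
  have : (n : ℝ) ≠ 0 := by positivity
  field_simp

/-! ### The risk bound for fixed dimension and sample size -/

theorem add_pow_four_le (a b : ℝ) : (a + b) ^ 4 ≤ 8 * (a ^ 4 + b ^ 4) := by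
  have h1 : (a + b) ^ 2 ≤ 2 * (a ^ 2 + b ^ 2) := by nlinarith [sq_nonneg (a - b)]
  have h2 : ((a + b) ^ 2) ^ 2 ≤ (2 * (a ^ 2 + b ^ 2)) ^ 2 := by gcongr
  nlinarith [sq_nonneg (a ^ 2 - b ^ 2)]

theorem norm_empCross_pow_four_le {n : ℕ} (x : Fin n → L2I) (e : Fin n → ℝ) {β : L2I} {ρ σ : ℝ}
    (hσ : 0 ≤ σ) (hβ : ‖β‖ ^ 2 ≤ ρ) :
    ‖empCross x fun i => ⟪β, x i⟫ + σ * e i‖ ^ 4 ≤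
      (n : ℝ)⁻¹ * ∑ i, 8 * (ρ ^ 2 * ‖x i‖ ^ 8 + σ ^ 4 * (|e i| ^ 8 + ‖x i‖ ^ 8)) := by
  rcases Nat.eq_zero_or_pos n with rfl | hn
  · simp [empCross]
  have hn0 : (0 : ℝ) < n := by exact_mod_cast hn
  set r : Fin n → ℝ := fun i => ‖β‖ * ‖x i‖ ^ 2 + σ * (|e i| * ‖x i‖) with hr
  have hr0 (i : Fin n) : 0 ≤ r i := by positivity
  have h1 : ‖empCross x fun i => ⟪β, x i⟫ + σ * e i‖ ≤ (n : ℝ)⁻¹ * ∑ i, r i := by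
    rw [empCross, norm_smul, norm_inv, Real.norm_eq_abs, Nat.abs_cast]
    refine mul_le_mul_of_nonneg_left ((norm_sum_le _ _).trans
      (Finset.sum_le_sum fun i _ => ?_)) (by positivity)
    rw [norm_smul, Real.norm_eq_abs]
    have h2 : |⟪β, x i⟫ + σ * e i| ≤ ‖β‖ * ‖x i‖ + σ * |e i| := by
      refine (abs_add_le _ _).trans (add_le_add (abs_real_inner_le_norm _ _) ?_)
      rw [abs_mul, abs_of_nonneg hσ]
    refine (mul_le_mul_of_nonneg_right h2 (norm_nonneg _)).trans_eq ?_
    simp only [hr]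
    ring
  have h2 : ((n : ℝ)⁻¹ * ∑ i, r i) ^ 4 ≤ (n : ℝ)⁻¹ * ∑ i, r i ^ 4 := by
    have h3 := pow_sum_div_card_le_sum_pow (s := Finset.univ) (f := r) (fun i _ => hr0 i) 3
    rw [Finset.card_univ, Fintype.card_fin, div_le_iff₀ (by positivity)] at h3
    rw [mul_pow, inv_pow, inv_mul_le_iff₀ (by positivity)]
    refine h3.trans_eq ?_
    field_simp
  refine (pow_le_pow_left₀ (norm_nonneg _) h1 4).trans (h2.trans ?_)
  refine mul_le_mul_of_nonneg_left (Finset.sum_le_sum fun i _ => ?_) (by positivity)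
  refine (add_pow_four_le _ _).trans ?_
  have h4 : (‖β‖ * ‖x i‖ ^ 2) ^ 4 ≤ ρ ^ 2 * ‖x i‖ ^ 8 := by
    have : ‖β‖ ^ 4 ≤ ρ ^ 2 := by
      rw [show ‖β‖ ^ 4 = (‖β‖ ^ 2) ^ 2 by ring]
      gcongr
    rw [show (‖β‖ * ‖x i‖ ^ 2) ^ 4 = ‖β‖ ^ 4 * ‖x i‖ ^ 8 by ring]
    gcongr
  have h5 : (σ * (|e i| * ‖x i‖)) ^ 4 ≤ σ ^ 4 * (|e i| ^ 8 + ‖x i‖ ^ 8) := by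
    rw [mul_pow]
    refine mul_le_mul_of_nonneg_left ?_ (by positivity)
    nlinarith [sq_nonneg (|e i| ^ 4 - ‖x i‖ ^ 4), sq_nonneg (|e i| ^ 4), sq_nonneg (‖x i‖ ^ 4)]
  gcongr

/-- The split of `(n g)²` into a part with a small expectation and a power of `n`, which is
multiplied by the probability of the bad event. -/
theorem sq_mul_le {n : ℝ} (hn : 0 < n) (g : ℝ) : (n * g) ^ 2 ≤ n⁻¹ ^ 2 * g ^ 4 + n ^ 6 := by
  have h1 := sq_nonneg (n⁻¹ * g ^ 2 - n ^ 3)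
  have h2 : n⁻¹ * n ^ 3 = n ^ 2 := by field_simp
  have h3 : 0 ≤ n ^ 2 * g ^ 2 := by positivity
  have h4 : (n⁻¹ * g ^ 2 - n ^ 3) ^ 2 =
      n⁻¹ ^ 2 * g ^ 4 - 2 * (n⁻¹ * n ^ 3) * g ^ 2 + n ^ 6 := by ring
  rw [h4, h2] at h1
  linarith [mul_pow n g 2]

/-- A crude bound for the loss of the thresholded estimator, which holds without exception. -/
theorem IsLinked.gammaSq_estimator_sub_le_of_norm_le {υ : ℕ → ℝ} {d ρ σ : ℝ} {Γ : L2I →L[ℝ] L2I}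
    (hΓ : IsLinked υ d Γ) (hυ : IsDecay υ) (hd : 0 ≤ d) (hσ : 0 ≤ σ) {n : ℕ}
    (hn : (0 : ℝ) < n) {β : L2I} (hβ : ‖β‖ ^ 2 ≤ ρ) (m : ℕ) (x : Fin n → L2I) (e : Fin n → ℝ) :
    gammaSq Γ (estimator m n x (fun i => ⟪β, x i⟫ + σ * e i) - β) ≤
      2 * d * ((n : ℝ)⁻¹ ^ 2 * ((n : ℝ)⁻¹ *
        ∑ i, 8 * (ρ ^ 2 * ‖x i‖ ^ 8 + σ ^ 4 * (|e i| ^ 8 + ‖x i‖ ^ 8)))) +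
      2 * d * ((n : ℝ) ^ 6 + ρ) := by
  have e3 := norm_estimator_le m hn.le x (fun i => ⟪β, x i⟫ + σ * e i)
  have e4 := norm_empCross_pow_four_le x e hσ hβ
  set bh := estimator m n x (fun i => ⟪β, x i⟫ + σ * e i)
  set w := (n : ℝ)⁻¹ * ∑ i, 8 * (ρ ^ 2 * ‖x i‖ ^ 8 + σ ^ 4 * (|e i| ^ 8 + ‖x i‖ ^ 8))
  set g := ‖empCross x fun i => ⟪β, x i⟫ + σ * e i‖
  have e1 : gammaSq Γ (bh - β) ≤ d * ‖bh - β‖ ^ 2 := hΓ.inner_le hυ hd _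
  have e2 : ‖bh - β‖ ^ 2 ≤ 2 * ‖bh‖ ^ 2 + 2 * ‖β‖ ^ 2 := by
    have : ‖bh - β‖ ^ 2 ≤ (‖bh‖ + ‖β‖) ^ 2 := by
      gcongr
      exact norm_sub_le _ _
    nlinarith [sq_nonneg (‖bh‖ - ‖β‖)]
  have e5 : ‖bh‖ ^ 2 ≤ (n * g) ^ 2 := by gcongr
  have e6 := sq_mul_le hn g
  have e7 : (n : ℝ)⁻¹ ^ 2 * g ^ 4 ≤ (n : ℝ)⁻¹ ^ 2 * w :=
    mul_le_mul_of_nonneg_left e4 (by positivity)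
  have e8 : ‖bh - β‖ ^ 2 ≤ 2 * ((n : ℝ)⁻¹ ^ 2 * w) + 2 * ((n : ℝ) ^ 6 + ρ) := by linarith
  refine e1.trans ((mul_le_mul_of_nonneg_left e8 hd).trans_eq ?_)
  ring

theorem lintegral_le_of_le_add_indicator {Ω : Type*} [MeasurableSpace Ω] {P : Measure Ω}
    {f : Ω → ℝ≥0∞} {F : Ω → ℝ} {B : Set Ω} {c a p : ℝ}
    (hF : Integrable F P) (hF0 : ∀ ω, 0 ≤ F ω) (hFa : ∫ ω, F ω ∂P ≤ a) (hc : 0 ≤ c) (ha : 0 ≤ a)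
    (hp : 0 ≤ p) (hB : P B ≤ ENNReal.ofReal p) (hgood : ∀ ω ∉ B, f ω ≤ ENNReal.ofReal (F ω))
    (hbad : ∀ ω, f ω ≤ ENNReal.ofReal (F ω + c)) :
    ∫⁻ ω, f ω ∂P ≤ ENNReal.ofReal (a + c * p) := by
  calc ∫⁻ ω, f ω ∂P
      ≤ ∫⁻ ω, (ENNReal.ofReal (F ω) + B.indicator (fun _ => ENNReal.ofReal c) ω) ∂P := by
        refine lintegral_mono fun ω => ?_
        by_cases hω : ω ∈ B
        · rw [Set.indicator_of_mem hω, ← ENNReal.ofReal_add (hF0 ω) hc]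
          exact hbad ω
        · rw [Set.indicator_of_notMem hω, add_zero]
          exact hgood ω hω
    _ = ENNReal.ofReal (∫ ω, F ω ∂P) + ∫⁻ ω, B.indicator (fun _ => ENNReal.ofReal c) ω ∂P := by
        rw [lintegral_add_left' hF.aestronglyMeasurable.aemeasurable.ennreal_ofReal,
          ofReal_integral_eq_lintegral_ofReal hF (ae_of_all _ hF0)]
    _ ≤ ENNReal.ofReal a + ENNReal.ofReal c * ENNReal.ofReal p := by
        refine add_le_add (ENNReal.ofReal_le_ofReal hFa) ((lintegral_indicator_const_le _ _).trans ?_)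
        gcongr
    _ = _ := by
        rw [← ENNReal.ofReal_mul hc, ← ENNReal.ofReal_add ha (mul_nonneg hc hp)]

section Risk

variable {Ω : Type*} [MeasurableSpace Ω] {P : Measure Ω} [IsProbabilityMeasure P]
  {K : ℕ} {η σ : ℝ} {X : Ω → L2I} {ε : Ω → ℝ}

theorem integrable_smul_of_classes (hX : RegressorClass K η P X) (hε : ErrorClass K η P ε)
    (hK : 8 ≤ K) (hη : 1 ≤ η) : MemLp ε 2 P ∧ Integrable (fun ω => ε ω • X ω) P := by
  have hε2 : MemLp ε 2 P := by
    have h := (integrable_abs_pow_of_lintegral_le hε.measurable.aemeasurable hη hε.moment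
      (by omega : 2 ≤ K)).1
    simp only [sq_abs] at h
    exact (memLp_two_iff_integrable_sq hε.measurable.aestronglyMeasurable).2 h
  refine ⟨hε2, ?_⟩
  have h := hε2.norm.integrable_mul hX.memLp.norm
  refine h.mono' (hε.measurable.aestronglyMeasurable.smul hX.memLp.aestronglyMeasurable)
    (ae_of_all _ fun ω => ?_)
  rw [norm_smul]
  rfl

/-- The summands of the standardised score are centred, because the regressor is uncorrelated with
the error and, by the Galerkin equations, the residual `⟨h, X⟩` with the first `m` coordinates. -/
theorem score_moments {m : ℕ} (hX : RegressorClass K η P X) (hε : ErrorClass K η P ε)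
    (hK : 8 ≤ K) (hη : 1 ≤ η) (hunc : ∫ ω, ε ω • X ω ∂P = 0) {h : L2I}
    (hgal : coords m (covOp P X h) = 0) {M T : ℝ}
    (hM : Integrable (fun ω => ‖X ω‖ ^ 8) P ∧ ∫ ω, ‖X ω‖ ^ 8 ∂P ≤ M)
    (hT : ‖h‖ ^ 2 ≤ T) (j : Fin m) :
    MemLp (fun ω => (⟪h, X ω⟫ + σ * ε ω) *
        (invSqrt (opMatrix m (covOp P X)) *ᵥ coords m (X ω)) j) 2 P ∧
      ∫ ω, (⟪h, X ω⟫ + σ * ε ω) *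
        (invSqrt (opMatrix m (covOp P X)) *ᵥ coords m (X ω)) j ∂P = 0 ∧
      ∫ ω, ((⟪h, X ω⟫ + σ * ε ω) *
        (invSqrt (opMatrix m (covOp P X)) *ᵥ coords m (X ω)) j) ^ 2 ∂P ≤
          4 * (T ^ 2 * (1 + M) + σ ^ 4 * (2 * η)) + η := by
  set R := invSqrt (opMatrix m (covOp P X)) with hR
  have hhX : Measurable fun ω => ⟪h, X ω⟫ := (measurable_inner_left h).comp hX.measurable
  have hZm : Measurable fun ω => (R *ᵥ coords m (X ω)) j :=
    (measurable_pi_apply j).comp ((measurable_mulVec_coords R).comp hX.measurable)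
  have hU : Measurable fun ω => ⟪h, X ω⟫ + σ * ε ω := hhX.add (hε.measurable.const_mul σ)
  obtain ⟨hZ1, hZ2⟩ := integrable_abs_pow_of_lintegral_le hZm.aemeasurable hη
    (hX.moment_std m j) (by omega : 4 ≤ K)
  obtain ⟨hε1, hε2⟩ := integrable_abs_pow_of_lintegral_le hε.measurable.aemeasurable hη
    hε.moment (by omega : 4 ≤ K)
  have hpt (ω : Ω) : ((⟪h, X ω⟫ + σ * ε ω) * (R *ᵥ coords m (X ω)) j) ^ 2 ≤
      4 * (T ^ 2 * (1 + ‖X ω‖ ^ 8) + σ ^ 4 * |ε ω| ^ 4) +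
        1 / 2 * |(R *ᵥ coords m (X ω)) j| ^ 4 := by
    set u := ⟪h, X ω⟫ + σ * ε ω with hu
    set z := (R *ᵥ coords m (X ω)) j
    have h1 : (u * z) ^ 2 ≤ 1 / 2 * u ^ 4 + 1 / 2 * |z| ^ 4 := by
      rw [Even.pow_abs (by decide)]
      nlinarith [sq_nonneg (u ^ 2 - z ^ 2)]
    have h2 := add_pow_four_le ⟪h, X ω⟫ (σ * ε ω)
    have h3 : ⟪h, X ω⟫ ^ 4 ≤ T ^ 2 * (1 + ‖X ω‖ ^ 8) := by
      have e1 : |⟪h, X ω⟫| ^ 4 ≤ (‖h‖ * ‖X ω‖) ^ 4 :=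
        pow_le_pow_left₀ (abs_nonneg _) (abs_real_inner_le_norm _ _) 4
      rw [Even.pow_abs (by decide)] at e1
      have e2 : ‖h‖ ^ 4 ≤ T ^ 2 := by
        rw [show ‖h‖ ^ 4 = (‖h‖ ^ 2) ^ 2 by ring]
        gcongr
      have e3 : ‖X ω‖ ^ 4 ≤ 1 + ‖X ω‖ ^ 8 := by
        nlinarith [sq_nonneg (‖X ω‖ ^ 4 - 1), sq_nonneg (‖X ω‖ ^ 4)]
      rw [mul_pow] at e1
      exact e1.trans (by gcongr)
    have h4 : (σ * ε ω) ^ 4 = σ ^ 4 * |ε ω| ^ 4 := by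
      rw [Even.pow_abs (by decide), mul_pow]
    linarith
  have hi1 : Integrable (fun ω => 1 + ‖X ω‖ ^ 8) P := (integrable_const 1).add hM.1
  have hi2 : Integrable (fun ω => T ^ 2 * (1 + ‖X ω‖ ^ 8) + σ ^ 4 * |ε ω| ^ 4) P :=
    (hi1.const_mul _).add (hε1.const_mul _)
  have hdom : Integrable (fun ω => 4 * (T ^ 2 * (1 + ‖X ω‖ ^ 8) + σ ^ 4 * |ε ω| ^ 4) +
      1 / 2 * |(R *ᵥ coords m (X ω)) j| ^ 4) P := (hi2.const_mul _).add (hZ1.const_mul _)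
  have hsq : Integrable (fun ω => ((⟪h, X ω⟫ + σ * ε ω) * (R *ᵥ coords m (X ω)) j) ^ 2) P :=
    hdom.mono' ((hU.mul hZm).pow_const 2).aestronglyMeasurable (ae_of_all _ fun ω => by
      rw [Real.norm_eq_abs, abs_of_nonneg (sq_nonneg _)]
      exact hpt ω)
  refine ⟨(memLp_two_iff_integrable_sq (hU.mul hZm).aestronglyMeasurable).2 hsq, ?_, ?_⟩
  · obtain ⟨hεL2, hsmul⟩ := integrable_smul_of_classes hX hε hK hη
    simp_rw [RegressorClass.std_apply]
    set s := synth (R j) with hs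
    have e1 : ∫ ω, ⟪h, X ω⟫ * ⟪s, X ω⟫ ∂P = 0 := by
      rw [← hX.covOp_inner, hs, inner_synth, hgal, zero_dotProduct]
    have e2 : ∫ ω, ⟪s, ε ω • X ω⟫ ∂P = 0 := by
      rw [integral_inner hsmul, hunc, inner_zero_right]
    have e3 (ω : Ω) : (⟪h, X ω⟫ + σ * ε ω) * ⟪s, X ω⟫ =
        ⟪h, X ω⟫ * ⟪s, X ω⟫ + σ * ⟪s, ε ω • X ω⟫ := by
      rw [inner_smul_right]
      ring
    simp_rw [e3]
    have e4 : Integrable (fun ω => ⟪h, X ω⟫ * ⟪s, X ω⟫) P :=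
      (hX.memLp.const_inner h).integrable_mul (hX.memLp.const_inner s)
    rw [integral_add e4 ((hsmul.const_inner s).const_mul σ), integral_const_mul, e1, e2]
    simp
  · refine (integral_mono hsq hdom hpt).trans ?_
    rw [integral_add (hi2.const_mul _) (hZ1.const_mul _), integral_const_mul, integral_const_mul,
      integral_add (hi1.const_mul _) (hε1.const_mul _), integral_const_mul, integral_const_mul,
      integral_add (integrable_const _) hM.1]
    simp only [integral_const, probReal_univ, smul_eq_mul, one_mul]
    have e1 := mul_le_mul_of_nonneg_left hM.2 (sq_nonneg T)
    have e2 := mul_le_mul_of_nonneg_left hε2 (show 0 ≤ σ ^ 4 by positivity)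
    linarith

theorem exists_bad_set_sample {k n m : ℕ} (hX : RegressorClass (4 * k) η P X) (hη : 1 ≤ η)
    (hk : 2 ≤ k) (hn : 0 < n) {L : ℝ} (hmL : (m + 1 : ℕ) ≤ L)
    (hL : 8 * η * (m + 1 : ℕ) ^ (2 * k) ≤ L ^ (2 * k - 1))
    {Xs : Fin n → Ω → L2I} {εs : Fin n → Ω → ℝ} (hs : IsSample n P X ε Xs εs) :
    ∃ B : Set Ω, P B ≤ ENNReal.ofReal
        (2 * (m + 1 : ℕ) ^ 2 * Real.exp (-(n / (128 * η * (m + 1 : ℕ) * L)))) ∧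
      ∀ ω ∉ B, ∀ c : Fin (m + 1) → ℝ, 1 / 2 * ⟪covOp P X (synth c), synth c⟫ ≤
        (n : ℝ)⁻¹ * ∑ i, (coords (m + 1) (Xs i ω) ⬝ᵥ c) ^ 2 := by
  set G := opMatrix (m + 1) (covOp P X) with hG
  set R := invSqrt G with hR
  have hstd : Measurable fun p : L2I × ℝ => R *ᵥ coords (m + 1) p.1 :=
    (measurable_mulVec_coords R).comp measurable_fst
  have hZm : Measurable fun ω => R *ᵥ coords (m + 1) (X ω) :=
    (measurable_mulVec_coords R).comp hX.measurable
  have hmomZ (r : ℕ) (hr : r ≤ 4 * k) (j : Fin (m + 1)) :=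
    integrable_abs_pow_of_lintegral_le (f := fun ω => (R *ᵥ coords (m + 1) (X ω)) j)
      ((measurable_pi_apply j).comp hZm).aemeasurable hη (hX.moment_std (m + 1) j) hr
  obtain ⟨B, hPB, hgood⟩ := exists_bad_set (q := 2 * k - 1) (η := 2 * η) (L := L)
    (Zs := fun i ω => R *ᵥ coords (m + 1) (Xs i ω)) hZm.aemeasurable hn
    (hs.indep.comp (fun _ p => R *ᵥ coords (m + 1) p.1) fun _ => hstd)
    (fun i => (hs.ident i).comp hstd) (hX.integral_std_mul_std (m + 1)) (by linarith)
    (hmomZ 4 (by omega)) (hmomZ _ (by omega)) (Nat.succ_pos m) hmL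
    (by rw [show 2 * k - 1 + 1 = 2 * k by omega]; linarith)
  rw [show 64 * (2 * η) = 128 * η by ring] at hPB
  refine ⟨B, hPB, fun ω hω c => ?_⟩
  have hRdot (v z : Fin (m + 1) → ℝ) : (R *ᵥ v) ⬝ᵥ z = v ⬝ᵥ (R *ᵥ z) := by
    rw [dotProduct_mulVec, ← mulVec_transpose, hR, invSqrt_transpose]
  have hRGR : R * G * R = 1 := invSqrt_mul_mul_invSqrt (posDef_opMatrix hX.covOp_symm hX.pos _)
  set θ := (G * R) *ᵥ c with hθ
  have hRθ : R *ᵥ θ = c := by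
    rw [hθ, mulVec_mulVec, ← mul_assoc, hRGR, one_mulVec]
  have e1 := hgood ω hω θ
  simp_rw [hRdot, hRθ] at e1
  refine le_of_eq_of_le ?_ e1
  rw [← dotProduct_opMatrix_mulVec]
  conv_lhs => rw [← hRθ]
  rw [hRdot, mulVec_mulVec, mulVec_mulVec, hRGR, one_mulVec]

theorem integral_sum_score_sq_le {n m : ℕ} (hn : 0 < n) (hX : RegressorClass K η P X)
    (hε : ErrorClass K η P ε) (hK : 8 ≤ K) (hη : 1 ≤ η) (hunc : ∫ ω, ε ω • X ω ∂P = 0)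
    {Xs : Fin n → Ω → L2I} {εs : Fin n → Ω → ℝ} (hs : IsSample n P X ε Xs εs) {h : L2I}
    (hgal : coords m (covOp P X h) = 0) {M T : ℝ}
    (hM : Integrable (fun ω => ‖X ω‖ ^ 8) P ∧ ∫ ω, ‖X ω‖ ^ 8 ∂P ≤ M) (hT : ‖h‖ ^ 2 ≤ T) :
    Integrable (fun ω => ∑ j, ((n : ℝ)⁻¹ * ∑ i, (⟪h, Xs i ω⟫ + σ * εs i ω) *
        (invSqrt (opMatrix m (covOp P X)) *ᵥ coords m (Xs i ω)) j) ^ 2) P ∧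
      ∫ ω, ∑ j, ((n : ℝ)⁻¹ * ∑ i, (⟪h, Xs i ω⟫ + σ * εs i ω) *
        (invSqrt (opMatrix m (covOp P X)) *ᵥ coords m (Xs i ω)) j) ^ 2 ∂P ≤
          (4 * (T ^ 2 * (1 + M) + σ ^ 4 * (2 * η)) + η) * (m / n) := by
  set R := invSqrt (opMatrix m (covOp P X)) with hR
  have hscore := score_moments (σ := σ) hX hε hK hη hunc hgal hM hT
  set u : Fin m → L2I × ℝ → ℝ := fun j p =>
    (⟪h, p.1⟫ + σ * p.2) * (R *ᵥ coords m p.1) j with hu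
  have hum (j : Fin m) : Measurable (u j) :=
    (((measurable_inner_left h).comp measurable_fst).add (measurable_snd.const_mul σ)).mul
      ((measurable_pi_apply j).comp ((measurable_mulVec_coords R).comp measurable_fst))
  have hvar (j : Fin m) :
      Integrable (fun ω => ((n : ℝ)⁻¹ * ∑ i, u j (Xs i ω, εs i ω)) ^ 2) P ∧
        ∫ ω, ((n : ℝ)⁻¹ * ∑ i, u j (Xs i ω, εs i ω)) ^ 2 ∂P =
          (n : ℝ)⁻¹ * ∫ ω, u j (X ω, ε ω) ^ 2 ∂P := integral_mean_sq hn
    (hs.indep.comp (fun _ => u j) fun _ => hum j) (fun i => (hs.ident i).comp (hum j))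
    (hscore j).1 (hscore j).2.1
  refine ⟨integrable_finsetSum _ fun j _ => (hvar j).1, ?_⟩
  rw [integral_finsetSum _ fun j _ => (hvar j).1]
  refine (Finset.sum_le_card_nsmul _ _ ((n : ℝ)⁻¹ *
    (4 * (T ^ 2 * (1 + M) + σ ^ 4 * (2 * η)) + η)) fun j _ => ?_).trans_eq ?_
  · refine (hvar j).2.trans_le ?_
    exact mul_le_mul_of_nonneg_left (hscore j).2.2 (by positivity)
  · rw [Finset.card_univ, Fintype.card_fin, nsmul_eq_mul]
    ring

theorem integral_mean_moment_le {n : ℕ} (hn : 0 < n) (hε : ErrorClass K η P ε) (hK : 8 ≤ K)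
    (hη : 1 ≤ η) {Xs : Fin n → Ω → L2I} {εs : Fin n → Ω → ℝ} (hs : IsSample n P X ε Xs εs)
    {M : ℝ} (ρ : ℝ) (hM : Integrable (fun ω => ‖X ω‖ ^ 8) P ∧ ∫ ω, ‖X ω‖ ^ 8 ∂P ≤ M) :
    Integrable (fun ω => (n : ℝ)⁻¹ *
        ∑ i, 8 * (ρ ^ 2 * ‖Xs i ω‖ ^ 8 + σ ^ 4 * (|εs i ω| ^ 8 + ‖Xs i ω‖ ^ 8))) P ∧
      ∫ ω, (n : ℝ)⁻¹ *
        ∑ i, 8 * (ρ ^ 2 * ‖Xs i ω‖ ^ 8 + σ ^ 4 * (|εs i ω| ^ 8 + ‖Xs i ω‖ ^ 8)) ∂P ≤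
          8 * (ρ ^ 2 * M + σ ^ 4 * (2 * η + M)) := by
  have hn0 : (0 : ℝ) < n := by exact_mod_cast hn
  set w : L2I × ℝ → ℝ := fun p =>
    8 * (ρ ^ 2 * ‖p.1‖ ^ 8 + σ ^ 4 * (|p.2| ^ 8 + ‖p.1‖ ^ 8)) with hw
  have hwm : Measurable w := by
    have h1 : Measurable fun p : L2I × ℝ => ‖p.1‖ ^ 8 := measurable_fst.norm.pow_const 8
    have h2 : Measurable fun p : L2I × ℝ => |p.2| ^ 8 := measurable_snd.norm.pow_const 8
    exact ((h1.const_mul _).add ((h2.add h1).const_mul _)).const_mul _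
  have hε8 := integrable_abs_pow_of_lintegral_le hε.measurable.aemeasurable hη hε.moment hK
  have hwX : Integrable (fun ω => w (X ω, ε ω)) P :=
    ((hM.1.const_mul _).add ((hε8.1.add hM.1).const_mul _)).const_mul _
  have hwXle : ∫ ω, w (X ω, ε ω) ∂P ≤ 8 * (ρ ^ 2 * M + σ ^ 4 * (2 * η + M)) := by
    have e1 : Integrable (fun ω => |ε ω| ^ 8 + ‖X ω‖ ^ 8) P := hε8.1.add hM.1
    simp only [hw]
    rw [integral_const_mul, integral_add (hM.1.const_mul _) (e1.const_mul _), integral_const_mul,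
      integral_const_mul, integral_add hε8.1 hM.1]
    have := hM.2
    have := hε8.2
    gcongr
  have hwid (i : Fin n) : IdentDistrib (fun ω => w (Xs i ω, εs i ω)) (fun ω => w (X ω, ε ω)) P P :=
    (hs.ident i).comp hwm
  have hwi (i : Fin n) : Integrable (fun ω => w (Xs i ω, εs i ω)) P :=
    (hwid i).integrable_iff.2 hwX
  refine ⟨(integrable_finsetSum _ fun i _ => hwi i).const_mul _, ?_⟩
  rw [integral_const_mul, integral_finsetSum _ fun i _ => hwi i, inv_mul_le_iff₀ hn0]
  refine (Finset.sum_le_card_nsmul _ _ _ fun i _ =>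
    (hwid i).integral_eq.trans_le hwXle).trans_eq ?_
  rw [Finset.card_univ, Fintype.card_fin, nsmul_eq_mul]

/-- The risk is at most a multiple of the squared bias plus the variance `m / n`, provided that the
threshold `n` is harmless and that the lower tail of the empirical second moments is negligible. -/
theorem mpe_le {υ b : ℕ → ℝ} {d ρ S : ℝ} (hυ : IsDecay υ) (hb : IsGrowth b) (hd : 1 ≤ d)
    (hρ : 0 ≤ ρ) (hσ : 0 ≤ σ) (hη : 1 ≤ η) (hS : ∀ N, ∑ j ∈ Finset.range N, υ (j + 1) ≤ S)
    {k n m : ℕ} (hk : 2 ≤ k) (hn : 0 < n) {L : ℝ} (hmL : (m + 1 : ℕ) ≤ L)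
    (hL : 8 * η * (m + 1 : ℕ) ^ (2 * k) ≤ L ^ (2 * k - 1))
    (hthr : 2 * d / υ (m + 1) ≤ n)
    (hexp : (n : ℝ) ^ 7 * (2 * (m + 1 : ℕ) ^ 2 *
      Real.exp (-(n / (128 * η * (m + 1 : ℕ) * L)))) ≤ 1)
    (hX : RegressorClass (4 * k) η P X) (hε : ErrorClass (4 * k) η P ε)
    (hunc : ∫ ω, ε ω • X ω ∂P = 0) (hlink : LinkCondition υ d (covOp P X))
    {Xs : Fin n → Ω → L2I} {εs : Fin n → Ω → ℝ} (hs : IsSample n P X ε Xs εs)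
    {β : L2I} (hβ : weightedSq b β ≤ ENNReal.ofReal ρ) :
    mpe P (covOp P X) (m + 1) n σ Xs εs β ≤ ENNReal.ofReal (
      d * ρ * (υ (m + 2) / b (m + 2)) +
      (4 * (4 * ((4 * d ^ 2 * ρ) ^ 2 * (1 + 2 * η * d ^ 4 * S ^ 4) + σ ^ 4 * (2 * η)) + η) +
        16 * d * (ρ ^ 2 * (2 * η * d ^ 4 * S ^ 4) +
          σ ^ 4 * (2 * η + 2 * η * d ^ 4 * S ^ 4)) +
        2 * d * (1 + ρ)) * ((m + 1 : ℕ) / n)) := by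
  have hd0 : 0 ≤ d := zero_le_one.trans hd
  have hn0 : (0 : ℝ) < n := by exact_mod_cast hn
  have hn1 : (1 : ℝ) ≤ n := by exact_mod_cast hn
  have hK : 8 ≤ 4 * k := by omega
  have hΓ := hX.isLinked hlink
  obtain ⟨c, hgal, hbias, hnorm, hβnorm⟩ := hΓ.exists_galerkin hυ hd hb hρ hβ m
  have hM := hX.integral_norm_pow_eight_le hK hη hυ hd hlink hS
  obtain ⟨hV, hVle⟩ := integral_sum_score_sq_le (σ := σ) hn hX hε hK hη hunc hs hgal hM hnorm
  obtain ⟨hW, hWle⟩ := integral_mean_moment_le (σ := σ) hn hε hK hη hs ρ hM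
  obtain ⟨B, hPB, hgood⟩ := exists_bad_set_sample hX hη hk hn hmL hL hs
  have hgoodle (ω : Ω) (hω : ω ∉ B) := gammaSq_estimator_sub_le (κ := υ (m + 1) / d) (γ := n)
    (σ := σ) (e := fun i => εs i ω) hΓ.symm hΓ.pos (div_pos (hυ.pos m) (by linarith))
    (by
      refine le_trans (le_of_eq ?_) hthr
      have h1 := (hυ.pos m).ne'
      have h2 : d ≠ 0 := by linarith
      field_simp)
    (fun c' => by
      rw [div_mul_eq_mul_div, div_le_iff₀ (by linarith)]
      linarith [hΓ.mul_dotProduct_le hυ hd0 c']) hgal (hgood ω hω)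
  have hbadle (ω : Ω) := hΓ.gammaSq_estimator_sub_le_of_norm_le hυ hd0 hσ hn0 hβnorm (m + 1)
    (fun i => Xs i ω) (fun i => εs i ω)
  set M := 2 * η * d ^ 4 * S ^ 4
  have hM0 : 0 ≤ M := by positivity
  clear_value M
  set Γ := covOp P X
  set V : Ω → ℝ := fun ω => ∑ j, ((n : ℝ)⁻¹ * ∑ i, (⟪β - synth c, Xs i ω⟫ + σ * εs i ω) *
        (invSqrt (opMatrix (m + 1) Γ) *ᵥ coords (m + 1) (Xs i ω)) j) ^ 2 with hVdef
  set W : Ω → ℝ := fun ω => (n : ℝ)⁻¹ *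
    ∑ i, 8 * (ρ ^ 2 * ‖Xs i ω‖ ^ 8 + σ ^ 4 * (|εs i ω| ^ 8 + ‖Xs i ω‖ ^ 8)) with hWdef
  have hV0 (ω : Ω) : 0 ≤ V ω := Finset.sum_nonneg fun j _ => sq_nonneg _
  have hW0 (ω : Ω) : 0 ≤ W ω :=
    mul_nonneg (by positivity) (Finset.sum_nonneg fun i _ => by positivity)
  have hh0 := hΓ.nonneg (β - synth c)
  have hint1 : Integrable (fun ω => ⟪Γ (β - synth c), β - synth c⟫ + 4 * V ω) P :=
    (integrable_const _).add (hV.const_mul 4)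
  have hint2 : Integrable (fun ω => 2 * d * ((n : ℝ)⁻¹ ^ 2 * W ω)) P :=
    (hW.const_mul _).const_mul _
  set p := 2 * ((m + 1 : ℕ) : ℝ) ^ 2 * Real.exp (-(n / (128 * η * (m + 1 : ℕ) * L)))
  have hp0 : 0 ≤ p := by positivity
  clear_value V W p
  have hmn : (n : ℝ)⁻¹ ≤ (m + 1 : ℕ) / n := by
    rw [inv_eq_one_div]
    gcongr
    exact_mod_cast Nat.succ_pos m
  have hninv : (n : ℝ)⁻¹ ^ 2 ≤ (m + 1 : ℕ) / n := by
    refine le_trans ?_ hmn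
    have h1 : (n : ℝ)⁻¹ ≤ 1 := inv_le_one_of_one_le₀ hn1
    exact pow_le_of_le_one (by positivity) h1 two_ne_zero
  have hbb : 0 ≤ d * ρ * (υ (m + 2) / b (m + 2)) := hh0.trans hbias
  set r : ℝ := (m + 1 : ℕ) / n
  have hr0 : 0 ≤ r := by positivity
  clear_value r
  set cV := 4 * ((4 * d ^ 2 * ρ) ^ 2 * (1 + M) + σ ^ 4 * (2 * η)) + η
  have hcV0 : 0 ≤ cV := by positivity
  set cW := ρ ^ 2 * M + σ ^ 4 * (2 * η + M)
  have hcW0 : 0 ≤ cW := by positivity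
  clear_value cV cW
  have hE : ∫ ω, (⟪Γ (β - synth c), β - synth c⟫ + 4 * V ω + 2 * d * ((n : ℝ)⁻¹ ^ 2 * W ω)) ∂P ≤
      d * ρ * (υ (m + 2) / b (m + 2)) + (4 * cV + 16 * d * cW) * r := by
    rw [integral_add hint1 hint2, integral_add (integrable_const _) (hV.const_mul 4),
      integral_const_mul, integral_const_mul, integral_const_mul]
    simp only [integral_const, probReal_univ, smul_eq_mul, one_mul]
    have h1 : (n : ℝ)⁻¹ ^ 2 * ∫ ω, W ω ∂P ≤ r * (8 * cW) :=
      mul_le_mul hninv hWle (integral_nonneg hW0) hr0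
    have h2 := mul_le_mul_of_nonneg_left h1 (show 0 ≤ 2 * d by positivity)
    linarith
  refine (lintegral_le_of_le_add_indicator (c := 2 * d * ((n : ℝ) ^ 6 + ρ)) (hint1.add hint2)
    (fun ω => ?_) hE (by positivity) (by positivity) hp0 hPB (fun ω hω => ?_)
    fun ω => ?_).trans (ENNReal.ofReal_le_ofReal ?_)
  · have h1 := hV0 ω
    have h2 := hW0 ω
    simp only [Pi.add_apply]
    positivity
  · refine ENNReal.ofReal_le_ofReal ((hgoodle ω hω).trans ?_)
    have h1 := hW0 ω
    have h2 : 0 ≤ 2 * d * ((n : ℝ)⁻¹ ^ 2 * W ω) := by positivity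
    simp only [Pi.add_apply, hVdef]
    linarith
  · refine ENNReal.ofReal_le_ofReal ((hbadle ω).trans ?_)
    have h1 := hV0 ω
    simp only [Pi.add_apply, hWdef]
    linarith
  · have h1 : (n : ℝ) ^ 6 * p ≤ (n : ℝ)⁻¹ := by
      rw [← mul_one (n : ℝ)⁻¹, le_inv_mul_iff₀ hn0]
      exact le_of_eq_of_le (by ring) hexp
    have h2 : (n : ℝ) ^ 6 + ρ ≤ (n : ℝ) ^ 6 * (1 + ρ) := by
      have := one_le_pow₀ hn1 (n := 6)
      nlinarith
    have h3 : 2 * d * ((n : ℝ) ^ 6 + ρ) * p ≤ 2 * d * (1 + ρ) * r := by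
      calc 2 * d * ((n : ℝ) ^ 6 + ρ) * p ≤ 2 * d * ((n : ℝ) ^ 6 * (1 + ρ)) * p := by gcongr
        _ = 2 * d * (1 + ρ) * ((n : ℝ) ^ 6 * p) := by ring
        _ ≤ 2 * d * (1 + ρ) * r := by
          gcongr
          exact h1.trans hmn
    linarith

end Risk

/-! ### Asymptotics -/

theorem isGrowth_sobolevWeight {p : ℝ} (hp : 0 < p) : IsGrowth (sobolevWeight p) := by
  refine ⟨by simp [sobolevWeight], monotone_nat_of_le_succ fun j => ?_⟩
  rcases Nat.eq_zero_or_pos j with rfl | hj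
  · simp [sobolevWeight]
  · simp only [sobolevWeight]
    rw [if_neg (by omega), if_neg (by omega)]
    refine Real.rpow_le_rpow (by positivity) ?_ (by positivity)
    exact_mod_cast Nat.div_le_div_right (by omega)

theorem polyWeight_succ (a : ℝ) (j : ℕ) :
    polyWeight a (j + 1) = ((j + 1 : ℕ) : ℝ) ^ (-(2 * a)) := by
  unfold polyWeight
  split_ifs with h
  · obtain rfl : j = 0 := by omega
    simp
  · rfl

theorem isDecay_polyWeight {a : ℝ} (ha : 0 < a) : IsDecay (polyWeight a) := by
  refine ⟨fun j => ?_, fun i j hij => ?_, by simp [polyWeight]⟩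
  · rw [polyWeight_succ]
    positivity
  · simp only [polyWeight_succ]
    refine Real.rpow_le_rpow_of_nonpos (by positivity) ?_ (by linarith)
    exact_mod_cast Nat.succ_le_succ hij

theorem summable_polyWeight {a : ℝ} (ha : 1 / 2 < a) :
    Summable fun j => polyWeight a (j + 1) := by
  simp only [polyWeight_succ]
  exact (summable_nat_add_iff 1).2 (Real.summable_nat_rpow.2 (by linarith))

theorem isDecay_expWeight {a : ℝ} (ha : 0 < a) : IsDecay (expWeight a) := by
  refine ⟨fun j => ?_, antitone_nat_of_succ_le fun j => ?_, by simp [expWeight]⟩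
  · unfold expWeight
    split_ifs
    · exact one_pos
    · positivity
  · rcases Nat.eq_zero_or_pos j with rfl | hj
    · simp [expWeight]
      positivity
    · simp only [expWeight]
      rw [if_neg (by omega), if_neg (by omega), Real.exp_le_exp, neg_le_neg_iff]
      exact Real.rpow_le_rpow (by positivity) (by push_cast; linarith) (by positivity)

theorem isLittleO_exp_neg_mul_rpow {c τ : ℝ} (hc : 0 < c) (hτ : 0 < τ) (r : ℝ) :
    (fun n : ℕ => Real.exp (-c * (n : ℝ) ^ τ)) =o[atTop] fun n : ℕ => (n : ℝ) ^ r := by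
  have h := (isLittleO_exp_neg_mul_rpow_atTop hc (r / τ)).comp_tendsto
    ((tendsto_rpow_atTop hτ).comp tendsto_natCast_atTop_atTop)
  refine h.congr (fun n => rfl) fun n => ?_
  simp only [Function.comp]
  rw [← Real.rpow_mul (by positivity), mul_div_cancel₀ _ hτ.ne']

theorem summable_expWeight {a : ℝ} (ha : 0 < a) : Summable fun j => expWeight a (j + 1) := by
  refine (summable_nat_add_iff (f := expWeight a) 1).2 ?_
  have h := isLittleO_exp_neg_mul_rpow one_pos (show 0 < 2 * a by positivity) (-2)
  refine summable_of_isBigO_nat (Real.summable_nat_rpow.2 (by norm_num : (-2 : ℝ) < -1))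
    (h.isBigO.congr' ?_ EventuallyEq.rfl)
  filter_upwards [eventually_ge_atTop 2] with n hn
  rw [expWeight, if_neg (by omega), neg_one_mul]

/-- Conditions on dimensions and truncation levels under which the rate follows from the risk
bound for fixed dimension and sample size. -/
theorem hasMPERate_of_eventually {υ : ℕ → ℝ} {p ρ d σ η : ℝ} {k : ℕ} {m : ℕ → ℕ} {rate : ℕ → ℝ}
    (hυ : IsDecay υ) (hsum : Summable fun j => υ (j + 1)) (hp : 0 < p) (hρ : 0 ≤ ρ) (hd : 1 ≤ d)
    (hσ : 0 ≤ σ) (hη : 1 ≤ η) (hk : 2 ≤ k) {L : ℕ → ℝ} {c₁ c₂ : ℝ} (hc₁ : 0 < c₁) (hc₂ : 0 < c₂)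
    (hm : ∀ᶠ n in atTop, 0 < m n) (hmL : ∀ᶠ n in atTop, m n ≤ L n)
    (hL : ∀ᶠ n in atTop, 8 * η * (m n : ℝ) ^ (2 * k) ≤ L n ^ (2 * k - 1))
    (hthr : ∀ᶠ n : ℕ in atTop, 2 * d / υ (m n) ≤ n)
    (hexp : ∀ᶠ n : ℕ in atTop, (n : ℝ) ^ 7 * (2 * (m n : ℝ) ^ 2 *
      Real.exp (-(n / (128 * η * m n * L n)))) ≤ 1)
    (hbias : ∀ᶠ n in atTop, υ (m n + 1) / sobolevWeight p (m n + 1) ≤ c₁ * rate n)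
    (hvar : ∀ᶠ n : ℕ in atTop, (m n : ℝ) / n ≤ c₂ * rate n) :
    HasMPERate.{u} υ p ρ d σ η k m rate := by
  have hυ0 (j : ℕ) : 0 ≤ υ (j + 1) := (hυ.pos j).le
  set S := ∑' j, υ (j + 1) with hSdef
  have hS (N : ℕ) : ∑ j ∈ Finset.range N, υ (j + 1) ≤ S :=
    hsum.sum_le_tsum _ fun j _ => hυ0 j
  have hS0 : 0 ≤ S := tsum_nonneg hυ0
  set c : ℝ := 4 * (4 * ((4 * d ^ 2 * ρ) ^ 2 * (1 + 2 * η * d ^ 4 * S ^ 4) +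
    σ ^ 4 * (2 * η)) + η) + 16 * d * (ρ ^ 2 * (2 * η * d ^ 4 * S ^ 4) +
      σ ^ 4 * (2 * η + 2 * η * d ^ 4 * S ^ 4)) + 2 * d * (1 + ρ) with hc
  have hc0 : 0 < c := by positivity
  refine ⟨d * ρ * c₁ + c * c₂, by positivity, ?_⟩
  obtain ⟨N, hN⟩ := eventually_atTop.1 ((eventually_gt_atTop 0).and
    (hm.and (hmL.and (hL.and (hthr.and (hexp.and (hbias.and hvar)))))))
  refine ⟨N, fun n hn Ω _ P _ X ε Xs εs hX hε hunc hlink hs => iSup₂_le fun β hβ => ?_⟩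
  obtain ⟨hn0, hm, hmL, hL, hthr, hexp, hbias, hvar⟩ := hN n hn
  obtain ⟨l, hl⟩ : ∃ l, m n = l + 1 := ⟨m n - 1, by omega⟩
  rw [hl] at hmL hL hthr hexp hbias hvar ⊢
  refine (mpe_le hυ (isGrowth_sobolevWeight hp) hd hρ hσ hη hS hk hn0 hmL hL hthr hexp hX hε hunc
    hlink hs hβ).trans (ENNReal.ofReal_le_ofReal ?_)
  rw [← hc]
  calc d * ρ * (υ (l + 2) / sobolevWeight p (l + 2)) + c * ((l + 1 : ℕ) / n)
      ≤ d * ρ * (c₁ * rate n) + c * (c₂ * rate n) := by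
        have : 0 ≤ d * ρ := by positivity
        gcongr
    _ = (d * ρ * c₁ + c * c₂) * rate n := by ring

/-- The truncation level `L = 8 η m^{1 + 1/(2k-1)}`, which satisfies `8 η m^{2k} ≤ L^{2k-1}`: moments
of order `4k` then bound the second moment lost by truncation. -/
noncomputable def truncLevel (η : ℝ) (k m : ℕ) : ℝ :=
  8 * η * (m : ℝ) ^ (1 + 1 / (2 * (k : ℝ) - 1))

theorem le_truncLevel {η : ℝ} (hη : 1 ≤ η) {k m : ℕ} (hk : 1 ≤ k) (hm : 0 < m) :
    m ≤ truncLevel η k m := by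
  have hm1 : (1 : ℝ) ≤ m := by exact_mod_cast hm
  have hk1 : (1 : ℝ) ≤ k := by exact_mod_cast hk
  have h1 : (m : ℝ) ≤ (m : ℝ) ^ (1 + 1 / (2 * (k : ℝ) - 1)) := by
    conv_lhs => rw [← Real.rpow_one m]
    refine Real.rpow_le_rpow_of_exponent_le hm1 ?_
    have : 0 ≤ 1 / (2 * (k : ℝ) - 1) := by
      refine one_div_nonneg.2 ?_
      linarith
    linarith
  refine h1.trans (le_mul_of_one_le_left (by positivity) ?_)
  linarith

theorem mul_pow_le_truncLevel_pow {η : ℝ} (hη : 1 ≤ η) {k : ℕ} (hk : 1 ≤ k) (m : ℕ) :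
    8 * η * (m : ℝ) ^ (2 * k) ≤ truncLevel η k m ^ (2 * k - 1) := by
  have hk1 : (1 : ℝ) ≤ k := by exact_mod_cast hk
  have h0 : (2 * (k : ℝ) - 1) ≠ 0 := by linarith
  have hcast : ((2 * k - 1 : ℕ) : ℝ) = 2 * (k : ℝ) - 1 := by
    rw [Nat.cast_sub (by omega)]
    push_cast
    ring
  have h1 : ((m : ℝ) ^ (1 + 1 / (2 * (k : ℝ) - 1))) ^ (2 * k - 1) = (m : ℝ) ^ (2 * k) := by
    rw [← Real.rpow_natCast, ← Real.rpow_mul (by positivity), hcast, ← Real.rpow_natCast]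
    congr 1
    push_cast
    field_simp
    ring
  rw [truncLevel, mul_pow, h1]
  refine mul_le_mul_of_nonneg_right (le_self_pow₀ (by linarith) (by omega)) (by positivity)

theorem isLittleO_natCast_rpow {a b : ℝ} (hab : a < b) :
    (fun n : ℕ => (n : ℝ) ^ a) =o[atTop] fun n : ℕ => (n : ℝ) ^ b := by
  have h1 : Tendsto (fun n : ℕ => (n : ℝ) ^ (-(b - a))) atTop (nhds 0) :=
    (tendsto_rpow_neg_atTop (sub_pos.2 hab)).comp tendsto_natCast_atTop_atTop
  refine (isLittleO_of_tendsto' ?_ (h1.congr' ?_))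
  · filter_upwards [eventually_gt_atTop 0] with n hn h
    have hn0 : (0 : ℝ) < n := by exact_mod_cast hn
    exact absurd h (Real.rpow_pos_of_pos hn0 b).ne'
  · filter_upwards [eventually_gt_atTop 0] with n hn
    have hn0 : (0 : ℝ) < n := by exact_mod_cast hn
    rw [← Real.rpow_sub hn0, neg_sub]

/-- For dimensions `O(n^κ)` with `κ (2 + 1/(2k-1)) < 1` the bound for the probability of the bad
event is at most `n^{-7}` for all large `n`: it decays like `exp(-c n^τ)` with `τ > 0`. -/
theorem eventually_tail_le {η κ : ℝ} (hη : 1 ≤ η) {k : ℕ} (hk : 1 ≤ k) (hκ : 0 < κ)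
    (hκk : κ * (2 + 1 / (2 * (k : ℝ) - 1)) < 1) {m : ℕ → ℕ}
    (hm : (fun n => (m n : ℝ)) =O[atTop] fun n : ℕ => (n : ℝ) ^ κ)
    (hm0 : ∀ᶠ n in atTop, 0 < m n) :
    ∀ᶠ n : ℕ in atTop, (n : ℝ) ^ 7 * (2 * (m n : ℝ) ^ 2 *
      Real.exp (-(n / (128 * η * m n * truncLevel η k (m n))))) ≤ 1 := by
  have hk1 : (1 : ℝ) ≤ k := by exact_mod_cast hk
  set δ := 1 / (2 * (k : ℝ) - 1) with hδ
  have hδ0 : 0 < δ := one_div_pos.2 (by linarith)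
  obtain ⟨C, hC, hmC⟩ := hm.exists_pos
  set τ := 1 - κ * (2 + δ) with hτ
  have hτ0 : 0 < τ := by linarith
  set c := (1024 * η ^ 2 * C ^ (2 + δ))⁻¹ with hc
  have hc0 : 0 < c := by positivity
  have hm1 : ∀ᶠ n : ℕ in atTop, (m n : ℝ) ≤ n := by
    have h1 : (fun n : ℕ => (n : ℝ) ^ κ) =o[atTop] fun n : ℕ => (n : ℝ) ^ (1 : ℝ) :=
      isLittleO_natCast_rpow (by nlinarith)
    filter_upwards [(hm.trans_isLittleO h1).bound one_pos] with n hn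
    simpa using hn
  have hexp := (isLittleO_exp_neg_mul_rpow hc0 hτ0 (-9)).bound (c := 1 / 2) (by norm_num)
  filter_upwards [hmC.bound, hm0, hm1, hexp, eventually_gt_atTop 0] with n h1 h2 h3 h4 h5
  have hn0 : (0 : ℝ) < n := by exact_mod_cast h5
  have hmn0 : (0 : ℝ) < m n := by exact_mod_cast h2
  rw [Real.norm_eq_abs, Real.norm_eq_abs, abs_of_pos hmn0, abs_of_pos (by positivity)] at h1
  rw [Real.norm_eq_abs, Real.norm_eq_abs, Real.abs_exp, abs_of_pos (by positivity)] at h4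
  have e1 : 128 * η * m n * truncLevel η k (m n) = 1024 * η ^ 2 * (m n : ℝ) ^ (2 + δ) := by
    have h6 : (m n : ℝ) ^ (2 + δ) = m n * (m n : ℝ) ^ (1 + δ) := by
      rw [show (2 : ℝ) + δ = 1 + (1 + δ) by ring, Real.rpow_add hmn0 1, Real.rpow_one]
    rw [truncLevel, ← hδ, h6]
    ring
  have e2 : (m n : ℝ) ^ (2 + δ) ≤ C ^ (2 + δ) * (n : ℝ) ^ (1 - τ) := by
    refine (Real.rpow_le_rpow hmn0.le h1 (by linarith)).trans_eq ?_
    rw [Real.mul_rpow hC.le (by positivity), ← Real.rpow_mul hn0.le, hτ]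
    ring_nf
  have e3 : c * (n : ℝ) ^ τ ≤ n / (128 * η * m n * truncLevel η k (m n)) := by
    rw [e1, le_div_iff₀ (by positivity)]
    calc c * (n : ℝ) ^ τ * (1024 * η ^ 2 * (m n : ℝ) ^ (2 + δ))
        ≤ c * (n : ℝ) ^ τ * (1024 * η ^ 2 * (C ^ (2 + δ) * (n : ℝ) ^ (1 - τ))) := by gcongr
      _ = (c * (1024 * η ^ 2 * C ^ (2 + δ))) * ((n : ℝ) ^ τ * (n : ℝ) ^ (1 - τ)) := by ring
      _ = n := by
        rw [hc, inv_mul_cancel₀ (by positivity), ← Real.rpow_add hn0, one_mul]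
        simp
  have e4 : Real.exp (-(n / (128 * η * m n * truncLevel η k (m n)))) ≤ 1 / 2 * (n : ℝ) ^ (-9 : ℝ) :=
    le_trans (Real.exp_le_exp.2 (by linarith)) h4
  calc (n : ℝ) ^ 7 * (2 * (m n : ℝ) ^ 2 * Real.exp (-(n / (128 * η * m n * truncLevel η k (m n)))))
      ≤ (n : ℝ) ^ 7 * (2 * (n : ℝ) ^ 2 * (1 / 2 * (n : ℝ) ^ (-9 : ℝ))) := by gcongr
    _ = (n : ℝ) ^ 9 * (n : ℝ) ^ (-9 : ℝ) := by ring
    _ = 1 := by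
      rw [show (n : ℝ) ^ 9 = (n : ℝ) ^ (9 : ℝ) by norm_cast, ← Real.rpow_add hn0]
      simp
    _ ≤ 1 := le_rfl

theorem tendsto_natCast_of_isTheta {m : ℕ → ℕ} {f : ℕ → ℝ}
    (hm : (fun n => (m n : ℝ)) =Θ[atTop] f) (hf : Tendsto f atTop atTop) :
    Tendsto (fun n => (m n : ℝ)) atTop atTop := by
  have h1 : Tendsto (fun n => ‖f n‖) atTop atTop := tendsto_norm_atTop_atTop.comp hf
  have h2 := hm.tendsto_norm_atTop_iff.2 h1
  exact h2.congr fun n => by simp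

theorem hasMPERate_polyWeight {a p ρ d σ η : ℝ} {k : ℕ} {m : ℕ → ℕ} (ha : 1 / 2 < a) (hp : 0 < p)
    (hρ : 0 < ρ) (hd : 1 ≤ d) (hσ : 0 < σ) (hη : 1 ≤ η)
    (hk : 2 + 8 / (2 * p + 2 * a - 1) ≤ (k : ℝ))
    (hm : (fun n : ℕ => (m n : ℝ)) =Θ[atTop] fun n : ℕ => (n : ℝ) ^ (1 / (2 * p + 2 * a + 1))) :
    HasMPERate.{u} (polyWeight a) p ρ d σ η k m
      fun n : ℕ => (n : ℝ) ^ (-((2 * p + 2 * a) / (2 * p + 2 * a + 1))) := by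
  set κ := 1 / (2 * p + 2 * a + 1) with hκ
  have hs : 0 < 2 * p + 2 * a - 1 := by linarith
  have hs1 : 0 < 2 * p + 2 * a + 1 := by linarith
  have hκ0 : 0 < κ := by positivity
  have hk2 : 2 ≤ k := by
    have : 0 ≤ 8 / (2 * p + 2 * a - 1) := by positivity
    have : (2 : ℝ) ≤ k := by linarith
    exact_mod_cast this
  have hk2' : (2 : ℝ) ≤ k := by exact_mod_cast hk2
  have hκk : κ * (2 + 1 / (2 * (k : ℝ) - 1)) < 1 := by
    rw [hκ, div_mul_eq_mul_div, one_mul, div_lt_one hs1]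
    have h1 : 8 / (2 * p + 2 * a - 1) < 2 * (k : ℝ) - 1 := by linarith
    have h2 : 1 / (2 * (k : ℝ) - 1) < 2 * p + 2 * a - 1 := by
      rw [div_lt_iff₀ hs] at h1
      rw [div_lt_iff₀ (by linarith)]
      linarith
    linarith
  have hrate : -((2 * p + 2 * a) / (2 * p + 2 * a + 1)) = -((2 * p + 2 * a) * κ) := by
    rw [hκ]
    ring
  have hrate' : -((2 * p + 2 * a) / (2 * p + 2 * a + 1)) = κ - 1 := by
    rw [hκ]
    field_simp
    ring
  have hpow : Tendsto (fun n : ℕ => (n : ℝ) ^ κ) atTop atTop :=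
    (tendsto_rpow_atTop hκ0).comp tendsto_natCast_atTop_atTop
  have hmtop := tendsto_natCast_of_isTheta hm hpow
  have hm0 : ∀ᶠ n in atTop, 0 < m n := by
    filter_upwards [hmtop.eventually_gt_atTop 0] with n hn
    exact_mod_cast hn
  obtain ⟨C₁, hC₁, hm₁⟩ := hm.1.exists_pos
  obtain ⟨C₂, hC₂, hm₂⟩ := hm.2.exists_pos
  have hup : ∀ᶠ n : ℕ in atTop, (m n : ℝ) ≤ C₁ * (n : ℝ) ^ κ := by
    filter_upwards [hm₁.bound] with n hn
    rwa [Real.norm_eq_abs, Real.norm_eq_abs, Nat.abs_cast, abs_of_nonneg (by positivity)] at hn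
  have hlow : ∀ᶠ n : ℕ in atTop, (n : ℝ) ^ κ ≤ C₂ * m n := by
    filter_upwards [hm₂.bound] with n hn
    rwa [Real.norm_eq_abs, Real.norm_eq_abs, Nat.abs_cast, abs_of_nonneg (by positivity)] at hn
  refine hasMPERate_of_eventually (isDecay_polyWeight (by linarith)) (summable_polyWeight ha) hp
    hρ.le hd hσ.le hη hk2 (L := fun n => truncLevel η k (m n))
    (c₁ := 2 ^ (2 * p) * C₂ ^ (2 * p + 2 * a)) (c₂ := C₁) (by positivity) hC₁ hm0 ?_ ?_ ?_
    (eventually_tail_le hη (by omega) hκ0 hκk hm.1 hm0) ?_ ?_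
  · filter_upwards [hm0] with n hn using le_truncLevel hη (by omega) hn
  · exact Eventually.of_forall fun n => mul_pow_le_truncLevel_pow hη (by omega) _
  · have h1 : (fun n : ℕ => (n : ℝ) ^ (κ * (2 * a))) =o[atTop] fun n : ℕ => (n : ℝ) ^ (1 : ℝ) := by
      refine isLittleO_natCast_rpow ?_
      rw [hκ, div_mul_eq_mul_div, one_mul, div_lt_one hs1]
      linarith
    filter_upwards [hup, hm0, h1.bound (c := (2 * d * C₁ ^ (2 * a))⁻¹) (by positivity)]
      with n h2 h3 h4
    obtain ⟨l, hl⟩ : ∃ l, m n = l + 1 := ⟨m n - 1, by omega⟩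
    rw [Real.norm_eq_abs, Real.norm_eq_abs, abs_of_nonneg (by positivity), Real.rpow_one,
      Nat.abs_cast, le_inv_mul_iff₀ (by positivity)] at h4
    refine le_trans ?_ h4
    rw [hl, polyWeight_succ, ← hl, Real.rpow_neg (by positivity), div_inv_eq_mul, mul_assoc]
    have h5 : (m n : ℝ) ^ (2 * a) ≤ C₁ ^ (2 * a) * (n : ℝ) ^ (κ * (2 * a)) := by
      rw [Real.rpow_mul (Nat.cast_nonneg n) κ (2 * a), ← Real.mul_rpow hC₁.le (by positivity)]
      exact Real.rpow_le_rpow (by positivity) h2 (by linarith)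
    have h6 : 0 ≤ d := by linarith
    calc 2 * (d * (m n : ℝ) ^ (2 * a))
        ≤ 2 * (d * (C₁ ^ (2 * a) * (n : ℝ) ^ (κ * (2 * a)))) := by gcongr
      _ = _ := by ring
  · filter_upwards [hlow, hm0, eventually_gt_atTop 0] with n h2 h3 h4
    have hmn : (0 : ℝ) < m n := by exact_mod_cast h3
    have hn0 : (0 : ℝ) < n := by exact_mod_cast h4
    have h5 : ((m n : ℝ) / 2) ^ (2 * p) ≤ sobolevWeight p (m n + 1) := by
      rw [sobolevWeight, if_neg (by omega)]
      refine Real.rpow_le_rpow (by positivity) ?_ (by positivity)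
      have : m n ≤ 2 * ((m n + 1) / 2) := by omega
      have h6 : (m n : ℝ) ≤ 2 * (((m n + 1) / 2 : ℕ) : ℝ) := by exact_mod_cast this
      linarith
    have h7 : polyWeight a (m n + 1) ≤ (m n : ℝ) ^ (-(2 * a)) := by
      rw [polyWeight_succ]
      refine Real.rpow_le_rpow_of_nonpos hmn (by push_cast; linarith) (by linarith)
    have h8 : ((m n : ℝ)) ^ (-(2 * p + 2 * a)) ≤
        C₂ ^ (2 * p + 2 * a) * (n : ℝ) ^ (-((2 * p + 2 * a) * κ)) := by
      have e1 : (n : ℝ) ^ κ / C₂ ≤ m n := by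
        rw [div_le_iff₀ hC₂]
        linarith
      refine (Real.rpow_le_rpow_of_nonpos (by positivity) e1 (by linarith)).trans_eq ?_
      rw [Real.div_rpow (by positivity) hC₂.le, ← Real.rpow_mul hn0.le, Real.rpow_neg hC₂.le,
        div_inv_eq_mul, mul_comm]
      congr 2
      ring
    rw [hrate]
    calc polyWeight a (m n + 1) / sobolevWeight p (m n + 1)
        ≤ (m n : ℝ) ^ (-(2 * a)) / ((m n : ℝ) / 2) ^ (2 * p) := by gcongr
      _ = 2 ^ (2 * p) * (m n : ℝ) ^ (-(2 * p + 2 * a)) := by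
        rw [Real.div_rpow hmn.le zero_le_two, Real.rpow_neg hmn.le, Real.rpow_neg hmn.le,
          Real.rpow_add hmn]
        field_simp
      _ ≤ 2 ^ (2 * p) * (C₂ ^ (2 * p + 2 * a) * (n : ℝ) ^ (-((2 * p + 2 * a) * κ))) := by gcongr
      _ = _ := by ring
  · filter_upwards [hup, eventually_gt_atTop 0] with n h2 h3
    have hn0 : (0 : ℝ) < n := by exact_mod_cast h3
    rw [hrate', Real.rpow_sub_one hn0.ne', ← mul_div_assoc]
    gcongr

theorem hasMPERate_expWeight {a p ρ d σ η : ℝ} {k : ℕ} {m : ℕ → ℕ} (ha : 0 < a) (hp : 0 < p)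
    (hρ : 0 < ρ) (hd : 1 ≤ d) (hσ : 0 < σ) (hη : 1 ≤ η) (hk : 4 ≤ k)
    (hm : (fun n : ℕ => (m n : ℝ)) =Θ[atTop] fun n : ℕ => Real.log n ^ (1 / (2 * a)))
    (hbal : BalancedDim (expWeight a) p m) :
    HasMPERate.{u} (expWeight a) p ρ d σ η k m
      fun n : ℕ => (n : ℝ)⁻¹ * Real.log n ^ (1 / (2 * a)) := by
  obtain ⟨D, hD, hbal⟩ := hbal
  have hυ := isDecay_expWeight ha
  have hlog : Tendsto (fun n : ℕ => Real.log n) atTop atTop :=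
    Real.tendsto_log_atTop.comp tendsto_natCast_atTop_atTop
  have hpow : Tendsto (fun n : ℕ => Real.log n ^ (1 / (2 * a))) atTop atTop :=
    (tendsto_rpow_atTop (by positivity)).comp hlog
  have hmtop := tendsto_natCast_of_isTheta hm hpow
  have hm0 : ∀ᶠ n in atTop, 0 < m n := by
    filter_upwards [hmtop.eventually_gt_atTop 0] with n hn
    exact_mod_cast hn
  have hmO : (fun n => (m n : ℝ)) =O[atTop] fun n : ℕ => (n : ℝ) ^ (1 / 6 : ℝ) :=
    hm.1.trans ((isLittleO_log_rpow_rpow_atTop (1 / (2 * a)) (by norm_num)).comp_tendsto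
      tendsto_natCast_atTop_atTop).isBigO
  have hκk : (1 / 6 : ℝ) * (2 + 1 / (2 * (k : ℝ) - 1)) < 1 := by
    have h1 : (4 : ℝ) ≤ k := by exact_mod_cast hk
    have h2 : 1 / (2 * (k : ℝ) - 1) ≤ 1 := by
      rw [div_le_one (by linarith)]
      linarith
    linarith
  obtain ⟨C, hC, hmC⟩ := hm.1.exists_pos
  have hvar : ∀ᶠ n : ℕ in atTop,
      (m n : ℝ) / n ≤ C * ((n : ℝ)⁻¹ * Real.log n ^ (1 / (2 * a))) := by
    filter_upwards [hmC.bound, hlog.eventually_ge_atTop 0] with n h1 h2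
    rw [Real.norm_eq_abs, Real.norm_eq_abs, Nat.abs_cast,
      abs_of_nonneg (Real.rpow_nonneg h2 _)] at h1
    calc (m n : ℝ) / n ≤ C * Real.log n ^ (1 / (2 * a)) / n := by gcongr
      _ = _ := by ring
  refine hasMPERate_of_eventually hυ (summable_expWeight ha) hp hρ.le hd hσ.le hη (by omega)
    (L := fun n => truncLevel η k (m n)) (c₁ := 2 * D * C) (c₂ := C) (by positivity) hC hm0 ?_ ?_
    ?_ (eventually_tail_le hη (by omega) (by norm_num) hκk hmO hm0) ?_ hvar
  · filter_upwards [hm0] with n hn using le_truncLevel hη (by omega) hn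
  · exact Eventually.of_forall fun n => mul_pow_le_truncLevel_pow hη (by omega) _
  · filter_upwards [hbal, hm0, hmtop.eventually_ge_atTop (2 * d * D)] with n h1 h2 h3
    obtain ⟨l, hl⟩ : ∃ l, m n = l + 1 := ⟨m n - 1, by omega⟩
    have hpos : 0 < expWeight a (m n) := hl ▸ hυ.pos l
    have h4 := h1.1
    rw [div_le_iff₀ hpos] at h4 ⊢
    have h5 : D * (2 * d) ≤ D * (n * expWeight a (m n)) := by linarith
    exact le_of_mul_le_mul_left h5 (by linarith)
  · filter_upwards [hbal, hm0, hvar, eventually_gt_atTop 0] with n h1 h2 h3 h4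
    have hn0 : (0 : ℝ) < n := by exact_mod_cast h4
    have hb := (isGrowth_sobolevWeight hp).one_le' (m n)
    have hpos := hυ.pos (m n)
    have hm1 : ((m n + 1 : ℕ) : ℝ) ≤ 2 * m n := by
      have : m n + 1 ≤ 2 * m n := by omega
      exact_mod_cast this
    have h5 := h1.2
    rw [← mul_div_assoc, le_div_iff₀ hpos] at h5
    have h6 : expWeight a (m n + 1) / sobolevWeight p (m n + 1) ≤ D * (m n + 1 : ℕ) / n := by
      rw [div_le_div_iff₀ (by linarith) hn0]
      linarith
    calc expWeight a (m n + 1) / sobolevWeight p (m n + 1) ≤ D * (m n + 1 : ℕ) / n := h6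
      _ ≤ D * (2 * m n) / n := by gcongr
      _ = 2 * D * (m n / n) := by ring
      _ ≤ 2 * D * (C * ((n : ℝ)⁻¹ * Real.log n ^ (1 / (2 * a)))) := by gcongr
      _ = _ := by ring

/-- The largest dimension `m` with `m / υ_m ≤ n` balances the exponential case for every order of
smoothness. -/
theorem exists_balancedDim_expWeight {a : ℝ} (ha : 0 < a) :
    ∃ m : ℕ → ℕ,
      (fun n : ℕ => (m n : ℝ)) =Θ[atTop] (fun n : ℕ => Real.log n ^ (1 / (2 * a))) ∧
      ∀ p : ℝ, 0 < p → BalancedDim (expWeight a) p m := by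
  classical
  have hυ := isDecay_expWeight ha
  set m : ℕ → ℕ := fun n => Nat.findGreatest (fun j => (j : ℝ) / expWeight a j ≤ n) n with hm
  have hle (n : ℕ) : (m n : ℝ) / expWeight a (m n) ≤ n :=
    Nat.findGreatest_spec (P := fun j : ℕ => (j : ℝ) / expWeight a j ≤ n) (Nat.zero_le n)
      (by simp)
  have hgt (n : ℕ) : (n : ℝ) < (m n + 1 : ℕ) / expWeight a (m n + 1) := by
    rcases Nat.lt_or_ge n (m n + 1) with h | h
    · have h1 : expWeight a (m n + 1) ≤ 1 := (hυ.anti (Nat.zero_le (m n))).trans hυ.le_one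
      have h2 : (n : ℝ) < (m n + 1 : ℕ) := by exact_mod_cast h
      exact h2.trans_le (le_div_self (by positivity) (hυ.pos _) h1)
    · exact not_le.1 (Nat.findGreatest_is_greatest (Nat.lt_succ_self (m n)) h)
  refine ⟨m, ⟨?_, ?_⟩, fun p hp => ⟨1, le_rfl, Eventually.of_forall fun n => ⟨?_, ?_⟩⟩⟩
  · have hlog : Tendsto (fun n : ℕ => Real.log n) atTop atTop :=
      Real.tendsto_log_atTop.comp tendsto_natCast_atTop_atTop
    refine IsBigO.of_bound 1 ?_
    filter_upwards [hlog.eventually_ge_atTop 1] with n hn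
    have hlog0 : 0 ≤ Real.log n := by linarith
    rw [Real.norm_eq_abs, Real.norm_eq_abs, Nat.abs_cast, abs_of_nonneg (by positivity), one_mul]
    rcases Nat.lt_or_ge (m n) 2 with h | h
    · have h1 : (m n : ℝ) ≤ 1 := by exact_mod_cast Nat.lt_succ_iff.1 h
      exact h1.trans (Real.one_le_rpow hn (by positivity))
    · have h1 := hle n
      have hm1 : (1 : ℝ) ≤ m n := by exact_mod_cast (by omega : 1 ≤ m n)
      rw [expWeight, if_neg (by omega), Real.exp_neg, div_inv_eq_mul] at h1
      have h2 : Real.exp ((m n : ℝ) ^ (2 * a)) ≤ n :=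
        (le_mul_of_one_le_left (Real.exp_pos _).le hm1).trans h1
      have h3 : (m n : ℝ) ^ (2 * a) ≤ Real.log n := by
        rw [Real.le_log_iff_exp_le ((Real.exp_pos _).trans_le h2)]
        exact h2
      calc (m n : ℝ) = ((m n : ℝ) ^ (2 * a)) ^ (1 / (2 * a)) := by
            rw [← Real.rpow_mul (by positivity), mul_one_div_cancel (by positivity), Real.rpow_one]
        _ ≤ Real.log n ^ (1 / (2 * a)) :=
            Real.rpow_le_rpow (by positivity) h3 (by positivity)
  · set c := (1 + 1 / (2 * a)) * 2 ^ (2 * a) with hc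
    have hc0 : 0 < c := by positivity
    refine IsBigO.of_bound (c ^ (1 / (2 * a))) ?_
    filter_upwards [eventually_ge_atTop 1] with n hn
    have hn1 : (1 : ℝ) ≤ n := by exact_mod_cast hn
    have hlog0 : 0 ≤ Real.log n := Real.log_nonneg hn1
    rw [Real.norm_eq_abs, Real.norm_eq_abs, Nat.abs_cast, abs_of_nonneg (by positivity)]
    have h1 := hgt n
    have hm0 : m n ≠ 0 := by
      intro h
      rw [h] at h1
      simp only [expWeight, zero_add, le_refl, if_true, Nat.cast_one, div_one] at h1
      linarith
    have hm1 : (1 : ℝ) ≤ m n := by exact_mod_cast Nat.one_le_iff_ne_zero.2 hm0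
    set x : ℝ := ((m n + 1 : ℕ) : ℝ) with hx
    have hx0 : 0 < x := by positivity
    have hx2 : x ≤ 2 * m n := by
      rw [hx]
      push_cast
      linarith
    rw [expWeight, if_neg (by omega), Real.exp_neg, div_inv_eq_mul] at h1
    have h2 : Real.log n ≤ c * (m n : ℝ) ^ (2 * a) := by
      calc Real.log n ≤ Real.log (x * Real.exp (x ^ (2 * a))) :=
            Real.log_le_log (by linarith) h1.le
        _ = Real.log x + x ^ (2 * a) := by
            rw [Real.log_mul hx0.ne' (Real.exp_pos _).ne', Real.log_exp]
        _ ≤ x ^ (2 * a) / (2 * a) + x ^ (2 * a) := by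
            gcongr
            exact Real.log_le_rpow_div hx0.le (by positivity)
        _ = (1 + 1 / (2 * a)) * x ^ (2 * a) := by ring
        _ ≤ (1 + 1 / (2 * a)) * (2 * m n) ^ (2 * a) := by gcongr
        _ = c * (m n : ℝ) ^ (2 * a) := by
            rw [Real.mul_rpow zero_le_two (by positivity), hc]
            ring
    calc Real.log n ^ (1 / (2 * a)) ≤ (c * (m n : ℝ) ^ (2 * a)) ^ (1 / (2 * a)) :=
          Real.rpow_le_rpow hlog0 h2 (by positivity)
      _ = c ^ (1 / (2 * a)) * m n := by
          rw [Real.mul_rpow hc0.le (by positivity), ← Real.rpow_mul (by positivity) (2 * a),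
            mul_one_div_cancel (by positivity), Real.rpow_one]
  · rw [one_mul]
    exact hle n
  · rw [one_mul]
    refine (hgt n).le.trans ?_
    have hpos := hυ.pos (m n)
    have hb := (isGrowth_sobolevWeight hp).one_le' (m n)
    gcongr
    exact le_mul_of_one_le_right (by positivity) hb

end FLR

theorem proposition4 :
    (∀ (a p ρ d σ η : ℝ) (k : ℕ) (m : ℕ → ℕ),
      1 / 2 < a → 0 < p → 0 < ρ → 1 ≤ d → 0 < σ → 1 ≤ η →
      2 + 8 / (2 * p + 2 * a - 1) ≤ (k : ℝ) →
      (fun n : ℕ => (m n : ℝ)) =Θ[atTop] (fun n : ℕ => (n : ℝ) ^ (1 / (2 * p + 2 * a + 1))) →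
      FLR.HasMPERate.{u} (FLR.polyWeight a) p ρ d σ η k m
        (fun n : ℕ => (n : ℝ) ^ (-((2 * p + 2 * a) / (2 * p + 2 * a + 1))))) ∧
    (∀ a : ℝ, 0 < a →
      (∃ m : ℕ → ℕ,
        (fun n : ℕ => (m n : ℝ)) =Θ[atTop] (fun n : ℕ => Real.log n ^ (1 / (2 * a))) ∧
        ∀ p : ℝ, 0 < p → FLR.BalancedDim (FLR.expWeight a) p m) ∧
      (∀ (p ρ d σ η : ℝ) (k : ℕ) (m : ℕ → ℕ),
        0 < p → 0 < ρ → 1 ≤ d → 0 < σ → 1 ≤ η → 4 ≤ k →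
        (fun n : ℕ => (m n : ℝ)) =Θ[atTop] (fun n : ℕ => Real.log n ^ (1 / (2 * a))) →
        FLR.BalancedDim (FLR.expWeight a) p m →
        FLR.HasMPERate.{u} (FLR.expWeight a) p ρ d σ η k m
          (fun n : ℕ => (n : ℝ)⁻¹ * Real.log n ^ (1 / (2 * a))))) :=
  ⟨fun _ _ _ _ _ _ _ _ ha hp hρ hd hσ hη hk hm =>
      FLR.hasMPERate_polyWeight ha hp hρ hd hσ hη hk hm,
    fun _ ha => ⟨FLR.exists_balancedDim_expWeight ha,
      fun _ _ _ _ _ _ _ hp hρ hd hσ hη hk hm hbal =>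
        FLR.hasMPERate_expWeight ha hp hρ hd hσ hη hk hm hbal⟩⟩
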